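/- For $N\ge 1$ let $\mathbb{GT}_N$ be the set of signatures of length $N$, i.e. integer tuples $\lambda=(\lambda_1\ge\dots\ge\lambda_N)$, and let $s_\lambda(x_1,\dots,x_N)=\det[x_i^{\lambda_j+N-j}]_{i,j=1}^N\big/\prod_{i<j}(x_i-x_j)$ be the Schur function, a symmetric Laurent polynomial. For a probability measure $\rho_N$ on $\mathbb{GT}_N$ define its Schur generating function and its (random) empirical measure by $$S_{\rho_N}(x_1,\dots,x_N)=\sum_{\lambda\in\mathbb{GT}_N}\rho_N(\lambda)\,\frac{s_\lambda(x_1,\dots,x_N)}{s_\lambda(1^N)},\qquad m[\rho_N]=\frac1N\sum_{i=1}^N\delta\!\left(\frac{\lambda_i+N-i}{N}\right),\quad \lambda\sim\rho_N,$$ where $1^m$ denotes the vector of $m$ ones. **Theorem (Law of Large Numbers).** Let $\rho_N$, $N\ge1$, be a sequence of probability measures on $\mathbb{GT}_N$ such that for every $N$ the series $S_{\rho_N}$ converges in an open complex neighborhood of $1^N$. Assume that there is a sequence of functions $F_k(z_1,\dots,z_k)$, $k\ge1$, each symmetric and analytic in a complex neighborhood of $1^k$, such that for every fixed $k\ge 1$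 $$\lim_{N\to\infty}\sqrt[N]{S_{\rho_N}(u_1,\dots,u_k,1^{N-k})}=F_k(u_1,\dots,u_k)$$ uniformly in a complex neighborhood of $1^k$. Here it is understood that, on this neighborhood (which may depend on $k$ but not on $N$) and for all sufficiently large $N$, the series converges and the root is an analytic branch taking the value $1$ at $1^k$. Then, as $N\to\infty$, the random measures $m[\rho_N]$ converge in probability, in the sense of moments, to a deterministic probability measure $\boldsymbol\mu$ on $\mathbb{R}$; that is, $\boldsymbol\mu$ has finite moments $\boldsymbol\mu_k=\int x^k\,\boldsymbol\mu(dx)$ of all orders, and for every $k\ge1$ the random variable $\int x^k\,m[\rho_N](dx)$ converges in probability to $\boldsymbol\mu_k$. Moreover, for every $k\ge1$, $$\boldsymbol\mu_k=\sum_{l=0}^k\binom{k}{l}\frac1{(l+1)!}\;\partial_u^{\,l}\Bigl[(1+u)^k\bigl(\partial_1F_{l+1}(1+u,1+uw_{l+1},1+uw_{l+1}^2,\dots,1+uw_{l+1}^l)\bigr)^{k-l}\Bigr]\Big|_{u=0},$$ where $w_m=\exp(2\pi\sqrt{-1}/m)$ and $\partial_1$ denotes the partial derivative with respect to the first variable.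 -/

import Mathlib

open MeasureTheory Filter Topology

namespace SchurLLN

/-- Signatures of length `N`: non-increasing `N`-tuples of integers. The entry with index
`i : Fin N` is the (`i + 1`)-st entry in the usual one-based numbering. The set of signatures is
countable and carries the discrete sigma-algebra, inherited from `Fin N → ℤ`. -/
abbrev Signature (N : ℕ) : Type := {l : Fin N → ℤ // Antitone l}

/-- The smallest (last) entry of a signature; `0` for the empty signature. -/
def lowest {N : ℕ} (l : Signature N) : ℤ :=
  if h : 0 < N then l.1 ⟨N - 1, Nat.sub_lt h Nat.one_pos⟩ else 0

theorem lowest_le {N : ℕ} (l : Signature N) (i : Fin N) : lowest l ≤ l.1 i := by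
  have hN : 0 < N := i.pos
  unfold lowest
  rw [dif_pos hN]
  apply l.2
  rw [Fin.le_def]
  have := i.isLt
  simp only
  omega

/-- The exponent `(λ_j - λ_N) + N - j` (with one-based `j`), a nonnegative integer. -/
def shiftedExponent {N : ℕ} (l : Signature N) (j : Fin N) : ℕ :=
  (l.1 j - lowest l).toNat + (N - 1 - (j : ℕ))

/-- The alternant `det [X_i ^ (m_j)]` as a polynomial. -/
noncomputable def alternant {N : ℕ} (m : Fin N → ℕ) : MvPolynomial (Fin N) ℂ :=
  Matrix.det (Matrix.of fun i j : Fin N => (MvPolynomial.X i : MvPolynomial (Fin N) ℂ) ^ m j)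

/-- The Vandermonde polynomial `∏_{i < j} (X_i - X_j)`. -/
noncomputable def vandermondePoly (N : ℕ) : MvPolynomial (Fin N) ℂ :=
  ∏ i : Fin N, ∏ j ∈ Finset.Ioi i, (MvPolynomial.X i - MvPolynomial.X j)

/-- Every alternant is divisible by the Vandermonde polynomial. -/
theorem vandermondePoly_dvd_alternant {N : ℕ} (m : Fin N → ℕ) :
    vandermondePoly N ∣ alternant m := by
  classical
  set v : Fin N → MvPolynomial (Fin N) ℂ := fun i => MvPolynomial.X i with hv
  set P : Polynomial (MvPolynomial (Fin N) ℂ) :=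
    ∏ i : Fin N, (Polynomial.X - Polynomial.C (v i)) with hP
  have hPm : P.Monic := Polynomial.monic_prod_of_monic _ _ fun i _ => Polynomial.monic_X_sub_C _
  have hPd : P.natDegree = N := by simp [hP]
  have hroot : ∀ i, P.eval (v i) = 0 := by
    intro i
    rw [hP, Polynomial.eval_prod]
    exact Finset.prod_eq_zero (Finset.mem_univ i) (by simp)
  set C : Matrix (Fin N) (Fin N) (MvPolynomial (Fin N) ℂ) :=
    Matrix.of fun a j => ((Polynomial.X ^ m j) %ₘ P).coeff a with hC
  have key : (Matrix.of fun i j : Fin N => v i ^ m j) = Matrix.vandermonde v * C := by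
    ext1 i j
    rw [Matrix.mul_apply]
    simp only [Matrix.of_apply, Matrix.vandermonde_apply, hC]
    have h1 : v i ^ m j = ((Polynomial.X ^ m j) %ₘ P).eval (v i) := by
      have := congrArg (Polynomial.eval (v i))
        (Polynomial.modByMonic_add_div (Polynomial.X ^ m j) P)
      simp only [Polynomial.eval_add, Polynomial.eval_mul, hroot, zero_mul, add_zero,
        Polynomial.eval_pow, Polynomial.eval_X] at this
      exact this.symm
    rw [h1]
    have hN : 0 < N := i.pos
    have hlt : ((Polynomial.X ^ m j) %ₘ P).natDegree < N := by
      have := Polynomial.natDegree_modByMonic_lt (Polynomial.X ^ m j) hPm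
        (by intro h; rw [h] at hPd; simp at hPd; omega)
      omega
    rw [Polynomial.eval_eq_sum_range' hlt, Finset.sum_range]
    exact Finset.sum_congr rfl fun a _ => mul_comm _ _
  have hdet : alternant m = Matrix.det (Matrix.vandermonde v) * C.det := by
    rw [← Matrix.det_mul, ← key]; rfl
  rw [hdet, Matrix.det_vandermonde]
  refine Dvd.dvd.mul_right ?_ _
  unfold vandermondePoly
  refine Finset.prod_dvd_prod_of_dvd _ _ fun i _ => Finset.prod_dvd_prod_of_dvd _ _ fun j _ => ?_
  exact ⟨-1, by simp [hv]⟩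

/-- The quotient `det [X_i ^ (λ_j - λ_N + N - j)] / ∏_{i < j} (X_i - X_j)` in the polynomial ring
(an integral domain, so that the quotient is unique). -/
noncomputable def schurPoly {N : ℕ} (l : Signature N) : MvPolynomial (Fin N) ℂ :=
  Classical.choose (vandermondePoly_dvd_alternant (shiftedExponent l))

theorem alternant_eq {N : ℕ} (l : Signature N) :
    alternant (shiftedExponent l) = vandermondePoly N * schurPoly l :=
  Classical.choose_spec (vandermondePoly_dvd_alternant (shiftedExponent l))

/-- The value at `x` of the Schur function of a signature, a Laurent polynomial:
`s_λ(x) = (x_1 ⋯ x_N) ^ (λ_N) * s_{λ - λ_N}(x)`. The formula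
`s_λ(x) = det [x_i ^ (λ_j + N - j)] / ∏_{i < j} (x_i - x_j)` is `schur_eq_div`. -/
noncomputable def schur {N : ℕ} (l : Signature N) (x : Fin N → ℂ) : ℂ :=
  (∏ i, x i) ^ lowest l * MvPolynomial.eval x (schurPoly l)

theorem vandermonde_mul_schur {N : ℕ} (l : Signature N) (x : Fin N → ℂ) (hx : ∀ i, x i ≠ 0) :
    (∏ i : Fin N, ∏ j ∈ Finset.Ioi i, (x i - x j)) * schur l x =
      Matrix.det (Matrix.of fun i j : Fin N => x i ^ (l.1 j + (N : ℤ) - 1 - (j : ℤ))) := by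
  have h1 := congrArg (MvPolynomial.eval x) (alternant_eq l)
  rw [map_mul] at h1
  have h2 : MvPolynomial.eval x (vandermondePoly N) =
      ∏ i : Fin N, ∏ j ∈ Finset.Ioi i, (x i - x j) := by
    simp [vandermondePoly, map_prod]
  have h3 : MvPolynomial.eval x (alternant (shiftedExponent l)) =
      Matrix.det (Matrix.of fun i j : Fin N => x i ^ shiftedExponent l j) := by
    unfold alternant
    rw [RingHom.map_det]
    congr 1
    ext i j
    simp
  have h4 : (Matrix.of fun i j : Fin N => x i ^ (l.1 j + (N : ℤ) - 1 - (j : ℤ))) =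
      Matrix.of fun i j : Fin N =>
        x i ^ lowest l * (Matrix.of fun i j : Fin N => x i ^ shiftedExponent l j) i j := by
    ext i j
    simp only [Matrix.of_apply]
    rw [← zpow_natCast, ← zpow_add₀ (hx i)]
    congr 1
    have := lowest_le l j
    have := j.isLt
    unfold shiftedExponent
    omega
  rw [h4, Matrix.det_mul_column, ← h3, h1, h2, schur, Finset.prod_zpow]
  ring

theorem schur_eq_div {N : ℕ} (l : Signature N) (x : Fin N → ℂ) (hx : ∀ i, x i ≠ 0)
    (hinj : Function.Injective x) :
    schur l x =
      Matrix.det (Matrix.of fun i j : Fin N => x i ^ (l.1 j + (N : ℤ) - 1 - (j : ℤ))) /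
        ∏ i : Fin N, ∏ j ∈ Finset.Ioi i, (x i - x j) := by
  rw [eq_div_iff, mul_comm, vandermonde_mul_schur l x hx]
  refine Finset.prod_ne_zero_iff.2 fun i _ => Finset.prod_ne_zero_iff.2 fun j hj => ?_
  exact sub_ne_zero.2 fun h => (Finset.mem_Ioi.1 hj).ne (hinj h)

/-- The term `ρ(λ) s_λ(x) / s_λ(1^N)` of the Schur generating function. -/
noncomputable def sgfTerm {N : ℕ} (ρ : Measure (Signature N)) (x : Fin N → ℂ)
    (l : Signature N) : ℂ :=
  (ρ.real {l} : ℂ) * (schur l x / schur l (fun _ => 1))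

/-- The Schur generating function `S_ρ(x) = ∑_λ ρ(λ) s_λ(x) / s_λ(1^N)`. -/
noncomputable def schurGF {N : ℕ} (ρ : Measure (Signature N)) (x : Fin N → ℂ) : ℂ :=
  ∑' l : Signature N, sgfTerm ρ x l

/-- The point `(u_1, …, u_k, 1^{N-k})` (used for `k ≤ N`). -/
noncomputable def padOnes {k : ℕ} (N : ℕ) (u : Fin k → ℂ) : Fin N → ℂ :=
  fun i => if h : (i : ℕ) < k then u ⟨i, h⟩ else 1

/-- `R` is, on the set `U`, the `N`-th root of `u ↦ S_ρ(u_1, …, u_k, 1^{N-k})`: the series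
converges on `U`, and `R` is an analytic branch of the root, with value `1` at `1^k`
(where `S_ρ` equals `1`). -/
structure IsRootBranch {N k : ℕ} (ρ : Measure (Signature N)) (U : Set (Fin k → ℂ))
    (R : (Fin k → ℂ) → ℂ) : Prop where
  summable : ∀ u ∈ U, Summable (sgfTerm ρ (padOnes N u))
  analytic : AnalyticOnNhd ℂ R U
  map_one : R (fun _ => 1) = 1
  pow_eq : ∀ u ∈ U, R u ^ N = schurGF ρ (padOnes N u)

/-- `lim_{N → ∞} (S_{ρ_N}(u_1, …, u_k, 1^{N-k}))^{1/N} = f(u_1, …, u_k)`, uniformly in a complex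
neighborhood of `1^k`. -/
def RootConverges (ρ : ∀ N : ℕ, Measure (Signature N)) (k : ℕ) (f : (Fin k → ℂ) → ℂ) : Prop :=
  ∃ U : Set (Fin k → ℂ), IsOpen U ∧ (fun _ => 1) ∈ U ∧
    ∃ R : ℕ → (Fin k → ℂ) → ℂ,
      (∀ᶠ N in atTop, IsRootBranch (ρ N) U (R N)) ∧ TendstoUniformlyOn R f atTop U

/-- The empirical measure `(1/N) ∑_i δ((λ_i + N - i) / N)` (one-based `i`). -/
noncomputable def empiricalMeasure {N : ℕ} (l : Signature N) : Measure ℝ :=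
  (N : ENNReal)⁻¹ • ∑ i : Fin N, Measure.dirac (((l.1 i : ℝ) + N - 1 - (i : ℕ)) / N)

/-- The partial derivative with respect to the first variable. -/
noncomputable def partialFirst {l : ℕ} (f : (Fin (l + 1) → ℂ) → ℂ) (x : Fin (l + 1) → ℂ) : ℂ :=
  deriv (fun z : ℂ => f (Function.update x 0 z)) (x 0)

/-- The primitive root of unity `w_m = exp(2πi/m)`. -/
noncomputable def rootOfUnity (m : ℕ) : ℂ :=
  Complex.exp (2 * Real.pi * Complex.I / m)

/-- The limiting moment
`∑_{l=0}^k C(k,l) / (l+1)! *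
  ∂_u^l [(1+u)^k (∂_1 F_{l+1}(1+u, 1+u w_{l+1}, …, 1+u w_{l+1}^l))^{k-l}]` at `u = 0`. -/
noncomputable def limitMoment (F : ∀ k : ℕ, (Fin k → ℂ) → ℂ) (k : ℕ) : ℂ :=
  ∑ l ∈ Finset.range (k + 1), (k.choose l : ℂ) * (1 / ((l + 1).factorial : ℂ)) *
    iteratedDeriv l
      (fun u : ℂ => (1 + u) ^ k *
        partialFirst (F (l + 1))
          (fun j : Fin (l + 1) => 1 + u * rootOfUnity (l + 1) ^ (j : ℕ)) ^ (k - l)) 0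

end SchurLLN

/-!
The Schur generating functions are studied as formal power series at `1^N`, in the variables
`X_i = x_i - 1`. The reason for the law of large numbers is that Schur functions are eigenvectors of
simple differential operators: since `∏_{i < j} (x_i - x_j) s_λ(x)` is a sum of Laurent monomials
whose exponents are the permutations of the positions `l_i = λ_i + N - i`, the operator
`V⁻¹ ∑_i x_i^k ∂_i^k V`, with `V` the Vandermonde product, multiplies `s_λ` by
`∑_i l_i (l_i - 1) ⋯ (l_i - k + 1)` (`momentOp_taylor_normSchur`). Applying it once or twice to the
generating function and evaluating at `1^N` gives the first two moments, over `λ`, of these sums.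

The singularity of `V⁻¹` at `1^N` is resolved algebraically. Expanded by the Leibniz rule, the
operator is a sum over sets `I` of `m + 1 ≤ k + 1` variables of divided symmetrizations
`∑_{i ∈ I} h_i / ∏_{j ∈ I, j ≠ i} (X_i - X_j)` (`mul_momentOp`), which are iterated divided
differences and hence power series with coefficients controlled uniformly in `N`
(`exists_bddBy_divSym`). Restricting to the line `X_j = w^j u` through the `(m+1)`-st roots of unity
shows that the value at `0` of such a symmetrization is a single Taylor coefficient along this line
(`constantCoeff_divSym`); this is the origin of the roots of unity in the limiting moments.

The hypothesis on the `N`-th roots says that the logarithmic derivatives `N⁻¹ ∂_i S / S` converge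
when restricted to any fixed number of variables (`logDerivConverges_schurSeries`). If `Q` is a
symmetric power series with coefficients bounded uniformly in `N`, the operator maps `Q S` to
`N^{k+1} Q' S`, where `Q'` is of the same kind and, up to `o(1)`, its value at `0` is that of `Q`
times a constant depending only on `k` (`tendsto_constantCoeff_momentQuot`). With `Q = 1` and then
`Q = Q'` the first two moments converge to those of a constant, so that the normalized factorial
moments concentrate (`tendstoInProb_mixedMoment_zero`), and with them the moments of the empirical
measures. The constant is the stated one because a symmetric function is constant up to order `m`
along the line through the `(m+1)`-st roots of unity (`formalMoment_limitSeries`).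

The expansion at `1^N` of the generating function may be taken term by term since Schur polynomials
have nonnegative coefficients (`exists_det_pow_eq`): their values near `1^N` are dominated by those
at the vertices of a real cube (`norm_normSchur_le`), where the series converges by hypothesis.
Finally, the limits of the moments are limits of moments of empirical measures of suitable
deterministic signatures; these are tight, and Prokhorov's theorem provides the limiting measure
(`exists_measure_of_tendsto_moments`).
-/

namespace SchurLLN

/-! ### Permutations of the variables and divided differences -/

section DividedDifferences

open MvPowerSeries

set_option linter.unusedSectionVars false

variable {σ : Type*} [DecidableEq σ]

theorem coeff_congr {α β : σ →₀ ℕ} (h : α = β) (f : MvPowerSeries σ ℂ) :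
    coeff α f = coeff β f := by rw [h]

theorem coeff_X_mul_eq_ite (i : σ) (g : MvPowerSeries σ ℂ) (α : σ →₀ ℕ) :
    coeff α (X i * g) = if α i = 0 then 0 else coeff (α - Finsupp.single i 1) g := by
  rw [show (X i : MvPowerSeries σ ℂ) = monomial (Finsupp.single i 1) 1 from rfl,
    coeff_monomial_mul]
  by_cases h : α i = 0
  · simp [h]
  · rw [if_pos, if_neg h, one_mul]
    simpa using Nat.one_le_iff_ne_zero.2 h

/-- The action of a permutation of the variables. -/
noncomputable def permAct (π : Equiv.Perm σ) : MvPowerSeries σ ℂ ≃ₐ[ℂ] MvPowerSeries σ ℂ :=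
  renameEquiv ℂ π

theorem coeff_permAct (π : Equiv.Perm σ) (f : MvPowerSeries σ ℂ) (α : σ →₀ ℕ) :
    coeff (α.equivMapDomain π) (permAct π f) = coeff α f := by
  have := coeff_embDomain_rename (R := ℂ) π.toEmbedding f α
  rw [Finsupp.embDomain_eq_mapDomain] at this
  rw [Finsupp.equivMapDomain_eq_mapDomain]
  exact this

theorem coeff_permAct' (π : Equiv.Perm σ) (f : MvPowerSeries σ ℂ) (α : σ →₀ ℕ) :
    coeff α (permAct π f) = coeff (α.equivMapDomain π.symm) f := by
  rw [← coeff_permAct π f]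
  refine coeff_congr ?_ _
  ext i
  simp [Finsupp.equivMapDomain_apply]

@[simp]
theorem permAct_X (π : Equiv.Perm σ) (i : σ) : permAct π (X i) = X (π i) := by
  simp [permAct]

theorem permAct_mul (π π' : Equiv.Perm σ) (f : MvPowerSeries σ ℂ) :
    permAct (π * π') f = permAct π (permAct π' f) := by
  ext α
  simp only [coeff_permAct']
  refine coeff_congr ?_ _
  ext i
  simp [Finsupp.equivMapDomain_apply]

theorem permAct_pderiv (π : Equiv.Perm σ) (i : σ) (f : MvPowerSeries σ ℂ) :
    permAct π (pderiv ℂ i f) = pderiv ℂ (π i) (permAct π f) := by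
  ext α
  rw [coeff_permAct', coeff_pderiv, coeff_pderiv, coeff_permAct']
  congr 1
  · refine coeff_congr ?_ _
    ext j
    simp [Finsupp.equivMapDomain_apply, Finsupp.single_apply]

/-- The divided difference `(f - s_{ij} f) / (X_i - X_j)`, given by an explicit formula for its
coefficients, each of which is a finite combination of coefficients of `f`. -/
noncomputable def divDiff (i j : σ) (f : MvPowerSeries σ ℂ) : MvPowerSeries σ ℂ :=
  fun β => ∑ t ∈ Finset.range (β j + 1),
    coeff (β + Finsupp.single i (t + 1) - Finsupp.single j t) (f - permAct (Equiv.swap i j) f)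

theorem coeff_divDiff (i j : σ) (f : MvPowerSeries σ ℂ) (β : σ →₀ ℕ) :
    coeff β (divDiff i j f) = ∑ t ∈ Finset.range (β j + 1),
      coeff (β + Finsupp.single i (t + 1) - Finsupp.single j t)
        (f - permAct (Equiv.swap i j) f) := rfl

/-- The defining property of divided differences. In the coefficient of `X^α` the two products are
sums of the same antisymmetric sequence `c t`, which telescope up to `c 0`. -/
theorem X_sub_X_mul_divDiff {i j : σ} (hij : i ≠ j) (f : MvPowerSeries σ ℂ) :
    (X i - X j) * divDiff i j f = f - permAct (Equiv.swap i j) f := by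
  set h := f - permAct (Equiv.swap i j) f with hh
  have hanti : permAct (Equiv.swap i j) h = -h := by
    rw [hh, map_sub, ← permAct_mul]
    simp [permAct]
  ext α
  set c : ℕ → ℂ := fun t => coeff (α + Finsupp.single i t - Finsupp.single j t) h with hc
  -- if `α i = 0` the left side vanishes by definition, the right side by antisymmetry
  have hi : coeff α (X i * divDiff i j f) = ∑ t ∈ Finset.range (α j + 1), c t := by
    rw [coeff_X_mul_eq_ite]
    split_ifs with h0
    · -- the reflection `t ↦ α j - t` pairs coefficients of opposite sign
      have hrefl : ∀ t ∈ Finset.range (α j + 1), c (α j - t) = - c t := by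
        intro t ht
        have ht' : t ≤ α j := Nat.lt_succ_iff.1 (Finset.mem_range.1 ht)
        have h1 := congrArg (coeff (α + Finsupp.single i t - Finsupp.single j t)) hanti
        rw [coeff_permAct', map_neg] at h1
        rw [hc]
        simp only
        rw [← h1]
        refine coeff_congr ?_ _
        ext k
        simp only [Finsupp.equivMapDomain_apply, Finsupp.coe_add, Finsupp.coe_tsub, Pi.add_apply,
          Pi.sub_apply, Equiv.symm_swap]
        by_cases hki : k = i
        · subst hki
          simp [hij, hij.symm, h0]
        · by_cases hkj : k = j
          · subst hkj
            simp [hij, hij.symm, h0]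
            omega
          · simp [Equiv.swap_apply_of_ne_of_ne hki hkj, Ne.symm hki, Ne.symm hkj]
      have h2 : ∑ t ∈ Finset.range (α j + 1), c t = ∑ t ∈ Finset.range (α j + 1), - c t := by
        rw [← Finset.sum_range_reflect]
        refine Finset.sum_congr rfl fun t ht => ?_
        rw [← hrefl t ht]
        congr 1
      rw [Finset.sum_neg_distrib] at h2
      exact (self_eq_neg.1 h2).symm
    · rw [coeff_divDiff]
      have : (α - Finsupp.single i 1 : σ →₀ ℕ) j = α j := by simp [hij]
      rw [this]
      refine Finset.sum_congr rfl fun t _ => ?_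
      rw [hc]
      simp only
      refine coeff_congr ?_ _
      ext k
      by_cases hki : k = i
      · subst hki
        simp [hij]
        omega
      · simp [Finsupp.single_apply, Ne.symm hki]
  have hj : coeff α (X j * divDiff i j f) = ∑ t ∈ Finset.range (α j), c (t + 1) := by
    rw [coeff_X_mul_eq_ite]
    split_ifs with h0
    · simp [h0]
    · rw [coeff_divDiff]
      have : (α - Finsupp.single j 1 : σ →₀ ℕ) j + 1 = α j := by simp; omega
      rw [this]
      refine Finset.sum_congr rfl fun t ht => ?_
      have ht' := Finset.mem_range.1 ht
      rw [hc]
      simp only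
      refine coeff_congr ?_ _
      ext k
      by_cases hkj : k = j
      · subst hkj
        simp [hij.symm]
        omega
      · simp [Finsupp.single_apply, Ne.symm hkj]
  rw [sub_mul, map_sub, hi, hj, Finset.sum_range_succ' c]
  simp [hc]

theorem X_sub_X_ne_zero {i j : σ} (hij : i ≠ j) : (X i - X j : MvPowerSeries σ ℂ) ≠ 0 := by
  rw [sub_ne_zero]
  intro h
  have := congrArg (coeff (Finsupp.single i 1)) h
  rw [coeff_index_single_X, coeff_index_single_X, if_pos rfl, if_neg hij] at this
  exact one_ne_zero this

theorem permAct_divDiff (π : Equiv.Perm σ) {i j : σ} (hij : i ≠ j) (f : MvPowerSeries σ ℂ) :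
    permAct π (divDiff i j f) = divDiff (π i) (π j) (permAct π f) := by
  have hij' : π i ≠ π j := fun h => hij (π.injective h)
  refine mul_left_cancel₀ (X_sub_X_ne_zero hij') ?_
  rw [X_sub_X_mul_divDiff hij', ← permAct_X π i, ← permAct_X π j, ← map_sub, ← map_mul,
    X_sub_X_mul_divDiff hij, map_sub, ← permAct_mul, ← permAct_mul]
  congr 3
  rw [Equiv.mul_swap_eq_swap_mul]

theorem divDiff_mul_of_symm {i j : σ} (hij : i ≠ j) {S : MvPowerSeries σ ℂ}
    (hS : permAct (Equiv.swap i j) S = S) (f : MvPowerSeries σ ℂ) :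
    divDiff i j (S * f) = S * divDiff i j f := by
  refine mul_left_cancel₀ (X_sub_X_ne_zero hij) ?_
  rw [X_sub_X_mul_divDiff hij, mul_left_comm, X_sub_X_mul_divDiff hij, map_mul, hS, mul_sub]

theorem divDiff_add (i j : σ) (f g : MvPowerSeries σ ℂ) :
    divDiff i j (f + g) = divDiff i j f + divDiff i j g := by
  ext β
  rw [map_add, coeff_divDiff, coeff_divDiff, coeff_divDiff, ← Finset.sum_add_distrib]
  refine Finset.sum_congr rfl fun t _ => ?_
  simp only [map_add, map_sub]
  ring

end DividedDifferences

/-! ### Divided symmetrizations and the moment operators -/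

section Symmetrization

open MvPowerSeries

set_option linter.unusedSectionVars false

variable {σ : Type*} [DecidableEq σ]

/-- Equivariance of a family of power series under permutations of the variables. -/
def Equivariant (h : σ → MvPowerSeries σ ℂ) : Prop :=
  ∀ (π : Equiv.Perm σ) (i : σ), permAct π (h i) = h (π i)

/-- The iterated divided difference `Δ_{a,b_1} ⋯ Δ_{a,b_m} h`. For an equivariant family `h_i` it
is the divided symmetrization `∑_i h_i / ∏_{j ≠ i} (X_i - X_j)` over the index set
`{a, b_1, …, b_m}`, see `toField_divSym`. -/
noncomputable def divSym (a : σ) (t : List σ) (h : MvPowerSeries σ ℂ) : MvPowerSeries σ ℂ :=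
  t.foldr (fun b g => divDiff a b g) h

theorem permAct_divSym (π : Equiv.Perm σ) (a : σ) (t : List σ) (ha : a ∉ t)
    (h : MvPowerSeries σ ℂ) :
    permAct π (divSym a t h) = divSym (π a) (t.map π) (permAct π h) := by
  induction t with
  | nil => rfl
  | cons b t ih =>
    rw [List.mem_cons, not_or] at ha
    simp only [divSym, List.foldr_cons, List.map_cons] at ih ⊢
    rw [permAct_divDiff π ha.1, ih ha.2]

theorem divSym_mul_of_symm {S : MvPowerSeries σ ℂ}
    (hS : ∀ π : Equiv.Perm σ, permAct π S = S) (a : σ) (t : List σ) (ha : a ∉ t)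
    (h : MvPowerSeries σ ℂ) :
    divSym a t (S * h) = S * divSym a t h := by
  induction t with
  | nil => rfl
  | cons b t ih =>
    rw [List.mem_cons, not_or] at ha
    simp only [divSym, List.foldr_cons] at ih ⊢
    rw [ih ha.2, divDiff_mul_of_symm ha.1 (hS _)]

theorem divSym_add (a : σ) (t : List σ) (g h : MvPowerSeries σ ℂ) :
    divSym a t (g + h) = divSym a t g + divSym a t h := by
  induction t with
  | nil => rfl
  | cons b t ih =>
    simp only [divSym, List.foldr_cons] at ih ⊢
    rw [ih, divDiff_add]

/-- The field of fractions of the ring of power series. -/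
abbrev SeriesField (σ : Type*) : Type _ := FractionRing (MvPowerSeries σ ℂ)

instance : IsDomain (MvPowerSeries σ ℂ) := NoZeroDivisors.to_isDomain _

/-- The inclusion of power series into their field of fractions. -/
noncomputable abbrev toField : MvPowerSeries σ ℂ →+* SeriesField σ :=
  algebraMap (MvPowerSeries σ ℂ) (SeriesField σ)

theorem toField_injective : Function.Injective (toField (σ := σ)) :=
  IsFractionRing.injective _ _

theorem toField_X_sub_X_ne_zero {i j : σ} (hij : i ≠ j) :
    toField (X i : MvPowerSeries σ ℂ) - toField (X j) ≠ 0 := by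
  rw [← map_sub]
  exact fun h => X_sub_X_ne_zero hij (toField_injective (by rw [h, map_zero]))

/-- The recursion of divided symmetrizations, an identity in any field. -/
theorem sum_div_prod_insert_sub {K : Type*} [Field K] (y h : σ → K) (hy : Function.Injective y)
    {a b : σ} (hab : a ≠ b) {T : Finset σ} (ha : a ∉ T) (hb : b ∉ T) :
    ∑ i ∈ insert a T, h i / ∏ j ∈ (insert a T).erase i, (y i - y j) -
      ∑ i ∈ insert b T, h i / ∏ j ∈ (insert b T).erase i, (y i - y j) =
    (y a - y b) * ∑ i ∈ insert a (insert b T),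
      h i / ∏ j ∈ (insert a (insert b T)).erase i, (y i - y j) := by
  have hne : ∀ i j, i ≠ j → y i - y j ≠ 0 := fun i j hij => sub_ne_zero.2 fun h => hij (hy h)
  have hab' : a ∉ insert b T := by simp [hab, ha]
  have hba' : b ∉ insert a T := by simp [hab.symm, hb]
  rw [Finset.sum_insert ha, Finset.sum_insert hb, Finset.sum_insert hab', Finset.sum_insert hb,
    Finset.erase_insert ha, Finset.erase_insert hb, Finset.erase_insert hab',
    Finset.insert_comm a b T, Finset.erase_insert hba', Finset.prod_insert ha,
    Finset.prod_insert hb, mul_add, mul_add, Finset.mul_sum]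
  have hT : ∑ i ∈ T, h i / ∏ j ∈ (insert a T).erase i, (y i - y j) -
      ∑ i ∈ T, h i / ∏ j ∈ (insert b T).erase i, (y i - y j) =
      ∑ i ∈ T, (y a - y b) * (h i / ∏ j ∈ (insert b (insert a T)).erase i, (y i - y j)) := by
    rw [← Finset.sum_sub_distrib]
    refine Finset.sum_congr rfl fun i hi => ?_
    have hia : i ≠ a := fun h => ha (h ▸ hi)
    have hib : i ≠ b := fun h => hb (h ▸ hi)
    have ha' : a ∉ T.erase i := fun h => ha (Finset.mem_of_mem_erase h)
    have hb' : b ∉ T.erase i := fun h => hb (Finset.mem_of_mem_erase h)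
    rw [Finset.erase_insert_of_ne hia.symm, Finset.erase_insert_of_ne hib.symm,
      Finset.erase_insert_of_ne hib.symm, Finset.erase_insert_of_ne hia.symm,
      Finset.prod_insert (s := insert a (T.erase i)) (a := b) (by simp [hab.symm, hb]),
      Finset.prod_insert ha', Finset.prod_insert hb']
    have h1 := hne i a hia
    have h2 := hne i b hib
    have h3 : ∏ j ∈ T.erase i, (y i - y j) ≠ 0 :=
      Finset.prod_ne_zero_iff.2 fun j hj => hne i j (Finset.ne_of_mem_erase hj).symm
    field_simp
    ring
  rw [← hT]
  have h1 := hne a b hab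
  have h2 : y b - y a ≠ 0 := hne b a hab.symm
  have h3 : ∏ j ∈ T, (y a - y j) ≠ 0 :=
    Finset.prod_ne_zero_iff.2 fun j hj => hne a j fun h => ha (h ▸ hj)
  have h4 : ∏ j ∈ T, (y b - y j) ≠ 0 :=
    Finset.prod_ne_zero_iff.2 fun j hj => hne b j fun h => hb (h ▸ hj)
  have e1 : (y a - y b) * (h a / ((y a - y b) * ∏ j ∈ T, (y a - y j))) =
      h a / ∏ j ∈ T, (y a - y j) := by
    field_simp
  have e2 : (y a - y b) * (h b / ((y b - y a) * ∏ j ∈ T, (y b - y j))) =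
      - (h b / ∏ j ∈ T, (y b - y j)) := by
    rw [← neg_sub (y b) (y a)]
    field_simp
  rw [e1, e2]
  ring

/-- Iterated divided differences of an equivariant family are divided symmetrizations. -/
theorem toField_divSym {h : σ → MvPowerSeries σ ℂ} (hh : Equivariant h) (t : List σ) :
    ∀ a : σ, (a :: t).Nodup → toField (divSym a t (h a)) =
      ∑ i ∈ insert a t.toFinset, toField (h i) /
        ∏ j ∈ (insert a t.toFinset).erase i, (toField (X i) - toField (X j)) := by
  induction t with
  | nil => intro a _; simp [divSym]
  | cons b t ih =>
    intro a hnd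
    simp only [List.nodup_cons, List.mem_cons, not_or] at hnd
    obtain ⟨⟨hab, hat⟩, hbt, ht⟩ := hnd
    have hya := ih a (by simp [hat, ht])
    have hyb := ih b (by simp [hbt, ht])
    have hswap : permAct (Equiv.swap a b) (divSym a t (h a)) = divSym b t (h b) := by
      rw [permAct_divSym _ _ _ hat, hh, Equiv.swap_apply_left]
      congr 1
      conv_rhs => rw [← List.map_id t]
      refine List.map_congr_left fun c hc => ?_
      exact Equiv.swap_apply_of_ne_of_ne (fun h => hat (h ▸ hc)) fun h => hbt (h ▸ hc)
    have hmul := congrArg toField (X_sub_X_mul_divDiff hab (divSym a t (h a)))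
    rw [hswap, map_mul, map_sub, map_sub, hya, hyb, sum_div_prod_insert_sub
      (fun i => toField (X i)) (fun i => toField (h i))
      (fun i j hij => by_contra fun hne => toField_X_sub_X_ne_zero hne (sub_eq_zero.2 hij))
      hab (by simpa using hat) (by simpa using hbt)] at hmul
    rw [List.toFinset_cons]
    exact mul_left_cancel₀ (toField_X_sub_X_ne_zero hab) hmul

/-- The general Leibniz rule for iterates of a derivation. -/
theorem derivation_iterate_mul (D : Derivation ℂ (MvPowerSeries σ ℂ) (MvPowerSeries σ ℂ)) (n : ℕ)
    (f g : MvPowerSeries σ ℂ) :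
    D^[n] (f * g) = ∑ m ∈ Finset.range (n + 1), n.choose m • (D^[m] f * D^[n - m] g) := by
  rw [← Finset.Nat.sum_antidiagonal_eq_sum_range_succ
    (fun i j => n.choose i • (D^[i] f * D^[j] g)) n]
  induction n with
  | zero => simp
  | succ n ih =>
    rw [Finset.sum_antidiagonal_choose_succ_nsmul (fun i j => D^[i] f * D^[j] g) n]
    simp only [Function.iterate_succ_apply', ih, map_sum, map_nsmul, Derivation.leibniz, smul_eq_mul,
      smul_add, Finset.sum_add_distrib, add_right_inj]
    refine Finset.sum_congr rfl fun ⟨i, j⟩ hij => ?_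
    rw [n.choose_symm_of_eq_add (Finset.HasAntidiagonal.mem_antidiagonal.1 hij).symm,
      mul_comm (D^[j] g)]

theorem derivation_iterate_mul_of_eq_one
    (D : Derivation ℂ (MvPowerSeries σ ℂ) (MvPowerSeries σ ℂ)) {f : MvPowerSeries σ ℂ}
    (hf : D f = 1) (n : ℕ) (g : MvPowerSeries σ ℂ) :
    D^[n + 1] (f * g) = f * D^[n + 1] g + (n + 1 : ℕ) • D^[n] g := by
  induction n with
  | zero => simp [hf]
  | succ n ih =>
    rw [Function.iterate_succ_apply', ih]
    rw [map_add, map_nsmul, Derivation.leibniz, hf, ← Function.iterate_succ_apply' D,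
      ← Function.iterate_succ_apply' D]
    simp only [smul_eq_mul, nsmul_eq_mul, mul_one]
    push_cast
    ring

/-- Iterated derivatives of a product of linear factors, as in the logarithmic derivative. -/
theorem toField_iterate_pderiv_prod (i : σ) (s : Finset σ) (hi : i ∉ s) (m : ℕ) :
    toField ((pderiv ℂ i)^[m] (∏ j ∈ s, (X i - X j))) =
      (∏ j ∈ s, (toField (X i) - toField (X j))) * (m.factorial : SeriesField σ) *
        ∑ t ∈ s.powersetCard m, ∏ j ∈ t, (toField (X i) - toField (X j))⁻¹ := by
  induction s using Finset.induction_on generalizing m with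
  | empty =>
    cases m with
    | zero => simp
    | succ m =>
      have : ∀ m, (pderiv ℂ i)^[m + 1] (1 : MvPowerSeries σ ℂ) = 0 := by
        intro m
        rw [Function.iterate_succ_apply, pderiv_one, iterate_map_zero]
      have h2 : (∅ : Finset σ).powersetCard (m + 1) = ∅ :=
        Finset.powersetCard_eq_empty.2 (by simp)
      simp [this, -Function.iterate_succ, h2]
  | insert a s ha ih =>
    rw [Finset.mem_insert, not_or] at hi
    have ih := ih hi.2
    have hne := toField_X_sub_X_ne_zero hi.1
    rw [Finset.prod_insert ha, Finset.prod_insert ha]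
    cases m with
    | zero => simp [map_prod]
    | succ m =>
      rw [derivation_iterate_mul_of_eq_one _ (by rw [map_sub, pderiv_X_self,
        pderiv_X_of_ne (Ne.symm hi.1), sub_zero]), map_add, map_mul, map_nsmul, ih, ih, map_sub,
        Finset.powersetCard_succ_insert ha, Finset.sum_union, Finset.sum_image]
      · have : ∑ x ∈ s.powersetCard m, ∏ j ∈ insert a x, (toField (X i) - toField (X j))⁻¹ =
            (toField (X i) - toField (X a))⁻¹ *
              ∑ x ∈ s.powersetCard m, ∏ j ∈ x, (toField (X i) - toField (X j))⁻¹ := by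
          rw [Finset.mul_sum]
          refine Finset.sum_congr rfl fun x hx => ?_
          rw [Finset.prod_insert fun h => ha ((Finset.mem_powersetCard.1 hx).1 h)]
        rw [this, Nat.factorial_succ]
        push_cast
        rw [nsmul_eq_mul]
        push_cast
        field_simp
      · intro x hx y hy hxy
        have hx' : a ∉ x := fun h => ha ((Finset.mem_powersetCard.1 hx).1 h)
        have hy' : a ∉ y := fun h => ha ((Finset.mem_powersetCard.1 hy).1 h)
        rw [← Finset.erase_insert hx', ← Finset.erase_insert hy']
        exact congrArg (fun z => Finset.erase z a) hxy
      · rw [Finset.disjoint_left]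
        intro x hx hx'
        obtain ⟨y, _, rfl⟩ := Finset.mem_image.1 hx'
        exact ha ((Finset.mem_powersetCard.1 hx).1 (Finset.mem_insert_self a y))

/-- The divided symmetrization `∑_{i ∈ I} h_i / ∏_{j ∈ I, j ≠ i} (X_i - X_j)`. It is computed by
divided differences along an enumeration of `I`, which stays inside the ring of power series; it has
this meaning for equivariant families, see `toField_divSymOn`. -/
noncomputable def divSymOn (I : Finset σ) (h : σ → MvPowerSeries σ ℂ) : MvPowerSeries σ ℂ :=
  match I.toList with
  | [] => 0
  | a :: t => divSym a t (h a)

theorem divSymOn_eq {I : Finset σ} {a : σ} {t : List σ} (hI : I.toList = a :: t)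
    (h : σ → MvPowerSeries σ ℂ) : divSymOn I h = divSym a t (h a) := by
  unfold divSymOn
  rw [hI]

theorem nodup_of_toList_eq {I : Finset σ} {a : σ} {t : List σ} (hI : I.toList = a :: t) :
    (a :: t).Nodup := hI ▸ I.nodup_toList

theorem toFinset_of_toList_eq {I : Finset σ} {a : σ} {t : List σ} (hI : I.toList = a :: t) :
    insert a t.toFinset = I := by
  rw [← List.toFinset_cons, ← hI, Finset.toList_toFinset]

theorem toField_divSymOn {h : σ → MvPowerSeries σ ℂ} (hh : Equivariant h) (I : Finset σ) :
    toField (divSymOn I h) = ∑ i ∈ I, toField (h i) /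
        ∏ j ∈ I.erase i, (toField (X i) - toField (X j)) := by
  rcases hI : I.toList with _ | ⟨a, t⟩
  · rw [Finset.toList_eq_nil] at hI
    subst hI
    simp [divSymOn]
  · rw [divSymOn_eq hI, toField_divSym hh t a (nodup_of_toList_eq hI), toFinset_of_toList_eq hI]

variable [Fintype σ]

/-- The operator acting on symmetric power series `f` as
`f ↦ V⁻¹ ∑_i (1 + X_i)^k ∂_i^k (V f)`, with `V` the Vandermonde determinant; it is written as a
sum of divided symmetrizations over subsets of at most `k + 1` variables, see
`mul_momentOp`. -/
noncomputable def momentOp (k : ℕ) (f : MvPowerSeries σ ℂ) : MvPowerSeries σ ℂ :=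
  ∑ m ∈ Finset.range (k + 1), ((k.choose m * m.factorial : ℕ) : ℂ) •
    ∑ I ∈ Finset.univ.powersetCard (m + 1),
      divSymOn I fun a => (1 + X a) ^ k * (pderiv ℂ a)^[k - m] f

theorem permAct_iterate_pderiv (π : Equiv.Perm σ) (i : σ) (q : ℕ) (f : MvPowerSeries σ ℂ) :
    permAct π ((pderiv ℂ i)^[q] f) = (pderiv ℂ (π i))^[q] (permAct π f) := by
  induction q with
  | zero => rfl
  | succ q ih => rw [Function.iterate_succ_apply', Function.iterate_succ_apply', permAct_pderiv, ih]

theorem equivariant_of_symm {f : MvPowerSeries σ ℂ}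
    (hf : ∀ π : Equiv.Perm σ, permAct π f = f) (k q : ℕ) :
    Equivariant fun a => (1 + X a) ^ k * (pderiv ℂ a)^[q] f := by
  intro π i
  simp [permAct_iterate_pderiv, hf]

/-- Summation over `(m+1)`-subsets with a marked element. -/
theorem sum_powersetCard_erase {M : Type*} [AddCommMonoid M] (g : σ → Finset σ → M) (m : ℕ) :
    ∑ I ∈ (Finset.univ : Finset σ).powersetCard (m + 1), ∑ i ∈ I, g i (I.erase i) =
      ∑ i, ∑ t ∈ (Finset.univ.erase i).powersetCard m, g i t := by
  rw [Finset.sum_sigma', Finset.sum_sigma']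
  refine Finset.sum_bij' (fun x _ => ⟨x.2, x.1.erase x.2⟩) (fun x _ => ⟨insert x.1 x.2, x.1⟩)
    ?_ ?_ ?_ ?_ ?_
  · rintro ⟨I, i⟩ h
    simp only [Finset.mem_sigma, Finset.mem_powersetCard, Finset.mem_univ, true_and] at h ⊢
    refine ⟨Finset.erase_subset_erase _ (Finset.subset_univ _), ?_⟩
    rw [Finset.card_erase_of_mem h.2, h.1.2, Nat.add_sub_cancel]
  · rintro ⟨i, t⟩ h
    simp only [Finset.mem_sigma, Finset.mem_powersetCard, Finset.mem_univ, true_and] at h ⊢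
    have hi : i ∉ t := fun hh => by simpa using h.1 hh
    exact ⟨⟨Finset.subset_univ _, by rw [Finset.card_insert_of_notMem hi, h.2]⟩,
      Finset.mem_insert_self _ _⟩
  · rintro ⟨I, i⟩ h
    simp only [Finset.mem_sigma] at h
    simp [Finset.insert_erase h.2]
  · rintro ⟨i, t⟩ h
    simp only [Finset.mem_sigma, Finset.mem_powersetCard, Finset.mem_univ, true_and] at h
    have hi : i ∉ t := fun hh => by simpa using h.1 hh
    simp [Finset.erase_insert hi]
  · rintro ⟨I, i⟩ _
    rfl

/-- The property of the Vandermonde product used below: for every `i` it is `∏_{j ≠ i} (X_i - X_j)`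
times a factor that does not involve `X_i`. -/
def IsVandermonde (V : MvPowerSeries σ ℂ) : Prop :=
  V ≠ 0 ∧ ∀ i, ∃ c : MvPowerSeries σ ℂ, pderiv ℂ i c = 0 ∧
    V = c * ∏ j ∈ Finset.univ.erase i, (X i - X j)

theorem IsVandermonde.toField_iterate_pderiv {V : MvPowerSeries σ ℂ} (hV : IsVandermonde V) (i : σ)
    (m : ℕ) :
    toField ((pderiv ℂ i)^[m] V) = toField V * (m.factorial : SeriesField σ) *
      ∑ t ∈ (Finset.univ.erase i).powersetCard m,
        ∏ j ∈ t, (toField (X i) - toField (X j))⁻¹ := by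
  obtain ⟨c, hc, hV'⟩ := hV.2 i
  have h1 : ∀ (m : ℕ) (g : MvPowerSeries σ ℂ),
      (pderiv ℂ i)^[m] (c * g) = c * (pderiv ℂ i)^[m] g := by
    intro m g
    induction m with
    | zero => rfl
    | succ m ih =>
      rw [Function.iterate_succ_apply', ih, Function.iterate_succ_apply', Derivation.leibniz, hc]
      simp
  rw [hV', h1, map_mul, map_mul, toField_iterate_pderiv_prod _ _ (Finset.notMem_erase _ _),
    map_prod]
  simp only [map_sub]
  ring

/-- The moment operator is the conjugate of `∑_i (1 + X_i)^k ∂_i^k` by the Vandermonde product: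
expand by the Leibniz rule and collect the terms according to the set of variables that occur. -/
theorem mul_momentOp {V : MvPowerSeries σ ℂ} (hV : IsVandermonde V) (k : ℕ)
    {f : MvPowerSeries σ ℂ} (hf : ∀ π : Equiv.Perm σ, permAct π f = f) :
    V * momentOp k f = ∑ i, (1 + X i) ^ k * (pderiv ℂ i)^[k] (V * f) := by
  apply toField_injective
  have hR : ∀ i, toField ((1 + X i) ^ k * (pderiv ℂ i)^[k] (V * f)) =
      ∑ m ∈ Finset.range (k + 1), toField V * ((k.choose m * m.factorial : ℕ) : SeriesField σ) *
        ∑ t ∈ (Finset.univ.erase i).powersetCard m,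
          toField ((1 + X i) ^ k * (pderiv ℂ i)^[k - m] f) /
            ∏ j ∈ t, (toField (X i) - toField (X j)) := by
    intro i
    rw [derivation_iterate_mul, map_mul, map_sum, Finset.mul_sum]
    refine Finset.sum_congr rfl fun m _ => ?_
    rw [map_nsmul, map_mul, hV.toField_iterate_pderiv, map_mul, nsmul_eq_mul]
    simp only [div_eq_mul_inv, Finset.mul_sum, Finset.sum_mul, Finset.prod_inv_distrib]
    refine Finset.sum_congr rfl fun t _ => ?_
    push_cast
    ring
  rw [map_sum, Finset.sum_congr rfl fun i _ => hR i, Finset.sum_comm, map_mul, momentOp, map_sum,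
    Finset.mul_sum]
  refine Finset.sum_congr rfl fun m _ => ?_
  have hs : ∀ (n : ℕ) (g : MvPowerSeries σ ℂ), toField ((n : ℂ) • g) = (n : SeriesField σ) *
      toField g := by
    intro n g
    rw [← nsmul_eq_mul, ← map_nsmul]
    congr 1
    exact Nat.cast_smul_eq_nsmul ℂ n g
  rw [hs, map_sum, ← Finset.mul_sum, mul_assoc]
  congr 2
  rw [← sum_powersetCard_erase (fun i t => toField ((1 + X i) ^ k * (pderiv ℂ i)^[k - m] f) /
            ∏ j ∈ t, (toField (X i) - toField (X j)))]
  exact Finset.sum_congr rfl fun I _ => toField_divSymOn (equivariant_of_symm hf k (k - m)) I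

end Symmetrization

/-! ### Coefficientwise summation -/

section CoeffHasSum

open MvPowerSeries

set_option linter.unusedSectionVars false

variable {σ : Type*} [DecidableEq σ] {ι : Type*}

/-- Coefficientwise summation of a family of power series. -/
def CoeffHasSum (g : ι → MvPowerSeries σ ℂ) (G : MvPowerSeries σ ℂ) : Prop :=
  ∀ α, HasSum (fun i => coeff α (g i)) (coeff α G)

namespace CoeffHasSum

variable {g g' : ι → MvPowerSeries σ ℂ} {G G' : MvPowerSeries σ ℂ}

theorem mul_left (f : MvPowerSeries σ ℂ) (h : CoeffHasSum g G) :
    CoeffHasSum (fun i => f * g i) (f * G) := by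
  intro α
  simp only [coeff_mul]
  exact hasSum_sum fun p _ => (h p.2).mul_left _

theorem smul (c : ℂ) (h : CoeffHasSum g G) : CoeffHasSum (fun i => c • g i) (c • G) := by
  intro α
  simp only [coeff_smul]
  exact (h α).mul_left _

theorem sub (h : CoeffHasSum g G) (h' : CoeffHasSum g' G') :
    CoeffHasSum (fun i => g i - g' i) (G - G') := by
  intro α
  simp only [map_sub]
  exact (h α).sub (h' α)

theorem sum {κ : Type*} (s : Finset κ) {g : κ → ι → MvPowerSeries σ ℂ}
    {G : κ → MvPowerSeries σ ℂ} (h : ∀ k ∈ s, CoeffHasSum (g k) (G k)) :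
    CoeffHasSum (fun i => ∑ k ∈ s, g k i) (∑ k ∈ s, G k) := by
  intro α
  simp only [map_sum]
  exact hasSum_sum fun k hk => h k hk α

theorem pderiv (j : σ) (h : CoeffHasSum g G) :
    CoeffHasSum (fun i => pderiv ℂ j (g i)) (pderiv ℂ j G) := by
  intro α
  simp only [coeff_pderiv]
  exact (h _).mul_right _

theorem iterate_pderiv (j : σ) (q : ℕ) (h : CoeffHasSum g G) :
    CoeffHasSum (fun i => (MvPowerSeries.pderiv ℂ j)^[q] (g i))
      ((MvPowerSeries.pderiv ℂ j)^[q] G) := by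
  induction q with
  | zero => exact h
  | succ q ih =>
    simp only [Function.iterate_succ_apply']
    exact ih.pderiv j

theorem permAct (π : Equiv.Perm σ) (h : CoeffHasSum g G) :
    CoeffHasSum (fun i => permAct π (g i)) (permAct π G) := by
  intro α
  simp only [coeff_permAct']
  exact h _

theorem divDiff (a b : σ) (h : CoeffHasSum g G) :
    CoeffHasSum (fun i => divDiff a b (g i)) (divDiff a b G) := by
  intro α
  simp only [coeff_divDiff]
  exact hasSum_sum fun t _ => h.sub (h.permAct _) _

theorem divSym (a : σ) (t : List σ) (h : CoeffHasSum g G) :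
    CoeffHasSum (fun i => divSym a t (g i)) (divSym a t G) := by
  induction t with
  | nil => exact h
  | cons b t ih => exact ih.divDiff a b

theorem divSymOn (I : Finset σ) {g : ι → σ → MvPowerSeries σ ℂ} {G : σ → MvPowerSeries σ ℂ}
    (h : ∀ a, CoeffHasSum (fun i => g i a) (G a)) :
    CoeffHasSum (fun i => divSymOn I (g i)) (divSymOn I G) := by
  rcases hI : I.toList with _ | ⟨a, t⟩
  · rw [Finset.toList_eq_nil] at hI
    subst hI
    intro α
    simp [SchurLLN.divSymOn]
  · simp only [divSymOn_eq hI]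
    exact (h a).divSym a t

theorem momentOp [Fintype σ] (k : ℕ) (h : CoeffHasSum g G) :
    CoeffHasSum (fun i => momentOp k (g i)) (momentOp k G) :=
  CoeffHasSum.sum _ fun _ _ => smul _ <| CoeffHasSum.sum _ fun I _ =>
    divSymOn I fun a => (h.iterate_pderiv a _).mul_left _

theorem unique (h : CoeffHasSum g G) (h' : CoeffHasSum g G') : G = G' := by
  ext α
  exact (h α).unique (h' α)

end CoeffHasSum

end CoeffHasSum

/-! ### Coefficient bounds that do not depend on the number of variables -/

section Bounds

open MvPowerSeries

set_option linter.unusedSectionVars false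

variable {σ : Type*} [DecidableEq σ]

/-- All coefficients of degree at most `d` are bounded by `C`. -/
def BddBy (d : ℕ) (C : ℝ) (f : MvPowerSeries σ ℂ) : Prop :=
  ∀ α : σ →₀ ℕ, α.degree ≤ d → ‖coeff α f‖ ≤ C

namespace BddBy

variable {d : ℕ} {C C' : ℝ} {f g : MvPowerSeries σ ℂ}

theorem nonneg (h : BddBy d C f) : 0 ≤ C :=
  (norm_nonneg _).trans (h 0 (by simp))

theorem mono (h : BddBy d C f) (hC : C ≤ C') : BddBy d C' f := fun α hα => (h α hα).trans hC

theorem add (hf : BddBy d C f) (hg : BddBy d C' g) : BddBy d (C + C') (f + g) := by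
  intro α hα
  rw [map_add]
  exact (norm_add_le _ _).trans (add_le_add (hf α hα) (hg α hα))

theorem sub (hf : BddBy d C f) (hg : BddBy d C' g) : BddBy d (C + C') (f - g) := by
  intro α hα
  rw [map_sub]
  exact (norm_sub_le _ _).trans (add_le_add (hf α hα) (hg α hα))

theorem smul (c : ℂ) (hf : BddBy d C f) : BddBy d (‖c‖ * C) (c • f) := by
  intro α hα
  rw [coeff_smul, norm_mul]
  exact mul_le_mul_of_nonneg_left (hf α hα) (norm_nonneg _)

theorem zero : BddBy d 0 (0 : MvPowerSeries σ ℂ) := by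
  intro α _
  simp

theorem sum {κ : Type*} (s : Finset κ) {f : κ → MvPowerSeries σ ℂ} {C : κ → ℝ}
    (h : ∀ k ∈ s, BddBy d (C k) (f k)) : BddBy d (∑ k ∈ s, C k) (∑ k ∈ s, f k) := by
  intro α hα
  rw [map_sum]
  exact (norm_sum_le _ _).trans (Finset.sum_le_sum fun k hk => h k hk α hα)

theorem one_add_X (a : σ) : BddBy d 2 (1 + X a : MvPowerSeries σ ℂ) := by
  intro α _
  rw [map_add, coeff_one, coeff_X]
  refine (norm_add_le _ _).trans ?_
  split_ifs <;> norm_num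

/-- A bound for the number of terms in a coefficient of a product, uniform in the number of
variables. -/
theorem card_antidiagonal_le (α : σ →₀ ℕ) :
    (Finset.HasAntidiagonal.antidiagonal α).card ≤ 2 ^ α.degree := by
  have h1 : (Finset.HasAntidiagonal.antidiagonal α).card ≤ (Finset.Iic α).card := by
    refine Finset.card_le_card_of_injOn Prod.fst ?_ ?_
    · intro p hp
      have := Finset.HasAntidiagonal.mem_antidiagonal.1 (Finset.mem_coe.1 hp)
      simp only [Finset.coe_Iic, Set.mem_Iic]
      exact this ▸ self_le_add_right _ _
    · intro p hp q hq hpq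
      have h1 := Finset.HasAntidiagonal.mem_antidiagonal.1 (Finset.mem_coe.1 hp)
      have h2 := Finset.HasAntidiagonal.mem_antidiagonal.1 (Finset.mem_coe.1 hq)
      refine Prod.ext hpq ?_
      rw [← h2, ← hpq] at h1
      exact add_left_cancel h1
  refine h1.trans ?_
  rw [Finsupp.card_Iic, Finsupp.degree_apply, ← Finset.prod_pow_eq_pow_sum]
  refine Finset.prod_le_prod' fun i _ => ?_
  rw [Nat.card_Iic]
  exact Nat.lt_two_pow_self

theorem mul (hf : BddBy d C f) (hg : BddBy d C' g) : BddBy d (2 ^ d * (C * C')) (f * g) := by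
  intro α hα
  rw [coeff_mul]
  have h1 : ∀ p ∈ Finset.HasAntidiagonal.antidiagonal α, ‖coeff p.1 f * coeff p.2 g‖ ≤ C * C' := by
    intro p hp
    have hp := Finset.HasAntidiagonal.mem_antidiagonal.1 hp
    have hdeg : p.1.degree + p.2.degree = α.degree := by rw [← hp, map_add]
    rw [norm_mul]
    exact mul_le_mul (hf _ (by omega)) (hg _ (by omega)) (norm_nonneg _) hf.nonneg
  refine (norm_sum_le_of_le _ h1).trans ?_
  rw [Finset.sum_const, nsmul_eq_mul]
  refine mul_le_mul_of_nonneg_right ?_ (mul_nonneg hf.nonneg hg.nonneg)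
  calc ((Finset.HasAntidiagonal.antidiagonal α).card : ℝ) ≤ (2 ^ α.degree : ℕ) := by
        exact_mod_cast card_antidiagonal_le α
    _ ≤ 2 ^ d := by
        push_cast
        exact pow_le_pow_right₀ one_le_two hα

theorem pow (hf : BddBy d C f) (q : ℕ) : BddBy d ((2 ^ d * C) ^ q) (f ^ q) := by
  induction q with
  | zero =>
    intro α _
    rw [pow_zero, pow_zero, coeff_one]
    split_ifs <;> simp
  | succ q ih =>
    rw [pow_succ, pow_succ]
    refine (ih.mul hf).mono (le_of_eq ?_)
    ring

theorem pderiv (j : σ) (hf : BddBy (d + 1) C f) : BddBy d (C * (d + 1)) (pderiv ℂ j f) := by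
  intro α hα
  rw [coeff_pderiv, norm_mul]
  refine mul_le_mul (hf _ ?_) ?_ (norm_nonneg _) hf.nonneg
  · rw [map_add, Finsupp.degree_single]
    omega
  · have : α j ≤ d := (Finsupp.le_degree j α).trans hα
    have h2 : ‖((α j : ℂ) + 1)‖ = (α j : ℝ) + 1 := by
      rw [← Nat.cast_succ, Complex.norm_natCast]
      push_cast
      ring
    rw [h2]
    gcongr

theorem permAct (π : Equiv.Perm σ) (hf : BddBy d C f) : BddBy d C (permAct π f) := by
  intro α hα
  rw [coeff_permAct']
  refine hf _ ?_
  rwa [Finsupp.equivMapDomain_eq_mapDomain, Finsupp.degree_mapDomain]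

theorem divDiff (i j : σ) (hf : BddBy (d + 1) C f) :
    BddBy d ((d + 1) * (C + C)) (divDiff i j f) := by
  intro β hβ
  rw [coeff_divDiff]
  have h1 : ∀ t ∈ Finset.range (β j + 1),
      ‖coeff (β + Finsupp.single i (t + 1) - Finsupp.single j t)
        (f - SchurLLN.permAct (Equiv.swap i j) f)‖ ≤ C + C := by
    intro t ht
    have ht' : t ≤ β j := Nat.lt_succ_iff.1 (Finset.mem_range.1 ht)
    refine (hf.sub (hf.permAct _)) _ ?_
    have h2 : β + Finsupp.single i (t + 1) - Finsupp.single j t + Finsupp.single j t =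
        β + Finsupp.single i (t + 1) := by
      refine tsub_add_cancel_of_le ?_
      rw [Finsupp.single_le_iff]
      simp
      omega
    have h3 := congrArg Finsupp.degree h2
    rw [map_add, map_add, Finsupp.degree_single, Finsupp.degree_single] at h3
    omega
  refine (norm_sum_le_of_le _ h1).trans ?_
  rw [Finset.sum_const, Finset.card_range, nsmul_eq_mul]
  have h0 := hf.nonneg
  have : β j ≤ d := (Finsupp.le_degree j β).trans hβ
  push_cast
  gcongr

end BddBy

/-- Iterated divided differences are bounded with a constant that depends on their number and on
the degree, but not on the variables involved. -/
theorem exists_bddBy_divSym (n d : ℕ) : ∃ K : ℝ, 0 ≤ K ∧ ∀ {σ : Type} [DecidableEq σ] (a : σ)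
    (t : List σ) (f : MvPowerSeries σ ℂ) (C : ℝ), t.length = n → a ∉ t → BddBy (d + n) C f →
    BddBy d (K * C) (divSym a t f) := by
  induction n generalizing d with
  | zero =>
    refine ⟨1, zero_le_one, fun a t f C ht _ hf => ?_⟩
    rw [List.length_eq_zero_iff.1 ht]
    simpa [divSym] using hf
  | succ n ih =>
    obtain ⟨K, hK, h⟩ := ih (d + 1)
    refine ⟨(d + 1) * (K + K), by positivity, fun a t f C ht ha hf => ?_⟩
    cases t with
    | nil => simp at ht
    | cons b t =>
      rw [List.mem_cons, not_or] at ha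
      have h1 := h a t f C (by simpa using ht) ha.2
        (by rwa [show d + 1 + n = d + (n + 1) by omega])
      have h2 := h1.divDiff a b
      refine h2.mono (le_of_eq ?_)
      ring

end Bounds

/-! ### Restriction to the line through the roots of unity -/

section LineEval

open MvPowerSeries

/-- The restriction of a power series to a line: the substitution `X_j ↦ c_j u`. -/
noncomputable def lineEval {n : ℕ} (c : Fin n → ℂ) : MvPowerSeries (Fin n) ℂ →+* PowerSeries ℂ :=
  ((rename (fun _ => ()) : MvPowerSeries (Fin n) ℂ →ₐ[ℂ] MvPowerSeries Unit ℂ) :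
    MvPowerSeries (Fin n) ℂ →+* MvPowerSeries Unit ℂ).comp (rescale c)

theorem coeff_lineEval {n : ℕ} (c : Fin n → ℂ) (f : MvPowerSeries (Fin n) ℂ) (d : ℕ) :
    PowerSeries.coeff d (lineEval c f) =
      ∑ β ∈ Finset.finsuppAntidiag Finset.univ d, (∏ j, c j ^ β j) * coeff β f := by
  rw [PowerSeries.coeff, lineEval, RingHom.comp_apply]
  erw [coeff_rename]
  refine Finset.sum_congr ?_ ?_
  · ext β
    rw [Set.Finite.mem_toFinset, Set.mem_preimage, Set.mem_singleton_iff]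
    rw [Finset.mem_finsuppAntidiag]
    have h1 : ∀ γ : Unit →₀ ℕ, γ = Finsupp.single () d ↔ γ.degree = d := by
      intro γ
      constructor
      · rintro rfl
        exact Finsupp.degree_single _ _
      · intro h
        ext
        rw [Finsupp.degree_eq_sum] at h
        simpa using h
    rw [h1, Finsupp.degree_mapDomain, Finsupp.degree_eq_sum]
    simp
  · intro β _
    rw [coeff_rescale]
    congr 1
    exact Finsupp.prod_fintype _ _ (by simp)

theorem lineEval_X {n : ℕ} (c : Fin n → ℂ) (i : Fin n) :
    lineEval c (X i) = PowerSeries.C (c i) * PowerSeries.X := by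
  ext d
  rw [coeff_lineEval, PowerSeries.coeff_C_mul, PowerSeries.coeff_X]
  simp only [coeff_X, mul_ite, mul_one, mul_zero]
  rw [Finset.sum_ite, Finset.sum_const_zero, add_zero]
  split_ifs with h
  · subst h
    rw [Finset.sum_eq_single (Finsupp.single i 1)]
    · rw [Finset.prod_eq_single i]
      · simp
      · intro j _ hj
        simp [hj.symm]
      · simp
    · intro β hβ hne
      exact absurd (Finset.mem_filter.1 hβ).2 hne
    · intro h
      exfalso
      apply h
      simp
  · refine Finset.sum_eq_zero fun β hβ => ?_
    exfalso
    obtain ⟨h1, h2⟩ := Finset.mem_filter.1 hβ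
    rw [h2, Finset.mem_finsuppAntidiag] at h1
    apply h
    rw [← h1.1]
    simp

theorem coeff_lineEval_mul_const {n : ℕ} (c : Fin n → ℂ) (z : ℂ) (f : MvPowerSeries (Fin n) ℂ)
    (d : ℕ) :
    PowerSeries.coeff d (lineEval (fun j => z * c j) f) =
      z ^ d * PowerSeries.coeff d (lineEval c f) := by
  rw [coeff_lineEval, coeff_lineEval, Finset.mul_sum]
  refine Finset.sum_congr rfl fun β hβ => ?_
  rw [Finset.mem_finsuppAntidiag] at hβ
  simp only [mul_pow, Finset.prod_mul_distrib, Finset.prod_pow_eq_pow_sum]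
  rw [hβ.1]
  ring

theorem lineEval_permAct {n : ℕ} (c : Fin n → ℂ) (π : Equiv.Perm (Fin n))
    (f : MvPowerSeries (Fin n) ℂ) :
    lineEval c (permAct π f) = lineEval (c ∘ π) f := by
  ext d
  rw [coeff_lineEval, coeff_lineEval]
  refine Finset.sum_bij' (fun β _ => β.equivMapDomain π.symm) (fun β _ => β.equivMapDomain π)
    ?_ ?_ ?_ ?_ ?_
  · intro β hβ
    rw [Finset.mem_finsuppAntidiag] at hβ ⊢
    refine ⟨?_, Finset.subset_univ _⟩
    rw [← hβ.1]
    exact Equiv.sum_comp π β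
  · intro β hβ
    rw [Finset.mem_finsuppAntidiag] at hβ ⊢
    refine ⟨?_, Finset.subset_univ _⟩
    rw [← hβ.1]
    exact Equiv.sum_comp π.symm β
  · intro β _
    ext i
    simp [Finsupp.equivMapDomain_apply]
  · intro β _
    ext i
    simp [Finsupp.equivMapDomain_apply]
  · intro β _
    rw [coeff_permAct']
    congr 1
    rw [← Equiv.prod_comp π]
    simp [Finsupp.equivMapDomain_apply]

theorem constantCoeff_lineEval {n : ℕ} (c : Fin n → ℂ) (f : MvPowerSeries (Fin n) ℂ) :
    PowerSeries.coeff 0 (lineEval c f) = constantCoeff f := by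
  rw [coeff_lineEval]
  simp [Finset.finsuppAntidiag_zero]

/-- The vector `(1, w, …, w^m)` of all `(m+1)`-st roots of unity. -/
noncomputable def rootsVec (m : ℕ) : Fin (m + 1) → ℂ := fun j => rootOfUnity (m + 1) ^ (j : ℕ)

theorem isPrimitiveRoot_rootOfUnity (m : ℕ) : IsPrimitiveRoot (rootOfUnity (m + 1)) (m + 1) :=
  Complex.isPrimitiveRoot_exp (m + 1) (Nat.succ_ne_zero m)

theorem rootsVec_add (m : ℕ) (i j : Fin (m + 1)) :
    rootsVec m (i + j) = rootsVec m i * rootsVec m j := by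
  simp only [rootsVec]
  rw [← pow_add, Fin.val_add, ← pow_mod_orderOf, ← pow_mod_orderOf (n := (i : ℕ) + j),
    ← (isPrimitiveRoot_rootOfUnity m).eq_orderOf, Nat.mod_mod]

theorem rootsVec_ne_zero (m : ℕ) (i : Fin (m + 1)) : rootsVec m i ≠ 0 :=
  pow_ne_zero _ ((isPrimitiveRoot_rootOfUnity m).ne_zero (Nat.succ_ne_zero m))

theorem prod_rootsVec_sub (m : ℕ) (i : Fin (m + 1)) :
    ∏ j ∈ Finset.univ.erase i, (rootsVec m i - rootsVec m j) = (m + 1) * rootsVec m i ^ m := by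
  have h0 : ∏ j ∈ Finset.univ.erase (0 : Fin (m + 1)), (1 - rootsVec m j) = m + 1 := by
    rw [← (isPrimitiveRoot_rootOfUnity m).prod_one_sub_pow_eq_order, Finset.prod_range]
    have : (Finset.univ.erase (0 : Fin (m + 1))) = Finset.univ.map (Fin.succEmb m) := by
      ext j
      simp only [Finset.mem_erase, Finset.mem_univ, and_true, Finset.mem_map, true_and]
      exact Fin.exists_succ_eq.symm
    rw [this, Finset.prod_map]
    simp [rootsVec]
  have h1 : ∏ j ∈ Finset.univ.erase i, (rootsVec m i - rootsVec m j) =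
      ∏ j ∈ Finset.univ.erase (0 : Fin (m + 1)), (rootsVec m i * (1 - rootsVec m j)) := by
    symm
    refine Finset.prod_bij (fun j _ => i + j) ?_ ?_ ?_ ?_
    · intro j hj
      simpa using hj
    · intro j _ j' _ h
      exact add_left_cancel h
    · intro j hj
      refine ⟨j - i, ?_, by abel⟩
      have := Finset.ne_of_mem_erase hj
      simp [sub_eq_zero, this]
    · intro j _
      rw [rootsVec_add]
      ring
  rw [h1, Finset.prod_mul_distrib, h0, Finset.prod_const,
    Finset.card_erase_of_mem (Finset.mem_univ _), Finset.card_univ, Fintype.card_fin,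
    Nat.add_sub_cancel]
  ring

variable {σ : Type*} [DecidableEq σ]

theorem killCompl_permAct {n : ℕ} (e : Fin n ↪ σ) (π : Equiv.Perm σ) (τ : Equiv.Perm (Fin n))
    (h : ∀ j, π (e j) = e (τ j)) (f : MvPowerSeries σ ℂ) :
    killCompl e (permAct π f) = permAct τ (killCompl e f) := by
  ext β
  rw [coeff_killCompl, coeff_permAct', coeff_permAct', coeff_killCompl]
  refine coeff_congr ?_ _
  ext i
  rw [Finsupp.equivMapDomain_apply, Equiv.symm_symm]
  by_cases hi : i ∈ Set.range e
  · obtain ⟨j, rfl⟩ := hi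
    rw [h, Finsupp.embDomain_apply_self, Finsupp.embDomain_apply_self,
      Finsupp.equivMapDomain_apply, Equiv.symm_symm]
  · rw [Finsupp.embDomain_of_notMem_range _ _ _ hi, Finsupp.embDomain_of_notMem_range]
    rintro ⟨j, hj⟩
    apply hi
    refine ⟨τ.symm j, π.injective ?_⟩
    rw [h, Equiv.apply_symm_apply, hj]

/-- The constant coefficient of a divided symmetrization over `m + 1` variables. On the line
`X_j = w^j u` through the `(m+1)`-st roots of unity every denominator is `(m + 1) w^{im} u^m`, and
by equivariance the coefficients of `u^m` in the numerators are `w^{im}` times that for `i = 0`, so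
that all `m + 1` terms contribute equally. -/
theorem constantCoeff_divSym {h : σ → MvPowerSeries σ ℂ} (hh : Equivariant h) {m : ℕ}
    (e : Fin (m + 1) ↪ σ) (t : List σ) (hnd : (e 0 :: t).Nodup)
    (ht : insert (e 0) t.toFinset = Finset.univ.map e) :
    constantCoeff (divSym (e 0) t (h (e 0))) =
      PowerSeries.coeff m (lineEval (rootsVec m) (killCompl e (h (e 0)))) := by
  set g := divSym (e 0) t (h (e 0)) with hg
  set I := Finset.univ.map e with hI
  set D : σ → MvPowerSeries σ ℂ := fun i => ∏ j ∈ I.erase i, (X i - X j) with hD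
  set Φ : MvPowerSeries σ ℂ →+* PowerSeries ℂ := (lineEval (rootsVec m)).comp
    (killCompl e : MvPowerSeries σ ℂ →ₐ[ℂ] MvPowerSeries (Fin (m + 1)) ℂ).toRingHom with hΦ
  have hDne : ∀ i, toField (D i) ≠ 0 := by
    intro i
    rw [hD]
    simp only [map_prod, map_sub]
    exact Finset.prod_ne_zero_iff.2 fun j hj =>
      toField_X_sub_X_ne_zero (Finset.ne_of_mem_erase hj).symm
  -- the identity of the divided symmetrization, with denominators cleared
  have hclear : g * ∏ i ∈ I, D i = ∑ i ∈ I, h i * ∏ j ∈ I.erase i, D j := by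
    apply toField_injective
    rw [map_mul, hg, toField_divSym hh t _ hnd, ht, map_sum, Finset.sum_mul]
    refine Finset.sum_congr rfl fun i hi => ?_
    have : ∏ j ∈ I.erase i, (toField (X i : MvPowerSeries σ ℂ) - toField (X j)) =
        toField (D i) := by
      rw [hD]
      simp only [map_prod, map_sub]
    rw [this, map_mul, ← Finset.mul_prod_erase I D hi, map_mul, div_mul_eq_mul_div, mul_left_comm,
      mul_div_cancel_left₀ _ (hDne i)]
  have hΦX : ∀ i, Φ (X (e i)) = PowerSeries.C (rootsVec m i) * PowerSeries.X := by
    intro i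
    simp [hΦ, lineEval_X]
  have hΦD : ∀ i, Φ (D (e i)) =
      PowerSeries.C ((m + 1) * rootsVec m i ^ m) * PowerSeries.X ^ m := by
    intro i
    have herase : I.erase (e i) = (Finset.univ.erase i).map e := by
      rw [hI, Finset.map_erase]
    rw [hD]
    simp only [herase, Finset.prod_map, map_prod, map_sub, hΦX]
    rw [← prod_rootsVec_sub, map_prod]
    have : ∀ j ∈ Finset.univ.erase i, PowerSeries.C (rootsVec m i) * PowerSeries.X -
        PowerSeries.C (rootsVec m j) * PowerSeries.X =
        PowerSeries.C (rootsVec m i - rootsVec m j) * PowerSeries.X := by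
      intro j _
      rw [map_sub, sub_mul]
    rw [Finset.prod_congr rfl this, Finset.prod_mul_distrib, Finset.prod_const,
      Finset.card_erase_of_mem (Finset.mem_univ _), Finset.card_univ, Fintype.card_fin,
      Nat.add_sub_cancel]
  have hΦh : ∀ i, PowerSeries.coeff m (Φ (h (e i))) =
      rootsVec m i ^ m * PowerSeries.coeff m (Φ (h (e 0))) := by
    intro i
    set τ : Equiv.Perm (Fin (m + 1)) := Equiv.addLeft i with hτ
    set π : Equiv.Perm σ := τ.viaFintypeEmbedding e with hπ
    have hπe : ∀ j, π (e j) = e (τ j) := fun j => Equiv.Perm.viaFintypeEmbedding_apply_image τ e j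
    have h1 : h (e i) = permAct π (h (e 0)) := by
      rw [hh π, hπe, hτ]
      simp
    have h2 : Φ (h (e i)) = lineEval (fun j => rootsVec m i * rootsVec m j)
        (killCompl e (h (e 0))) := by
      rw [h1]
      simp only [hΦ, RingHom.comp_apply]
      refine (congrArg (lineEval (rootsVec m)) (killCompl_permAct e π τ hπe _)).trans ?_
      rw [lineEval_permAct]
      congr 2
      funext j
      simp only [Function.comp_apply, hτ, Equiv.coe_addLeft, rootsVec_add]
    rw [h2, coeff_lineEval_mul_const]
    rfl
  have hmain := congrArg Φ hclear
  rw [map_mul, map_prod, map_sum, hI, Finset.prod_map, Finset.sum_map] at hmain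
  set c : Fin (m + 1) → ℂ := fun i => (m + 1) * rootsVec m i ^ m with hc
  have hc0 : ∀ i, c i ≠ 0 := fun i =>
    mul_ne_zero (by exact_mod_cast Nat.succ_ne_zero m) (pow_ne_zero _ (rootsVec_ne_zero m i))
  have hprod : ∏ i, Φ (D (e i)) = PowerSeries.C (∏ i, c i) * PowerSeries.X ^ (m * m + m) := by
    simp only [hΦD]
    rw [Finset.prod_mul_distrib, map_prod, Finset.prod_const, Finset.card_univ, Fintype.card_fin,
      ← pow_mul]
    congr 2
  have hterm : ∀ i, Φ (h (e i) * ∏ j ∈ (Finset.univ.map e).erase (e i), D j) =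
      PowerSeries.C ((∏ i, c i) * (c i)⁻¹) * Φ (h (e i)) * PowerSeries.X ^ (m * m) := by
    intro i
    rw [← Finset.map_erase, map_mul, map_prod, Finset.prod_map]
    simp only [hΦD]
    rw [Finset.prod_mul_distrib, ← map_prod, Finset.prod_const,
      Finset.card_erase_of_mem (Finset.mem_univ _), Finset.card_univ, Fintype.card_fin,
      Nat.add_sub_cancel, ← pow_mul, ← Finset.mul_prod_erase _ c (Finset.mem_univ i)]
    have : c i * (∏ x ∈ Finset.univ.erase i, c x) * (c i)⁻¹ = ∏ x ∈ Finset.univ.erase i, c x := by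
      rw [mul_comm (c i), mul_assoc, mul_inv_cancel₀ (hc0 i), mul_one]
    rw [this]
    ring
  rw [hprod, Finset.sum_congr rfl fun i _ => hterm i] at hmain
  -- both sides are divisible by `u^{m(m+1)}`; compare the leading coefficients
  have hcoeff := congrArg (PowerSeries.coeff (m * m + m)) hmain
  have hlhs : PowerSeries.coeff (m * m + m)
      (Φ g * (PowerSeries.C (∏ i, c i) * PowerSeries.X ^ (m * m + m))) =
      (∏ i, c i) * PowerSeries.coeff 0 (Φ g) := by
    have := PowerSeries.coeff_mul_X_pow (PowerSeries.C (∏ i, c i) * Φ g) (m * m + m) 0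
    rw [zero_add, PowerSeries.coeff_C_mul] at this
    rw [← this, ← mul_assoc, mul_comm (Φ g)]
  rw [hlhs, map_sum] at hcoeff
  have hrhs : ∀ i, PowerSeries.coeff (m * m + m)
      (PowerSeries.C ((∏ i, c i) * (c i)⁻¹) * Φ (h (e i)) * PowerSeries.X ^ (m * m)) =
      (∏ i, c i) * ((m + 1 : ℂ)⁻¹ * PowerSeries.coeff m (Φ (h (e 0)))) := by
    intro i
    rw [add_comm, PowerSeries.coeff_mul_X_pow, PowerSeries.coeff_C_mul, hΦh, hc]
    have h1 : rootsVec m i ^ m ≠ 0 := pow_ne_zero _ (rootsVec_ne_zero m i)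
    field_simp
  rw [Finset.sum_congr rfl fun i _ => hrhs i, Finset.sum_const, Finset.card_univ, Fintype.card_fin,
    nsmul_eq_mul] at hcoeff
  have hP : (∏ i, c i) ≠ 0 := Finset.prod_ne_zero_iff.2 fun i _ => hc0 i
  have h0 : PowerSeries.coeff 0 (Φ g) = constantCoeff g := by
    rw [hΦ, RingHom.comp_apply, constantCoeff_lineEval, ← coeff_zero_eq_constantCoeff_apply,
      ← coeff_zero_eq_constantCoeff_apply]
    refine (coeff_killCompl g 0).trans ?_
    rw [Finsupp.embDomain_zero]
  rw [← h0]
  refine mul_left_cancel₀ hP (hcoeff.trans ?_)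
  have hm : (m + 1 : ℂ) ≠ 0 := by exact_mod_cast Nat.succ_ne_zero m
  push_cast
  field_simp
  rfl

end LineEval

/-! ### Asymptotics of the moment operators in many variables -/

section Asymptotics

open MvPowerSeries

set_option linter.unusedSectionVars false

variable {σ : Type*} [DecidableEq σ]

theorem permAct_C (π : Equiv.Perm σ) (c : ℂ) : permAct π (C c) = C c := by
  simp [permAct]

theorem permAct_divSymOn {h : σ → MvPowerSeries σ ℂ} (hh : Equivariant h) (π : Equiv.Perm σ)
    (I : Finset σ) : permAct π (divSymOn I h) = divSymOn (I.map π.toEmbedding) h := by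
  rcases hI : I.toList with _ | ⟨a, t⟩
  · rw [Finset.toList_eq_nil] at hI
    subst hI
    simp [divSymOn]
  · have hnd := nodup_of_toList_eq hI
    have hnd' : (π a :: t.map π).Nodup := by
      have := hnd.map π.injective
      rwa [List.map_cons] at this
    rw [divSymOn_eq hI, permAct_divSym _ _ _ (List.nodup_cons.1 hnd).1, hh]
    apply toField_injective
    rw [toField_divSym hh _ _ hnd', toField_divSymOn hh]
    have : insert (π a) (t.map π).toFinset = I.map π.toEmbedding := by
      rw [← toFinset_of_toList_eq hI]
      ext x
      simp only [Finset.mem_insert, List.mem_toFinset, List.mem_map, Finset.mem_map_equiv]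
      rw [Equiv.symm_apply_eq]
      refine or_congr Iff.rfl ⟨?_, fun h => ⟨_, h, by simp⟩⟩
      rintro ⟨b, hb, rfl⟩
      simpa using hb
    rw [this]

theorem permAct_momentOp [Fintype σ] (k : ℕ) {f : MvPowerSeries σ ℂ}
    (hf : ∀ π : Equiv.Perm σ, permAct π f = f) (π : Equiv.Perm σ) :
    permAct π (momentOp k f) = momentOp k f := by
  unfold momentOp
  rw [map_sum]
  refine Finset.sum_congr rfl fun m _ => ?_
  rw [map_smul, map_sum]
  congr 1
  refine Finset.sum_bij' (fun I _ => I.map π.toEmbedding) (fun I _ => I.map π.symm.toEmbedding)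
    ?_ ?_ ?_ ?_ ?_
  · intro I hI
    rw [Finset.mem_powersetCard] at hI ⊢
    exact ⟨Finset.subset_univ _, by rw [Finset.card_map, hI.2]⟩
  · intro I hI
    rw [Finset.mem_powersetCard] at hI ⊢
    exact ⟨Finset.subset_univ _, by rw [Finset.card_map, hI.2]⟩
  · intro I _
    ext x
    simp
  · intro I _
    ext x
    simp
  · intro I _
    exact permAct_divSymOn (equivariant_of_symm hf k (k - m)) π I

theorem divSymOn_mul_of_symm {S : MvPowerSeries σ ℂ}
    (hS : ∀ π : Equiv.Perm σ, permAct π S = S) (I : Finset σ) (h : σ → MvPowerSeries σ ℂ) :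
    divSymOn I (fun a => S * h a) = S * divSymOn I h := by
  rcases hI : I.toList with _ | ⟨a, t⟩
  · rw [Finset.toList_eq_nil] at hI
    subst hI
    simp [divSymOn]
  · rw [divSymOn_eq hI, divSymOn_eq hI,
      divSym_mul_of_symm hS _ _ (List.nodup_cons.1 (nodup_of_toList_eq hI)).1]

/-- The series `p_q` with `∂_a^q (Q S) = c^q p_q S`, when `∂_a S = c L_a S`. -/
noncomputable def scaledDeriv (c : ℂ) (Q : MvPowerSeries σ ℂ) (L : σ → MvPowerSeries σ ℂ) (a : σ) :
    ℕ → MvPowerSeries σ ℂ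
  | 0 => Q
  | q + 1 => c⁻¹ • pderiv ℂ a (scaledDeriv c Q L a q) + L a * scaledDeriv c Q L a q

/-- The correction in `p_q = Q L_a^q + c⁻¹ e_q`. -/
noncomputable def scaledErr (c : ℂ) (Q : MvPowerSeries σ ℂ) (L : σ → MvPowerSeries σ ℂ) (a : σ) :
    ℕ → MvPowerSeries σ ℂ
  | 0 => 0
  | q + 1 => pderiv ℂ a (scaledDeriv c Q L a q) + L a * scaledErr c Q L a q

theorem scaledDeriv_eq (c : ℂ) (Q : MvPowerSeries σ ℂ) (L : σ → MvPowerSeries σ ℂ) (a : σ) (q : ℕ) :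
    scaledDeriv c Q L a q = Q * L a ^ q + c⁻¹ • scaledErr c Q L a q := by
  induction q with
  | zero => simp [scaledDeriv, scaledErr]
  | succ q ih =>
    rw [scaledDeriv, scaledErr, smul_add, add_comm]
    nth_rewrite 1 [ih]
    rw [mul_add, pow_succ, mul_smul_comm]
    ring

theorem iterate_pderiv_mul_eq {c : ℂ} (hc : c ≠ 0) (Q : MvPowerSeries σ ℂ)
    {S : MvPowerSeries σ ℂ} {L : σ → MvPowerSeries σ ℂ} {a : σ}
    (hL : pderiv ℂ a S = c • (L a * S)) (q : ℕ) :
    (pderiv ℂ a)^[q] (Q * S) = c ^ q • (scaledDeriv c Q L a q * S) := by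
  induction q with
  | zero => simp [scaledDeriv]
  | succ q ih =>
    rw [Function.iterate_succ_apply', ih, scaledDeriv, Derivation.map_smul, Derivation.leibniz, hL]
    have hC : (C c : MvPowerSeries σ ℂ) * C c⁻¹ = 1 := by
      rw [← map_mul, mul_inv_cancel₀ hc, map_one]
    simp only [smul_eq_C_mul, smul_eq_mul, pow_succ, map_mul]
    linear_combination (-(C (c ^ q) * S * (pderiv ℂ a) (scaledDeriv c Q L a q))) * hC

/-- The quotient `c^{-k-1} momentOp k (Q S) / S`, see `momentOp_mul_eq`. -/
noncomputable def momentQuot [Fintype σ] (k : ℕ) (c : ℂ) (Q : MvPowerSeries σ ℂ)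
    (L : σ → MvPowerSeries σ ℂ) : MvPowerSeries σ ℂ :=
  ∑ m ∈ Finset.range (k + 1), (((k.choose m * m.factorial : ℕ) : ℂ) * (c ^ (m + 1))⁻¹) •
    ∑ I ∈ Finset.univ.powersetCard (m + 1),
      divSymOn I fun a => (1 + X a) ^ k * scaledDeriv c Q L a (k - m)

/-- When `S` has logarithmic derivatives `c L_a`, the moment operator maps multiples of `S` to
multiples of `S`, and its order of magnitude `c^{k+1}` can be factored out. -/
theorem momentOp_mul_eq [Fintype σ] (k : ℕ) {c : ℂ} (hc : c ≠ 0) (Q : MvPowerSeries σ ℂ)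
    {S : MvPowerSeries σ ℂ} {L : σ → MvPowerSeries σ ℂ}
    (hS : ∀ π : Equiv.Perm σ, permAct π S = S)
    (hL : ∀ a, pderiv ℂ a S = c • (L a * S)) :
    momentOp k (Q * S) = c ^ (k + 1) • (S * momentQuot k c Q L) := by
  rw [momentOp, momentQuot, Finset.mul_sum, Finset.smul_sum]
  refine Finset.sum_congr rfl fun m hm => ?_
  have hmk : m ≤ k := Nat.lt_succ_iff.1 (Finset.mem_range.1 hm)
  have h1 : ∀ a, (1 + X a) ^ k * (pderiv ℂ a)^[k - m] (Q * S) =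
      (C (c ^ (k - m)) * S) * ((1 + X a) ^ k * scaledDeriv c Q L a (k - m)) := by
    intro a
    rw [iterate_pderiv_mul_eq hc Q (hL a), smul_eq_C_mul]
    ring
  have h2 : ∀ π : Equiv.Perm σ, permAct π (C (c ^ (k - m)) * S) = C (c ^ (k - m)) * S := by
    intro π
    rw [map_mul, hS, permAct_C]
  simp only [h1]
  rw [Finset.sum_congr rfl fun I _ => divSymOn_mul_of_symm h2 I _, ← Finset.mul_sum]
  have h3 : c ^ (k + 1) * (c ^ (m + 1))⁻¹ = c ^ (k - m) := by
    rw [show k + 1 = (k - m) + (m + 1) by omega, pow_add, mul_assoc,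
      mul_inv_cancel₀ (pow_ne_zero _ hc), mul_one]
  rw [mul_smul_comm, smul_smul, mul_left_comm, h3, mul_smul, mul_assoc, ← smul_eq_C_mul]

/-- Boundedness of families of power series in `N` variables, indexed by the variables: for every
degree `d`, the coefficients of degree at most `d` are bounded uniformly in large `N`. -/
def UnifBdd (f : ∀ N : ℕ, Fin N → MvPowerSeries (Fin N) ℂ) : Prop :=
  ∀ d, ∃ C : ℝ, ∀ᶠ N : ℕ in atTop, ∀ i, BddBy d C (f N i)

namespace UnifBdd

variable {f g : ∀ N : ℕ, Fin N → MvPowerSeries (Fin N) ℂ}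

theorem add (hf : UnifBdd f) (hg : UnifBdd g) : UnifBdd fun N i => f N i + g N i := by
  intro d
  obtain ⟨C, hC⟩ := hf d
  obtain ⟨C', hC'⟩ := hg d
  exact ⟨C + C', by filter_upwards [hC, hC'] with N h1 h2 i using (h1 i).add (h2 i)⟩

theorem mul (hf : UnifBdd f) (hg : UnifBdd g) : UnifBdd fun N i => f N i * g N i := by
  intro d
  obtain ⟨C, hC⟩ := hf d
  obtain ⟨C', hC'⟩ := hg d
  exact ⟨_, by filter_upwards [hC, hC'] with N h1 h2 i using (h1 i).mul (h2 i)⟩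

theorem pow (hf : UnifBdd f) (q : ℕ) : UnifBdd fun N i => f N i ^ q := by
  intro d
  obtain ⟨C, hC⟩ := hf d
  exact ⟨_, by filter_upwards [hC] with N h1 i using (h1 i).pow q⟩

theorem pderiv (hf : UnifBdd f) : UnifBdd fun N i => pderiv ℂ i (f N i) := by
  intro d
  obtain ⟨C, hC⟩ := hf (d + 1)
  exact ⟨_, by filter_upwards [hC] with N h1 i using (h1 i).pderiv i⟩

theorem inv_smul (hf : UnifBdd f) : UnifBdd fun N i => (N : ℂ)⁻¹ • f N i := by
  intro d
  obtain ⟨C, hC⟩ := hf d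
  refine ⟨C, ?_⟩
  filter_upwards [hC] with N h1 i
  refine ((h1 i).smul _).mono (mul_le_of_le_one_left (h1 i).nonneg ?_)
  rw [norm_inv, Complex.norm_natCast]
  exact Nat.cast_inv_le_one N

theorem zero : UnifBdd fun _ _ => 0 := fun _ => ⟨0, Eventually.of_forall fun _ _ => BddBy.zero⟩

theorem one_add_X_pow (k : ℕ) : UnifBdd fun _ i => (1 + X i) ^ k :=
  pow (fun _ => ⟨2, Eventually.of_forall fun _ i => BddBy.one_add_X i⟩) k

end UnifBdd

/-- Coefficientwise convergence of power series. -/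
def CoeffTendsto (f : ℕ → MvPowerSeries σ ℂ) (F : MvPowerSeries σ ℂ) : Prop :=
  ∀ α, Tendsto (fun N => coeff α (f N)) atTop (𝓝 (coeff α F))

namespace CoeffTendsto

variable {f g : ℕ → MvPowerSeries σ ℂ} {F G : MvPowerSeries σ ℂ}

theorem const (F : MvPowerSeries σ ℂ) : CoeffTendsto (fun _ => F) F :=
  fun _ => tendsto_const_nhds

theorem mul (hf : CoeffTendsto f F) (hg : CoeffTendsto g G) :
    CoeffTendsto (fun N => f N * g N) (F * G) := by
  intro α
  simp only [coeff_mul]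
  exact tendsto_finsetSum _ fun p _ => (hf p.1).mul (hg p.2)

theorem pow (hf : CoeffTendsto f F) (q : ℕ) : CoeffTendsto (fun N => f N ^ q) (F ^ q) := by
  induction q with
  | zero => simpa using const 1
  | succ q ih =>
    simp only [pow_succ]
    exact ih.mul hf

theorem coeff_lineEval {n : ℕ} {f : ℕ → MvPowerSeries (Fin n) ℂ} {F : MvPowerSeries (Fin n) ℂ}
    (hf : CoeffTendsto f F) (c : Fin n → ℂ) (d : ℕ) :
    Tendsto (fun N => PowerSeries.coeff d (lineEval c (f N))) atTop
      (𝓝 (PowerSeries.coeff d (lineEval c F))) := by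
  simp only [SchurLLN.coeff_lineEval]
  exact tendsto_finsetSum _ fun β _ => (hf β).const_mul _

end CoeffTendsto

/-- Symmetric power series `S_N` in `N` variables with logarithmic derivatives of order `N`:
`∂_i S_N = N L_{N,i} S_N`, such that the restriction of `L_{N,i}` to any `n + 1` variables, the
first of which is the `i`-th one, converges to `G_n`. -/
structure LogDerivConverges (S : ∀ N : ℕ, MvPowerSeries (Fin N) ℂ)
    (L : ∀ N : ℕ, Fin N → MvPowerSeries (Fin N) ℂ) (G : ∀ n : ℕ, MvPowerSeries (Fin (n + 1)) ℂ) :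
    Prop where
  symm : ∀ N, 1 ≤ N → ∀ π : Equiv.Perm (Fin N), permAct π (S N) = S N
  ne_zero : ∀ N, 1 ≤ N → S N ≠ 0
  pderiv_eq : ∀ N i, pderiv ℂ i (S N) = (N : ℂ) • (L N i * S N)
  lim : ∀ n, ∃ ℓ : ℕ → MvPowerSeries (Fin (n + 1)) ℂ,
    (∀ᶠ N : ℕ in atTop, ∀ e : Fin (n + 1) ↪ Fin N, killCompl e (L N (e 0)) = ℓ N) ∧
      CoeffTendsto ℓ (G n)

/-- The limit of the normalized `k`-th moment, in terms of the limits of the logarithmic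
derivatives. -/
noncomputable def formalMoment (G : ∀ n : ℕ, MvPowerSeries (Fin (n + 1)) ℂ) (k : ℕ) : ℂ :=
  ∑ m ∈ Finset.range (k + 1), (k.choose m : ℂ) * (1 / (m + 1) *
    PowerSeries.coeff m (lineEval (rootsVec m) ((1 + X 0) ^ k * G m ^ (k - m))))

/-- A monomial of degree at most `d` involves, together with a marked variable, at most `d + 1`
variables. -/
theorem exists_embedding_of_degree_le {N d : ℕ} (hN : d + 1 ≤ N) (i : Fin N) (α : Fin N →₀ ℕ)
    (hα : α.degree ≤ d) :
    ∃ (e : Fin (d + 1) ↪ Fin N) (β : Fin (d + 1) →₀ ℕ), e 0 = i ∧ α = β.embDomain e ∧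
      β.degree ≤ d := by
  have hcard : (insert i α.support).card ≤ d + 1 := by
    refine (Finset.card_insert_le _ _).trans (Nat.succ_le_succ (le_trans ?_ hα))
    rw [Finsupp.degree_apply, Finset.card_eq_sum_ones]
    exact Finset.sum_le_sum fun j hj => Nat.one_le_iff_ne_zero.2 (Finsupp.mem_support_iff.1 hj)
  obtain ⟨s, hs, -, hscard⟩ := Finset.exists_subsuperset_card_eq (Finset.subset_univ _) hcard
    (by simpa using hN)
  obtain ⟨e₀⟩ : Nonempty (Fin (d + 1) ≃ s) := ⟨(s.equivFinOfCardEq hscard).symm⟩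
  obtain ⟨j₀, hj₀⟩ : ∃ j₀, e₀ j₀ = ⟨i, hs (Finset.mem_insert_self _ _)⟩ := e₀.surjective _
  let e : Fin (d + 1) ↪ Fin N :=
    ((Equiv.swap 0 j₀).trans e₀).toEmbedding.trans (Function.Embedding.subtype _)
  have he0 : e 0 = i := by
    simp [e, hj₀]
  have hrange : ∀ x ∈ s, x ∈ Set.range e := by
    intro x hx
    refine ⟨(Equiv.swap 0 j₀).symm (e₀.symm ⟨x, hx⟩), ?_⟩
    simp [e]
  have hα' : α ∈ Set.range (Finsupp.embDomain e) := by
    rw [Finsupp.mem_range_embDomain_iff]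
    intro x hx
    exact hrange x (hs (Finset.mem_insert_of_mem hx))
  obtain ⟨β, rfl⟩ := hα'
  refine ⟨e, β, he0, rfl, ?_⟩
  rwa [Finsupp.embDomain_eq_mapDomain, Finsupp.degree_mapDomain] at hα

variable {S : ∀ N : ℕ, MvPowerSeries (Fin N) ℂ} {L : ∀ N : ℕ, Fin N → MvPowerSeries (Fin N) ℂ}
  {G : ∀ n : ℕ, MvPowerSeries (Fin (n + 1)) ℂ}

namespace LogDerivConverges

theorem equivariant (h : LogDerivConverges S L G) (N : ℕ) : Equivariant (L N) := by
  intro π i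
  have hN : 1 ≤ N := i.pos
  have h1 := h.pderiv_eq N (π i)
  rw [← h.symm N hN π, ← permAct_pderiv, h.pderiv_eq, map_smul, map_mul, h.symm N hN π] at h1
  have hN0 : (N : ℂ) ≠ 0 := by exact_mod_cast (by omega : N ≠ 0)
  exact mul_right_cancel₀ (h.ne_zero N hN) (smul_right_injective _ hN0 h1)

/-- By symmetry, every coefficient of degree at most `d` of the logarithmic derivatives already
occurs in a restriction to `d + 1` variables. -/
theorem unifBdd (h : LogDerivConverges S L G) : UnifBdd L := by
  intro d
  obtain ⟨ℓ, hℓ, hlim⟩ := h.lim d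
  have hfin := Finsupp.finite_of_degree_le (σ := Fin (d + 1)) d
  set B := hfin.toFinset with hB
  refine ⟨∑ β ∈ B, (‖coeff β (G d)‖ + 1), ?_⟩
  have hev : ∀ᶠ N : ℕ in atTop, ∀ β ∈ B, ‖coeff β (ℓ N)‖ ≤ ‖coeff β (G d)‖ + 1 := by
    rw [Filter.eventually_all_finset]
    intro β _
    exact ((hlim β).norm.eventually_lt_const (lt_add_one _)).mono fun _ => le_of_lt
  filter_upwards [hℓ, hev, eventually_ge_atTop (d + 1)] with N h1 h2 h3 i α hα
  obtain ⟨e, β, rfl, rfl, hβ⟩ := exists_embedding_of_degree_le h3 i α hα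
  rw [← coeff_killCompl, h1]
  have hβB : β ∈ B := by
    rw [hB, Set.Finite.mem_toFinset]
    exact hβ
  refine (h2 β hβB).trans ?_
  exact Finset.single_le_sum (f := fun β => ‖coeff β (G d)‖ + 1) (fun _ _ => by positivity) hβB

theorem unifBdd_scaledDeriv (h : LogDerivConverges S L G) {Q : ∀ N : ℕ, MvPowerSeries (Fin N) ℂ}
    (hQ : UnifBdd fun N _ => Q N) (q : ℕ) :
    UnifBdd fun N a => scaledDeriv (N : ℂ) (Q N) (L N) a q := by
  induction q with
  | zero => exact hQ
  | succ q ih => exact ih.pderiv.inv_smul.add (h.unifBdd.mul ih)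

theorem unifBdd_scaledErr (h : LogDerivConverges S L G) {Q : ∀ N : ℕ, MvPowerSeries (Fin N) ℂ}
    (hQ : UnifBdd fun N _ => Q N) (q : ℕ) :
    UnifBdd fun N a => scaledErr (N : ℂ) (Q N) (L N) a q := by
  induction q with
  | zero => exact UnifBdd.zero
  | succ q ih => exact (h.unifBdd_scaledDeriv hQ q).pderiv.add (h.unifBdd.mul ih)

end LogDerivConverges

theorem UnifBdd.divSymOn {f : ∀ N : ℕ, Fin N → MvPowerSeries (Fin N) ℂ} (hf : UnifBdd f)
    (m d : ℕ) : ∃ C : ℝ, 0 ≤ C ∧ ∀ᶠ N : ℕ in atTop,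
      ∀ I ∈ (Finset.univ : Finset (Fin N)).powersetCard (m + 1), BddBy d C (divSymOn I (f N)) := by
  obtain ⟨K, hK, h⟩ := exists_bddBy_divSym m d
  obtain ⟨C, hC⟩ := hf (d + m)
  refine ⟨K * |C|, by positivity, ?_⟩
  filter_upwards [hC] with N hN I hI
  rw [Finset.mem_powersetCard] at hI
  rcases hl : I.toList with _ | ⟨a, t⟩
  · have := congrArg List.length hl
    rw [Finset.length_toList, hI.2] at this
    simp at this
  · rw [divSymOn_eq hl]
    refine h a t _ _ ?_ (List.nodup_cons.1 (nodup_of_toList_eq hl)).1 ((hN a).mono (le_abs_self _))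
    have := congrArg List.length hl
    rw [Finset.length_toList, hI.2] at this
    simpa using this.symm

theorem norm_choose_mul_inv_pow_le (N m : ℕ) :
    (N.choose (m + 1) : ℝ) * ‖((N : ℂ) ^ (m + 1))⁻¹‖ ≤ 1 := by
  rw [norm_inv, norm_pow, Complex.norm_natCast]
  have h1 : (N.choose (m + 1) : ℝ) ≤ (N : ℝ) ^ (m + 1) := by
    exact_mod_cast Nat.choose_le_pow N (m + 1)
  rcases eq_or_ne N 0 with rfl | hN
  · simp
  · have : (0 : ℝ) < (N : ℝ) ^ (m + 1) := by positivity
    rw [← div_eq_mul_inv, div_le_one this]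
    exact h1

theorem tendsto_choose_mul_factorial (m : ℕ) :
    Tendsto (fun N : ℕ => (m.factorial : ℂ) * ((N : ℂ) ^ (m + 1))⁻¹ * N.choose (m + 1)) atTop
      (𝓝 (1 / (m + 1))) := by
  have h1 : Tendsto (fun N : ℕ => (m.factorial : ℝ) * ((N : ℝ) ^ (m + 1))⁻¹ * N.choose (m + 1)) atTop
      (𝓝 (1 / (m + 1))) := by
    have h2 := (Asymptotics.isEquivalent_iff_tendsto_one ?_).1 (isEquivalent_choose (m + 1))
    · have h3 := h2.const_mul (1 / ((m : ℝ) + 1))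
      rw [mul_one] at h3
      refine h3.congr' ?_
      filter_upwards [eventually_ge_atTop 1] with N hN
      simp only [Pi.div_apply]
      rw [Nat.factorial_succ]
      have hN' : (N : ℝ) ≠ 0 := by exact_mod_cast (by omega : N ≠ 0)
      have hm : (m.factorial : ℝ) ≠ 0 := by exact_mod_cast m.factorial_ne_zero
      push_cast
      field_simp
    · filter_upwards [eventually_ge_atTop 1] with N hN
      have hN' : (N : ℝ) ≠ 0 := by exact_mod_cast (by omega : N ≠ 0)
      have hm : ((m + 1).factorial : ℝ) ≠ 0 := by exact_mod_cast (m + 1).factorial_ne_zero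
      exact div_ne_zero (pow_ne_zero _ hN') hm
  have h2 := (Complex.continuous_ofReal.tendsto _).comp h1
  refine (h2.congr fun N => ?_).trans (le_of_eq ?_)
  · simp
  · simp

namespace LogDerivConverges

/-- The `N choose (m + 1)` divided symmetrizations in `momentQuot` are compensated by the factor
`N^{-m-1}`. -/
theorem unifBdd_momentQuot (h : LogDerivConverges S L G) {Q : ∀ N : ℕ, MvPowerSeries (Fin N) ℂ}
    (hQ : UnifBdd fun N _ => Q N) (k : ℕ) :
    UnifBdd fun N _ => momentQuot k (N : ℂ) (Q N) (L N) := by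
  intro d
  choose C hC0 hC using fun m => ((UnifBdd.one_add_X_pow k).mul
    (h.unifBdd_scaledDeriv hQ (k - m))).divSymOn m d
  refine ⟨∑ m ∈ Finset.range (k + 1), ((k.choose m * m.factorial : ℕ) : ℝ) * C m, ?_⟩
  have hall : ∀ᶠ N : ℕ in atTop, ∀ m ∈ Finset.range (k + 1),
      ∀ I ∈ (Finset.univ : Finset (Fin N)).powersetCard (m + 1),
      BddBy d (C m) (SchurLLN.divSymOn I fun a =>
        (1 + X a) ^ k * scaledDeriv (N : ℂ) (Q N) (L N) a (k - m)) := by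
    rw [Filter.eventually_all_finset]
    exact fun m _ => hC m
  filter_upwards [hall] with N hN _
  refine BddBy.sum _ fun m hm => ?_
  refine (BddBy.smul _ (BddBy.sum _ (hN m hm))).mono ?_
  rw [Finset.sum_const, Finset.card_powersetCard, Finset.card_univ, Fintype.card_fin, nsmul_eq_mul,
    norm_mul, Complex.norm_natCast, mul_assoc]
  refine mul_le_mul_of_nonneg_left ?_ (Nat.cast_nonneg _)
  rw [← mul_assoc, mul_comm ‖_‖]
  exact mul_le_of_le_one_left (hC0 m) (norm_choose_mul_inv_pow_le N m)

/-- The constant coefficient of `momentQuot` is asymptotically that of `Q` times a constant that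
does not depend on `Q`; this is the source of both the convergence of moments and their
concentration. -/
theorem tendsto_constantCoeff_momentQuot (h : LogDerivConverges S L G)
    {Q : ∀ N : ℕ, MvPowerSeries (Fin N) ℂ} (hQ : UnifBdd fun N _ => Q N)
    (hQs : ∀ N, 1 ≤ N → ∀ π : Equiv.Perm (Fin N), permAct π (Q N) = Q N) (k : ℕ) :
    Tendsto (fun N : ℕ => constantCoeff (momentQuot k (N : ℂ) (Q N) (L N)) -
      constantCoeff (Q N) * formalMoment G k) atTop (𝓝 0) := by
  choose ℓ hℓ hlim using h.lim
  -- the contributions of the main term and of the error term of `scaledDeriv`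
  set A : ℕ → ℕ → ℂ := fun m N =>
    PowerSeries.coeff m (lineEval (rootsVec m) ((1 + X 0) ^ k * ℓ m N ^ (k - m))) with hA
  set E : ∀ m N : ℕ, Finset (Fin N) → ℂ := fun m N I => constantCoeff (SchurLLN.divSymOn I fun a =>
        (1 + X a) ^ k * scaledErr (N : ℂ) (Q N) (L N) a (k - m)) with hE
  have hAlim : ∀ m, Tendsto (A m) atTop
      (𝓝 (PowerSeries.coeff m (lineEval (rootsVec m) ((1 + X 0) ^ k * G m ^ (k - m))))) :=
    fun m => ((CoeffTendsto.const _).mul ((hlim m).pow _)).coeff_lineEval _ _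
  -- by symmetry the main term is the same for all sets `I` of variables
  have hconst : ∀ m, ∀ᶠ N : ℕ in atTop, ∀ I ∈ (Finset.univ : Finset (Fin N)).powersetCard (m + 1),
      constantCoeff (SchurLLN.divSymOn I fun a =>
        (1 + X a) ^ k * scaledDeriv (N : ℂ) (Q N) (L N) a (k - m)) =
      constantCoeff (Q N) * A m N + (N : ℂ)⁻¹ * E m N I := by
    intro m
    filter_upwards [hℓ m, eventually_ge_atTop 1] with N hN hN1 I hI
    rw [Finset.mem_powersetCard] at hI
    rcases hl : I.toList with _ | ⟨a, t⟩
    · have := congrArg List.length hl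
      rw [Finset.length_toList, hI.2] at this
      simp at this
    have hnd := nodup_of_toList_eq hl
    have hlen : (a :: t).length = m + 1 := by
      rw [← hl, Finset.length_toList, hI.2]
    let e : Fin (m + 1) ↪ Fin N :=
      ⟨fun j => (a :: t).get (j.cast hlen.symm), fun i j hij => by
        have := (List.nodup_iff_injective_get.1 hnd) hij
        simpa using this⟩
    have he0 : e 0 = a := rfl
    have hemap : insert (e 0) t.toFinset = Finset.univ.map e := by
      ext x
      rw [he0, ← List.toFinset_cons, List.mem_toFinset, List.mem_iff_get]
      simp only [Finset.mem_map, Finset.mem_univ, true_and]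
      constructor
      · rintro ⟨n, rfl⟩
        exact ⟨n.cast hlen, rfl⟩
      · rintro ⟨j, rfl⟩
        exact ⟨j.cast hlen.symm, rfl⟩
    have hequiv : Equivariant fun b => (1 + X b) ^ k * L N b ^ (k - m) := by
      intro π b
      simp [h.equivariant N π b]
    have hmain := constantCoeff_divSym hequiv e t (by rw [he0]; exact hnd) hemap
    rw [hE]
    simp only [divSymOn_eq hl]
    have hsplit : (1 + X a) ^ k * scaledDeriv (N : ℂ) (Q N) (L N) a (k - m) =
        Q N * ((1 + X a) ^ k * L N a ^ (k - m)) +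
          C (N : ℂ)⁻¹ * ((1 + X a) ^ k * scaledErr (N : ℂ) (Q N) (L N) a (k - m)) := by
      rw [scaledDeriv_eq, smul_eq_C_mul]
      ring
    have hat := (List.nodup_cons.1 hnd).1
    rw [hsplit, divSym_add, divSym_mul_of_symm (hQs N hN1) _ _ hat,
      divSym_mul_of_symm (S := C (N : ℂ)⁻¹) (fun π => permAct_C π _) _ _ hat, map_add, map_mul, map_mul,
      constantCoeff_C]
    congr 2
    rw [he0] at hmain
    rw [hmain, hA]
    simp only
    rw [map_mul, map_pow, map_pow, ← hN e, he0, map_add, map_one]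
    congr 5
    rw [← he0]
    exact killCompl_X 0
  -- the error terms are uniformly bounded
  choose C hC0 hC using fun m => ((UnifBdd.one_add_X_pow k).mul
    (h.unifBdd_scaledErr hQ (k - m))).divSymOn m 0
  have hEbd : ∀ m, ∀ᶠ N : ℕ in atTop, ∀ I ∈ (Finset.univ : Finset (Fin N)).powersetCard (m + 1),
      ‖E m N I‖ ≤ C m := by
    intro m
    filter_upwards [hC m] with N hN I hI
    have := hN I hI 0 (by simp)
    rwa [coeff_zero_eq_constantCoeff_apply] at this
  -- `r m N` counts the sets of variables, `δ m N` collects the error terms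
  set r : ℕ → ℕ → ℂ := fun m N =>
    (m.factorial : ℂ) * ((N : ℂ) ^ (m + 1))⁻¹ * N.choose (m + 1) with hr
  set δ : ℕ → ℕ → ℂ := fun m N => (m.factorial : ℂ) * ((N : ℂ) ^ (m + 1))⁻¹ *
    ∑ I ∈ (Finset.univ : Finset (Fin N)).powersetCard (m + 1), (N : ℂ)⁻¹ * E m N I with hδ
  have hδlim : ∀ m, Tendsto (δ m) atTop (𝓝 0) := by
    intro m
    have hb : Tendsto (fun N : ℕ => (m.factorial : ℝ) * C m * (N : ℝ)⁻¹) atTop (𝓝 0) := by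
      simpa using (tendsto_inv_atTop_nhds_zero_nat (𝕜 := ℝ)).const_mul ((m.factorial : ℝ) * C m)
    refine squeeze_zero_norm' ?_ hb
    filter_upwards [hEbd m] with N hN
    rw [hδ]
    simp only
    rw [← Finset.mul_sum, norm_mul, norm_mul, norm_mul, Complex.norm_natCast]
    have h1 := norm_sum_le_of_le _ hN
    rw [Finset.sum_const, Finset.card_powersetCard, Finset.card_univ, Fintype.card_fin,
      nsmul_eq_mul] at h1
    have h2 : ‖(N : ℂ)⁻¹‖ = (N : ℝ)⁻¹ := by rw [norm_inv, Complex.norm_natCast]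
    rw [h2]
    have h3 := norm_choose_mul_inv_pow_le N m
    have h4 : (0 : ℝ) ≤ (N : ℝ)⁻¹ := by positivity
    calc (m.factorial : ℝ) * ‖((N : ℂ) ^ (m + 1))⁻¹‖ * ((N : ℝ)⁻¹ *
          ‖∑ I ∈ (Finset.univ : Finset (Fin N)).powersetCard (m + 1), E m N I‖) ≤
        (m.factorial : ℝ) * ‖((N : ℂ) ^ (m + 1))⁻¹‖ * ((N : ℝ)⁻¹ * (N.choose (m + 1) * C m)) := by
          gcongr
      _ = (m.factorial : ℝ) * C m * (N : ℝ)⁻¹ *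
          (N.choose (m + 1) * ‖((N : ℂ) ^ (m + 1))⁻¹‖) := by ring
      _ ≤ (m.factorial : ℝ) * C m * (N : ℝ)⁻¹ * 1 := by
          refine mul_le_mul_of_nonneg_left h3 ?_
          have := hC0 m
          positivity
      _ = _ := by ring
  have hformula : ∀ᶠ N : ℕ in atTop, constantCoeff (momentQuot k (N : ℂ) (Q N) (L N)) -
      constantCoeff (Q N) * formalMoment G k =
      constantCoeff (Q N) * (∑ m ∈ Finset.range (k + 1), (k.choose m : ℂ) * (r m N * A m N) -
        formalMoment G k) + ∑ m ∈ Finset.range (k + 1), (k.choose m : ℂ) * δ m N := by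
    have hall : ∀ᶠ N : ℕ in atTop, ∀ m ∈ Finset.range (k + 1),
      ∀ I ∈ (Finset.univ : Finset (Fin N)).powersetCard (m + 1),
      constantCoeff (SchurLLN.divSymOn I fun a =>
        (1 + X a) ^ k * scaledDeriv (N : ℂ) (Q N) (L N) a (k - m)) =
      constantCoeff (Q N) * A m N + (N : ℂ)⁻¹ * E m N I := by
      rw [Filter.eventually_all_finset]
      exact fun m _ => hconst m
    filter_upwards [hall] with N hN
    rw [mul_sub, Finset.mul_sum, sub_add_eq_add_sub, ← Finset.sum_add_distrib, momentQuot, map_sum]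
    congr 1
    refine Finset.sum_congr rfl fun m hm => ?_
    rw [constantCoeff_smul, map_sum, Finset.sum_congr rfl (hN m hm), Finset.sum_add_distrib,
      Finset.sum_const, Finset.card_powersetCard, Finset.card_univ, Fintype.card_fin, nsmul_eq_mul,
      hδ, hr, smul_eq_mul]
    push_cast
    ring
  refine (Tendsto.congr' (hformula.mono fun N hN => hN.symm)) ?_
  have h1 : Tendsto (fun N => ∑ m ∈ Finset.range (k + 1), (k.choose m : ℂ) * (r m N * A m N) -
        formalMoment G k) atTop (𝓝 0) := by
    rw [← sub_self (formalMoment G k)]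
    exact (tendsto_finsetSum _ fun m _ =>
      ((tendsto_choose_mul_factorial m).mul (hAlim m)).const_mul _).sub_const _
  have h2 : Tendsto (fun N => ∑ m ∈ Finset.range (k + 1), (k.choose m : ℂ) * δ m N) atTop (𝓝 0) := by
    have := tendsto_finsetSum (Finset.range (k + 1)) fun m _ => (hδlim m).const_mul (k.choose m : ℂ)
    simpa using this
  obtain ⟨B, hB⟩ := hQ 0
  have h3 : Tendsto (fun N => constantCoeff (Q N) *
      (∑ m ∈ Finset.range (k + 1), (k.choose m : ℂ) * (r m N * A m N) -
        formalMoment G k)) atTop (𝓝 0) := by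
    have hb := (h1.norm.const_mul B)
    rw [norm_zero, mul_zero] at hb
    refine squeeze_zero_norm' ?_ hb
    filter_upwards [hB, eventually_ge_atTop 1] with N hN hN1
    rw [norm_mul]
    refine mul_le_mul_of_nonneg_right ?_ (norm_nonneg _)
    have := hN ⟨0, hN1⟩ 0 (by simp)
    rwa [coeff_zero_eq_constantCoeff_apply] at this
  simpa using h3.add h2

end LogDerivConverges

end Asymptotics

/-! ### Taylor series at `1^n` -/

section Taylor

open MvPowerSeries

set_option linter.unusedSectionVars false

variable {n : ℕ}

/-- The `j`-th partial derivative. -/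
noncomputable def pd (j : Fin n) (f : (Fin n → ℂ) → ℂ) : (Fin n → ℂ) → ℂ :=
  fun x => fderiv ℂ f x (Pi.single j 1)

theorem pd_eq_deriv (j : Fin n) {f : (Fin n → ℂ) → ℂ} {x : Fin n → ℂ}
    (hf : DifferentiableAt ℂ f x) :
    pd j f x = deriv (fun z : ℂ => f (Function.update x j z)) (x j) := by
  have h1 : HasDerivAt (fun z : ℂ => Function.update x j z) (Pi.single j 1) (x j) :=
    hasDerivAt_update x j (x j)
  have h2 : HasFDerivAt f (fderiv ℂ f x) (Function.update x j (x j)) := by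
    rw [Function.update_eq_self]
    exact hf.hasFDerivAt
  exact (h2.comp_hasDerivAt (x j) h1).deriv.symm

theorem pd_congr (j : Fin n) {f g : (Fin n → ℂ) → ℂ} {x : Fin n → ℂ} (h : f =ᶠ[𝓝 x] g) :
    pd j f =ᶠ[𝓝 x] pd j g := by
  filter_upwards [h.fderiv (𝕜 := ℂ)] with y hy
  rw [pd, pd, hy]

theorem analyticAt_pd (j : Fin n) {f : (Fin n → ℂ) → ℂ} {x : Fin n → ℂ} (hf : AnalyticAt ℂ f x) :
    AnalyticAt ℂ (pd j f) x :=
  ((ContinuousLinearMap.apply ℂ ℂ (Pi.single j (1 : ℂ) : Fin n → ℂ)).analyticAt _).comp hf.fderiv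

theorem pd_comm (i j : Fin n) {f : (Fin n → ℂ) → ℂ} {x : Fin n → ℂ} (hf : AnalyticAt ℂ f x) :
    pd i (pd j f) =ᶠ[𝓝 x] pd j (pd i f) := by
  filter_upwards [hf.eventually_analyticAt] with y hy
  have h1 : ∀ k : Fin n, fderiv ℂ (pd k f) y = (fderiv ℂ (fderiv ℂ f) y).flip (Pi.single k 1) := by
    intro k
    have hd : DifferentiableAt ℂ (fderiv ℂ f) y := hy.fderiv.differentiableAt
    have := fderiv_clm_apply hd (differentiableAt_const (Pi.single k (1 : ℂ) : Fin n → ℂ))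
    simp only [fderiv_fun_const, Pi.zero_apply, ContinuousLinearMap.comp_zero, zero_add] at this
    exact this
  have hs : IsSymmSndFDerivAt ℂ f y :=
    (hy.contDiffAt (n := ⊤)).isSymmSndFDerivAt (by simp)
  show fderiv ℂ (pd j f) y (Pi.single i 1) = fderiv ℂ (pd i f) y (Pi.single j 1)
  rw [h1, h1, ContinuousLinearMap.flip_apply, ContinuousLinearMap.flip_apply]
  exact hs _ _

/-- The iterated partial derivative along a word. -/
noncomputable def wordD : List (Fin n) → ((Fin n → ℂ) → ℂ) → (Fin n → ℂ) → ℂ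
  | [], f => f
  | j :: w, f => wordD w (pd j f)

theorem wordD_congr (w : List (Fin n)) {f g : (Fin n → ℂ) → ℂ} {x : Fin n → ℂ}
    (h : f =ᶠ[𝓝 x] g) : wordD w f =ᶠ[𝓝 x] wordD w g := by
  induction w generalizing f g with
  | nil => exact h
  | cons j w ih => exact ih (pd_congr j h)

theorem wordD_perm {w w' : List (Fin n)} (hw : w.Perm w') {f : (Fin n → ℂ) → ℂ} {x : Fin n → ℂ}
    (hf : AnalyticAt ℂ f x) : wordD w f x = wordD w' f x := by
  induction hw generalizing f with
  | nil => rfl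
  | cons j _ ih => exact ih (analyticAt_pd j hf)
  | swap i j w => exact (wordD_congr w (pd_comm i j hf)).eq_of_nhds
  | trans _ _ ih ih' => exact (ih hf).trans (ih' hf)

/-- The point `1^n`. -/
abbrev onePt (n : ℕ) : Fin n → ℂ := fun _ => 1

/-- The product of the factorials of the exponents. -/
noncomputable def finsuppFactorial (α : Fin n →₀ ℕ) : ℂ := ∏ i, ((α i).factorial : ℂ)

theorem finsuppFactorial_ne_zero (α : Fin n →₀ ℕ) : finsuppFactorial α ≠ 0 :=
  Finset.prod_ne_zero_iff.2 fun i _ => by exact_mod_cast (α i).factorial_ne_zero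

theorem finsuppFactorial_add_single (α : Fin n →₀ ℕ) (j : Fin n) :
    finsuppFactorial (α + Finsupp.single j 1) = finsuppFactorial α * (α j + 1) := by
  rw [finsuppFactorial, finsuppFactorial, ← Finset.mul_prod_erase _ _ (Finset.mem_univ j),
    ← Finset.mul_prod_erase Finset.univ (fun i => ((α i).factorial : ℂ)) (Finset.mem_univ j)]
  have : ∏ x ∈ Finset.univ.erase j, (((α + Finsupp.single j 1 : Fin n →₀ ℕ) x).factorial : ℂ) =
      ∏ x ∈ Finset.univ.erase j, ((α x).factorial : ℂ) := by
    refine Finset.prod_congr rfl fun i hi => ?_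
    rw [Finsupp.add_apply, Finsupp.single_eq_of_ne (Finset.ne_of_mem_erase hi), add_zero]
  rw [this, Finsupp.add_apply, Finsupp.single_eq_same, Nat.factorial_succ]
  push_cast
  ring

/-- The Taylor series of `f` at `1^n`, in the variables `X_j = x_j - 1`. The coefficients are defined
by iterated partial derivatives, in an order that does not matter for analytic `f`. -/
noncomputable def taylor (f : (Fin n → ℂ) → ℂ) : MvPowerSeries (Fin n) ℂ :=
  fun α => wordD α.toMultiset.toList f (onePt n) / finsuppFactorial α

theorem coeff_taylor (f : (Fin n → ℂ) → ℂ) (α : Fin n →₀ ℕ) :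
    coeff α (taylor f) = wordD α.toMultiset.toList f (onePt n) / finsuppFactorial α := rfl

theorem taylor_congr {f g : (Fin n → ℂ) → ℂ} (h : f =ᶠ[𝓝 (onePt n)] g) : taylor f = taylor g := by
  ext α
  rw [coeff_taylor, coeff_taylor, (wordD_congr _ h).eq_of_nhds]

theorem constantCoeff_taylor (f : (Fin n → ℂ) → ℂ) : constantCoeff (taylor f) = f (onePt n) := by
  rw [← coeff_zero_eq_constantCoeff_apply, coeff_taylor]
  simp [wordD, finsuppFactorial]

theorem pderiv_taylor (j : Fin n) {f : (Fin n → ℂ) → ℂ} (hf : AnalyticAt ℂ f (onePt n)) :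
    pderiv ℂ j (taylor f) = taylor (pd j f) := by
  ext α
  rw [coeff_pderiv, coeff_taylor, coeff_taylor, finsuppFactorial_add_single]
  have h1 : (α + Finsupp.single j 1).toMultiset.toList.Perm (j :: α.toMultiset.toList) := by
    rw [← Multiset.coe_eq_coe, Multiset.coe_toList, ← Multiset.cons_coe, Multiset.coe_toList,
      map_add, Finsupp.toMultiset_single, one_smul, add_comm, Multiset.singleton_add]
  rw [wordD_perm h1 hf, wordD]
  have h2 : ((α j : ℂ) + 1) ≠ 0 := Nat.cast_add_one_ne_zero (α j)
  have h3 := finsuppFactorial_ne_zero α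
  field_simp

/-- Two power series that agree at `0` and whose partial derivatives agree up to degree `d` agree up
to degree `d + 1`. -/
theorem coeff_eq_of_pderiv {p q : MvPowerSeries (Fin n) ℂ} (d : ℕ)
    (h0 : constantCoeff p = constantCoeff q)
    (h1 : ∀ j, ∀ β : Fin n →₀ ℕ, β.degree ≤ d →
      coeff β (pderiv ℂ j p) = coeff β (pderiv ℂ j q)) (α : Fin n →₀ ℕ)
    (hα : α.degree ≤ d + 1) : coeff α p = coeff α q := by
  by_cases hz : α = 0
  · rw [hz, coeff_zero_eq_constantCoeff_apply, coeff_zero_eq_constantCoeff_apply, h0]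
  · obtain ⟨j, hj⟩ := Finsupp.ne_iff.1 hz
    have hsplit : α = (α - Finsupp.single j 1) + Finsupp.single j 1 := by
      rw [tsub_add_cancel_of_le]
      rw [Finsupp.single_le_iff]
      exact Nat.one_le_iff_ne_zero.2 hj
    set β := α - Finsupp.single j 1 with hβ
    have hdeg : β.degree ≤ d := by
      rw [hsplit, map_add, Finsupp.degree_single] at hα
      omega
    have h2 := h1 j β hdeg
    rw [coeff_pderiv, coeff_pderiv, ← hsplit] at h2
    have h3 : ((β j : ℂ) + 1) ≠ 0 := Nat.cast_add_one_ne_zero (β j)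
    exact mul_right_cancel₀ h3 h2

theorem taylor_add {f g : (Fin n → ℂ) → ℂ} (hf : AnalyticAt ℂ f (onePt n))
    (hg : AnalyticAt ℂ g (onePt n)) : taylor (fun x => f x + g x) = taylor f + taylor g := by
  have key : ∀ d : ℕ, ∀ f g : (Fin n → ℂ) → ℂ, AnalyticAt ℂ f (onePt n) →
      AnalyticAt ℂ g (onePt n) → ∀ α : Fin n →₀ ℕ, α.degree ≤ d →
      coeff α (taylor (fun x => f x + g x)) = coeff α (taylor f + taylor g) := by
    intro d
    induction d with
    | zero =>
      intro f g _ _ α hα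
      rw [(Finsupp.degree_eq_zero_iff α).1 (Nat.le_zero.1 hα)]
      simp only [coeff_zero_eq_constantCoeff_apply, map_add, constantCoeff_taylor]
    | succ d ih =>
      intro f g hf hg
      refine coeff_eq_of_pderiv d (by simp only [map_add, constantCoeff_taylor]) ?_
      intro j β hβ
      have hpd : pd j (fun x => f x + g x) =ᶠ[𝓝 (onePt n)] fun x => pd j f x + pd j g x := by
        filter_upwards [hf.eventually_analyticAt, hg.eventually_analyticAt] with x hx hy
        simp only [pd]
        rw [fderiv_fun_add hx.differentiableAt hy.differentiableAt, add_apply]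
      rw [map_add, pderiv_taylor j (hf.fun_add hg), pderiv_taylor j hf, pderiv_taylor j hg,
        taylor_congr hpd]
      exact ih _ _ (analyticAt_pd j hf) (analyticAt_pd j hg) β hβ
  ext α
  exact key _ f g hf hg α le_rfl

theorem taylor_mul {f g : (Fin n → ℂ) → ℂ} (hf : AnalyticAt ℂ f (onePt n))
    (hg : AnalyticAt ℂ g (onePt n)) : taylor (fun x => f x * g x) = taylor f * taylor g := by
  have key : ∀ d : ℕ, ∀ f g : (Fin n → ℂ) → ℂ, AnalyticAt ℂ f (onePt n) →
      AnalyticAt ℂ g (onePt n) → ∀ α : Fin n →₀ ℕ, α.degree ≤ d →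
      coeff α (taylor (fun x => f x * g x)) = coeff α (taylor f * taylor g) := by
    intro d
    induction d with
    | zero =>
      intro f g _ _ α hα
      rw [(Finsupp.degree_eq_zero_iff α).1 (Nat.le_zero.1 hα)]
      simp only [coeff_zero_eq_constantCoeff_apply, map_mul, constantCoeff_taylor]
    | succ d ih =>
      intro f g hf hg
      refine coeff_eq_of_pderiv d (by simp only [map_mul, constantCoeff_taylor]) ?_
      intro j β hβ
      have hpd : pd j (fun x => f x * g x) =ᶠ[𝓝 (onePt n)]
          fun x => f x * pd j g x + g x * pd j f x := by
        filter_upwards [hf.eventually_analyticAt, hg.eventually_analyticAt] with x hx hy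
        simp only [pd]
        rw [fderiv_fun_mul hx.differentiableAt hy.differentiableAt]
        simp
      rw [Derivation.leibniz, pderiv_taylor j (hf.fun_mul hg), pderiv_taylor j hf,
        pderiv_taylor j hg, taylor_congr hpd, taylor_add (hf.fun_mul (analyticAt_pd j hg))
        (hg.fun_mul (analyticAt_pd j hf)), map_add, ih _ _ hf (analyticAt_pd j hg) β hβ,
        ih _ _ hg (analyticAt_pd j hf) β hβ, map_add, smul_eq_mul, smul_eq_mul]
  ext α
  exact key _ f g hf hg α le_rfl

theorem wordD_zero (w : List (Fin n)) : wordD w (fun _ => (0 : ℂ)) = fun _ => 0 := by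
  induction w with
  | nil => rfl
  | cons j w ih =>
    rw [wordD, show pd j (fun _ : Fin n → ℂ => (0 : ℂ)) = fun _ => 0 by
      funext x
      simp [pd], ih]

theorem taylor_zero : taylor (fun _ : Fin n → ℂ => (0 : ℂ)) = 0 := by
  ext α
  rw [coeff_taylor, wordD_zero]
  simp

theorem taylor_const (c : ℂ) : taylor (fun _ : Fin n → ℂ => c) = C c := by
  ext α
  refine coeff_eq_of_pderiv α.degree ?_ ?_ α (Nat.le_succ _)
  · rw [constantCoeff_taylor, constantCoeff_C]
  · intro j β _
    rw [pderiv_taylor j analyticAt_const, pderiv_C, show pd j (fun _ : Fin n → ℂ => c) =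
      fun _ => 0 by
        funext x
        simp [pd], taylor_zero]

theorem analyticAt_coord (i : Fin n) (x : Fin n → ℂ) : AnalyticAt ℂ (fun x : Fin n → ℂ => x i) x :=
  (ContinuousLinearMap.proj (R := ℂ) (φ := fun _ : Fin n => ℂ) i).analyticAt x

theorem taylor_coord (i : Fin n) : taylor (fun x : Fin n → ℂ => x i) = 1 + X i := by
  ext α
  refine coeff_eq_of_pderiv α.degree ?_ ?_ α (Nat.le_succ _)
  · simp [constantCoeff_taylor]
  · intro j β _
    have hpd : pd j (fun x : Fin n → ℂ => x i) = fun _ => (Pi.single j (1 : ℂ) : Fin n → ℂ) i := by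
      funext x
      have := (ContinuousLinearMap.proj (R := ℂ) (φ := fun _ : Fin n => ℂ) i).fderiv (x := x)
      simp only [pd]
      erw [this]
      rfl
    rw [pderiv_taylor j (analyticAt_coord i _), hpd, taylor_const, map_add, pderiv_one, zero_add,
      pderiv_X, Pi.single_apply]
    split_ifs <;> simp_all

theorem taylor_const_mul (c : ℂ) {f : (Fin n → ℂ) → ℂ} (hf : AnalyticAt ℂ f (onePt n)) :
    taylor (fun x => c * f x) = c • taylor f := by
  rw [taylor_mul analyticAt_const hf, taylor_const, smul_eq_C_mul]

theorem taylor_sub {f g : (Fin n → ℂ) → ℂ} (hf : AnalyticAt ℂ f (onePt n))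
    (hg : AnalyticAt ℂ g (onePt n)) : taylor (fun x => f x - g x) = taylor f - taylor g := by
  have h1 : (fun x => f x - g x) = fun x => f x + (-1) * g x := by
    funext x
    ring
  rw [h1, taylor_add hf (analyticAt_const.fun_mul hg), taylor_const_mul _ hg]
  simp [sub_eq_add_neg]

theorem taylor_sum {κ : Type*} (s : Finset κ) {f : κ → (Fin n → ℂ) → ℂ}
    (hf : ∀ k ∈ s, AnalyticAt ℂ (f k) (onePt n)) :
    taylor (fun x => ∑ k ∈ s, f k x) = ∑ k ∈ s, taylor (f k) := by
  classical
  induction s using Finset.induction_on with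
  | empty => simpa using taylor_zero
  | insert a s ha ih =>
    simp only [Finset.sum_insert ha]
    rw [taylor_add (hf a (Finset.mem_insert_self _ _))
      (Finset.analyticAt_fun_sum s fun k hk => hf k (Finset.mem_insert_of_mem hk)),
      ih fun k hk => hf k (Finset.mem_insert_of_mem hk)]

theorem taylor_prod {κ : Type*} (s : Finset κ) {f : κ → (Fin n → ℂ) → ℂ}
    (hf : ∀ k ∈ s, AnalyticAt ℂ (f k) (onePt n)) :
    taylor (fun x => ∏ k ∈ s, f k x) = ∏ k ∈ s, taylor (f k) := by
  classical
  induction s using Finset.induction_on with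
  | empty => simpa using taylor_const 1
  | insert a s ha ih =>
    simp only [Finset.prod_insert ha]
    rw [taylor_mul (hf a (Finset.mem_insert_self _ _))
      (Finset.analyticAt_fun_prod s fun k hk => hf k (Finset.mem_insert_of_mem hk)),
      ih fun k hk => hf k (Finset.mem_insert_of_mem hk)]

theorem taylor_pow {f : (Fin n → ℂ) → ℂ} (hf : AnalyticAt ℂ f (onePt n)) (q : ℕ) :
    taylor (fun x => f x ^ q) = taylor f ^ q := by
  induction q with
  | zero => simpa using taylor_const 1
  | succ q ih =>
    simp only [pow_succ]
    rw [taylor_mul (hf.fun_pow q) hf, ih]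

/-- Cauchy's estimate for a partial derivative. -/
theorem norm_pd_le {p : Fin n → ℂ} {r r' M : ℝ} (hr : r' < r) {g : (Fin n → ℂ) → ℂ}
    (hg : AnalyticOnNhd ℂ g (Metric.ball p r)) (hM : ∀ x ∈ Metric.ball p r, ‖g x‖ ≤ M) (j : Fin n)
    {x : Fin n → ℂ} (hx : x ∈ Metric.ball p r') : ‖pd j g x‖ ≤ M / (r - r') := by
  have hline : ∀ z ∈ Metric.closedBall (x j) (r - r'), Function.update x j z ∈ Metric.ball p r := by
    intro z hz
    have h1 : dist (Function.update x j z) x ≤ r - r' := by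
      refine (dist_pi_le_iff (by linarith)).2 fun i => ?_
      by_cases hij : i = j
      · subst hij
        simpa using hz
      · simp [hij, hr.le]
    rw [Metric.mem_ball] at hx ⊢
    linarith [dist_triangle (Function.update x j z) x p]
  have hxr : x ∈ Metric.ball p r := Metric.ball_subset_ball hr.le hx
  rw [pd_eq_deriv j (hg x hxr).differentiableAt]
  refine Complex.norm_deriv_le_of_forall_mem_sphere_norm_le (by linarith) ?_ ?_
  · refine DifferentiableOn.diffContOnCl ?_
    rw [closure_ball _ (by linarith : r - r' ≠ 0)]
    intro z hz
    have h1 := (hg _ (hline z hz)).differentiableAt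
    exact (h1.comp z (hasDerivAt_update x j z).differentiableAt).differentiableWithinAt
  · intro z hz
    exact hM _ (hline z (Metric.sphere_subset_closedBall hz))

/-- Cauchy's estimate for iterated partial derivatives, on shrinking balls. -/
theorem exists_norm_wordD_le (w : List (Fin n)) (p : Fin n → ℂ) (r : ℝ) (hr : 0 < r) :
    ∃ K : ℝ, ∀ (g : (Fin n → ℂ) → ℂ) (M : ℝ), AnalyticOnNhd ℂ g (Metric.ball p r) →
      (∀ x ∈ Metric.ball p r, ‖g x‖ ≤ M) → ‖wordD w g p‖ ≤ K * M := by
  induction w generalizing r with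
  | nil =>
    refine ⟨1, fun g M _ hM => ?_⟩
    rw [one_mul]
    exact hM p (Metric.mem_ball_self hr)
  | cons j w ih =>
    obtain ⟨K, hK⟩ := ih (r / 2) (by linarith)
    refine ⟨K / (r - r / 2), fun g M hg hM => ?_⟩
    have := hK (pd j g) (M / (r - r / 2))
      (fun x hx => analyticAt_pd j (hg x (Metric.ball_subset_ball (by linarith) hx)))
      (fun x hx => norm_pd_le (by linarith) hg hM j hx)
    rw [wordD]
    calc _ ≤ _ := this
      _ = _ := by ring

theorem exists_norm_coeff_taylor_le (α : Fin n →₀ ℕ) (r : ℝ) (hr : 0 < r) :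
    ∃ K : ℝ, ∀ (g : (Fin n → ℂ) → ℂ) (M : ℝ), AnalyticOnNhd ℂ g (Metric.ball (onePt n) r) →
      (∀ x ∈ Metric.ball (onePt n) r, ‖g x‖ ≤ M) → ‖coeff α (taylor g)‖ ≤ K * M := by
  obtain ⟨K, hK⟩ := exists_norm_wordD_le α.toMultiset.toList (onePt n) r hr
  refine ⟨K / ‖finsuppFactorial α‖, fun g M hg hM => ?_⟩
  rw [coeff_taylor, norm_div]
  calc _ ≤ K * M / ‖finsuppFactorial α‖ := by
        gcongr
        exact hK g M hg hM
    _ = _ := by ring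

/-- Uniform convergence of analytic functions near `1^n` implies convergence of Taylor
coefficients. -/
theorem tendsto_coeff_taylor {ι : Type*} {l : Filter ι} {g : ι → (Fin n → ℂ) → ℂ}
    {f : (Fin n → ℂ) → ℂ} {U : Set (Fin n → ℂ)} (hU : U ∈ 𝓝 (onePt n))
    (hg : ∀ᶠ i in l, AnalyticOnNhd ℂ (g i) U) (hf : AnalyticAt ℂ f (onePt n))
    (h : TendstoUniformlyOn g f l U) (α : Fin n →₀ ℕ) :
    Tendsto (fun i => coeff α (taylor (g i))) l (𝓝 (coeff α (taylor f))) := by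
  obtain ⟨r, hr, hball⟩ := Metric.mem_nhds_iff.1 (inter_mem hU hf.eventually_analyticAt)
  obtain ⟨K, hK⟩ := exists_norm_coeff_taylor_le α r hr
  rw [Metric.tendsto_nhds]
  intro ε hε
  have hpos : 0 < ε / (|K| + 1) := by positivity
  have h1 := Metric.tendstoUniformlyOn_iff.1 h _ hpos
  filter_upwards [h1, hg] with i hi hgi
  have hga : AnalyticOnNhd ℂ (g i) (Metric.ball (onePt n) r) := fun x hx => hgi x (hball hx).1
  have hfa : AnalyticOnNhd ℂ f (Metric.ball (onePt n) r) := fun x hx => (hball hx).2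
  have h2 := hK (fun x => g i x - f x) (ε / (|K| + 1)) (fun x hx => (hga x hx).fun_sub (hfa x hx)) (by
    intro x hx
    have := hi x (hball hx).1
    rw [dist_comm, dist_eq_norm] at this
    exact this.le)
  rw [taylor_sub (hga _ (Metric.mem_ball_self hr)) hf, map_sub] at h2
  rw [dist_eq_norm]
  refine h2.trans_lt ?_
  calc K * (ε / (|K| + 1)) ≤ |K| * (ε / (|K| + 1)) := by
        gcongr
        exact le_abs_self K
    _ < (|K| + 1) * (ε / (|K| + 1)) := by
        gcongr
        linarith
    _ = ε := by field_simp

/-- The chain rule along a line, on the level of power series. -/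
theorem coeff_succ_lineEval (c : Fin n → ℂ) (p : MvPowerSeries (Fin n) ℂ) (d : ℕ) :
    (d + 1 : ℂ) * PowerSeries.coeff (d + 1) (lineEval c p) =
      ∑ j, c j * PowerSeries.coeff d (lineEval c (pderiv ℂ j p)) := by
  simp only [coeff_lineEval, coeff_pderiv]
  have h1 : (d + 1 : ℂ) * ∑ β ∈ Finset.finsuppAntidiag Finset.univ (d + 1),
      (∏ j, c j ^ β j) * coeff β p = ∑ j, ∑ β ∈ Finset.finsuppAntidiag Finset.univ (d + 1),
        (β j : ℂ) * ((∏ j, c j ^ β j) * coeff β p) := by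
    rw [Finset.sum_comm, Finset.mul_sum]
    refine Finset.sum_congr rfl fun β hβ => ?_
    rw [Finset.mem_finsuppAntidiag] at hβ
    rw [← Finset.sum_mul]
    congr 1
    rw [← Nat.cast_sum]
    have := hβ.1
    rw [this]
    push_cast
    ring
  rw [h1]
  refine Finset.sum_congr rfl fun j _ => ?_
  rw [Finset.mul_sum]
  symm
  refine Finset.sum_of_injOn (fun γ => γ + Finsupp.single j 1) ?_ ?_ ?_ ?_
  · intro γ _ γ' _ h
    exact add_right_cancel h
  · intro γ hγ
    rw [Finset.mem_coe, Finset.mem_finsuppAntidiag] at hγ ⊢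
    refine ⟨?_, Finset.subset_univ _⟩
    simp only [Finsupp.coe_add, Pi.add_apply, Finset.sum_add_distrib]
    rw [hγ.1]
    simp [Finsupp.single_apply]
  · intro β hβ hnot
    rw [Finset.mem_finsuppAntidiag] at hβ
    by_cases hj : β j = 0
    · simp [hj]
    · exfalso
      apply hnot
      have hsplit : β - Finsupp.single j 1 + Finsupp.single j 1 = β := by
        rw [tsub_add_cancel_of_le]
        rw [Finsupp.single_le_iff]
        exact Nat.one_le_iff_ne_zero.2 hj
      refine ⟨β - Finsupp.single j 1, ?_, hsplit⟩
      rw [Finset.mem_coe, Finset.mem_finsuppAntidiag]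
      refine ⟨?_, Finset.subset_univ _⟩
      have h2 := hβ.1
      rw [← hsplit] at h2
      simp only [Finsupp.coe_add, Pi.add_apply, Finset.sum_add_distrib] at h2
      rw [Finset.sum_eq_single j (f := fun i => (Finsupp.single j 1 : Fin n →₀ ℕ) i)] at h2
      · rw [Finsupp.single_eq_same] at h2
        exact Nat.succ_injective h2
      · intro i _ hi
        exact Finsupp.single_eq_of_ne hi
      · simp
  · intro γ _
    have h3 : ∏ i, c i ^ (γ + Finsupp.single j 1 : Fin n →₀ ℕ) i = c j * ∏ i, c i ^ γ i := by
      simp only [Finsupp.coe_add, Pi.add_apply, pow_add, Finset.prod_mul_distrib]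
      rw [Finset.prod_eq_single j (f := fun i => c i ^ (Finsupp.single j 1 : Fin n →₀ ℕ) i)]
      · rw [Finsupp.single_eq_same, pow_one, mul_comm]
      · intro i _ hi
        rw [Finsupp.single_eq_of_ne hi, pow_zero]
      · simp
    rw [h3, Finsupp.add_apply, Finsupp.single_eq_same]
    push_cast
    ring

/-- Derivatives along the line `1 + u c` are coefficients of the restricted Taylor series. -/
theorem iteratedDeriv_line (c : Fin n → ℂ) (d : ℕ) {f : (Fin n → ℂ) → ℂ}
    (hf : AnalyticAt ℂ f (onePt n)) :
    iteratedDeriv d (fun u : ℂ => f (fun j => 1 + u * c j)) 0 =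
      d.factorial * PowerSeries.coeff d (lineEval c (taylor f)) := by
  have hline : ∀ u : ℂ, HasDerivAt (fun u : ℂ => fun j => 1 + u * c j) c u := by
    intro u
    refine hasDerivAt_pi.2 fun j => ?_
    simpa using ((hasDerivAt_id u).mul_const (c j)).const_add 1
  have hpt : (fun j => 1 + (0 : ℂ) * c j) = onePt n := by
    funext j
    simp
  induction d generalizing f with
  | zero =>
    rw [iteratedDeriv_zero, constantCoeff_lineEval, constantCoeff_taylor]
    simp
  | succ d ih =>
    rw [iteratedDeriv_succ']
    have hcont : Tendsto (fun u : ℂ => fun j => 1 + u * c j) (𝓝 0) (𝓝 (onePt n)) := by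
      have := (hline 0).continuousAt.tendsto
      rwa [hpt] at this
    have hderiv : deriv (fun u : ℂ => f (fun j => 1 + u * c j)) =ᶠ[𝓝 0]
        fun u => (fun x => ∑ j, c j * pd j f x) (fun j => 1 + u * c j) := by
      filter_upwards [hcont.eventually hf.eventually_analyticAt] with u hu
      refine (hu.differentiableAt.hasFDerivAt.comp_hasDerivAt u (hline u)).deriv.trans ?_
      have hc : c = ∑ i, c i • (Pi.single i (1 : ℂ) : Fin n → ℂ) := pi_eq_sum_univ' c
      conv_lhs => arg 2; rw [hc]
      rw [map_sum]
      refine Finset.sum_congr rfl fun j _ => ?_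
      rw [map_smul, smul_eq_mul]
      rfl
    have hA : ∀ j ∈ Finset.univ, AnalyticAt ℂ (fun x => c j * pd j f x) (onePt n) :=
      fun j _ => analyticAt_const.fun_mul (analyticAt_pd j hf)
    rw [hderiv.iteratedDeriv_eq, ih (Finset.analyticAt_fun_sum _ hA), taylor_sum _ hA, map_sum,
      map_sum, Nat.factorial_succ]
    push_cast
    rw [mul_assoc, mul_left_comm, coeff_succ_lineEval]
    congr 1
    refine Finset.sum_congr rfl fun j _ => ?_
    have hj : taylor (fun x => c j * pd j f x) = C (c j) * pderiv ℂ j (taylor f) := by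
      rw [taylor_const_mul _ (analyticAt_pd j hf), pderiv_taylor j hf, smul_eq_C_mul]
    have hC : lineEval c (C (c j)) = PowerSeries.C (c j) := by
      rw [lineEval, RingHom.comp_apply]
      have : rescale c (C (c j) : MvPowerSeries (Fin n) ℂ) = C (c j) := by
        ext α
        rw [coeff_rescale, coeff_C]
        split_ifs with h
        · simp [h]
        · simp
      rw [this]
      exact rename_C _ _
    rw [hj, map_mul, hC, PowerSeries.coeff_C_mul]

end Taylor

/-! ### Positivity of Schur polynomials -/

section Positivity

/-- Generalized Vandermonde determinants are multiples of the Vandermonde determinant by a nonzero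
polynomial with nonnegative integer coefficients. The induction step is the branching rule of Schur
functions: column operations clear the row of the first variable, and expanding the remaining minor
multilinearly gives generalized Vandermonde determinants with interlacing exponents. -/
theorem exists_det_pow_eq {n : ℕ} (m : Fin n → ℕ) (hm : StrictMono m) :
    ∃ P : MvPolynomial (Fin n) ℕ, 0 < MvPolynomial.eval (fun _ => 1) P ∧
      ∀ (R : Type) [CommRing R] (x : Fin n → R),
        Matrix.det (Matrix.of fun i j => x i ^ m j) =
          Matrix.det (Matrix.vandermonde x) * MvPolynomial.aeval x P := by
  induction n with
  | zero => exact ⟨1, by simp, fun R _ x => by simp⟩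
  | succ n ih =>
    set d : Fin n → ℕ := fun j => m j.succ - m j.castSucc with hd
    have hlt : ∀ j : Fin n, m j.castSucc < m j.succ := fun j => hm Fin.castSucc_lt_succ
    set T : Finset (Fin n → ℕ) := Fintype.piFinset fun j => Finset.range (d j) with hT
    have hmono : ∀ r ∈ T, StrictMono fun j => m j.castSucc + r j := by
      intro r hr i j hij
      have h1 := Finset.mem_range.1 (Fintype.mem_piFinset.1 hr i)
      have h2 : m i.succ ≤ m j.castSucc := hm.monotone (by
        rw [Fin.le_def]
        simpa using hij)
      have := hlt i
      simp only [hd] at h1 ⊢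
      omega
    have hex : ∀ r : Fin n → ℕ, ∃ P : MvPolynomial (Fin n) ℕ, r ∈ T →
        0 < MvPolynomial.eval (fun _ => 1) P ∧
        ∀ (R : Type) [CommRing R] (x : Fin n → R),
          Matrix.det (Matrix.of fun i j => x i ^ (m j.castSucc + r j)) =
            Matrix.det (Matrix.vandermonde x) * MvPolynomial.aeval x P := by
      intro r
      by_cases hr : r ∈ T
      · obtain ⟨P, hP⟩ := ih _ (hmono r hr)
        exact ⟨P, fun _ => hP⟩
      · exact ⟨0, fun h => absurd h hr⟩
    choose P hP using hex
    refine ⟨MvPolynomial.X 0 ^ m 0 * ∑ r ∈ T, (∏ j, MvPolynomial.X 0 ^ (d j - 1 - r j)) *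
      MvPolynomial.rename Fin.succ (P r), ?_, ?_⟩
    · rw [map_mul, map_sum, map_pow, MvPolynomial.eval_X, one_pow, one_mul]
      refine Finset.sum_pos (fun r hr => ?_) ⟨fun _ => 0, ?_⟩
      · rw [map_mul, MvPolynomial.eval_rename, map_prod]
        simp only [map_pow, MvPolynomial.eval_X, one_pow, Finset.prod_const_one, one_mul]
        exact (hP r hr).1
      · refine Fintype.mem_piFinset.2 fun j => Finset.mem_range.2 ?_
        have := hlt j
        simp only [hd]
        omega
    · intro R _ x
      -- subtract `x_0^{d_j}` times the preceding column from each column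
      set B : Matrix (Fin (n + 1)) (Fin (n + 1)) R := Matrix.of fun i =>
        Fin.cons (x i ^ m 0) fun j => x i ^ m j.succ - x 0 ^ d j * x i ^ m j.castSucc with hB
      have hAB : Matrix.det (Matrix.of fun i j => x i ^ m j) = B.det := by
        refine Matrix.det_eq_of_forall_col_eq_smul_add_pred (fun j => x 0 ^ d j) ?_ ?_
        · intro i
          simp [hB]
        · intro i j
          simp [hB]
      have hB0 : ∀ j : Fin n, B 0 j.succ = 0 := by
        intro j
        simp only [hB, Matrix.of_apply, Fin.cons_succ, hd]
        rw [← pow_add, Nat.sub_add_cancel (hlt j).le, sub_self]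
      have hBdet : B.det = x 0 ^ m 0 * (B.submatrix Fin.succ Fin.succ).det := by
        rw [Matrix.det_succ_row_zero, Fin.sum_univ_succ,
          Finset.sum_eq_zero fun j _ => by rw [hB0, mul_zero, zero_mul], add_zero]
        simp [hB]
      have hBsub : (B.submatrix Fin.succ Fin.succ).det =
          (∏ i : Fin n, (x i.succ - x 0)) * Matrix.det (Matrix.of fun i j : Fin n =>
            ∑ t ∈ Finset.range (d j), x 0 ^ (d j - 1 - t) * x i.succ ^ (m j.castSucc + t)) := by
        rw [← Matrix.det_mul_column]
        congr 1
        ext i j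
        simp only [hB, Matrix.submatrix_apply, Matrix.of_apply, Fin.cons_succ]
        have h1 : m j.succ = m j.castSucc + d j := by
          have := hlt j
          simp only [hd]
          omega
        rw [h1, pow_add, mul_comm (x 0 ^ d j), ← mul_sub, ← geom_sum₂_mul, Finset.sum_mul,
          Finset.mul_sum, Finset.mul_sum]
        refine Finset.sum_congr rfl fun t _ => ?_
        rw [pow_add]
        ring
      -- multilinearity in the columns
      have hexp : Matrix.det (Matrix.of fun i j : Fin n =>
            ∑ t ∈ Finset.range (d j), x 0 ^ (d j - 1 - t) * x i.succ ^ (m j.castSucc + t)) =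
          ∑ r ∈ T, (∏ j, x 0 ^ (d j - 1 - r j)) *
            Matrix.det (Matrix.of fun i j : Fin n => x i.succ ^ (m j.castSucc + r j)) := by
        rw [← Matrix.det_transpose]
        have h2 : (Matrix.of fun i j : Fin n => ∑ t ∈ Finset.range (d j),
            x 0 ^ (d j - 1 - t) * x i.succ ^ (m j.castSucc + t)).transpose =
            fun j => ∑ t ∈ Finset.range (d j),
              (fun i => x 0 ^ (d j - 1 - t) * x i.succ ^ (m j.castSucc + t)) := by
          ext j i
          simp
        have h3 := (Matrix.detRowAlternating (n := Fin n) (R := R)).toMultilinearMap.map_sum_finset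
          (fun j t => fun i => x 0 ^ (d j - 1 - t) * x i.succ ^ (m j.castSucc + t))
          (fun j => Finset.range (d j))
        rw [h2]
        refine h3.trans (Finset.sum_congr rfl fun r _ => ?_)
        rw [← Matrix.det_mul_row, ← Matrix.det_transpose]
        rfl
      rw [hAB, hBdet, hBsub, hexp, Matrix.det_vandermonde, Fin.prod_univ_succ, Fin.prod_Ioi_zero]
      simp only [Fin.prod_Ioi_succ]
      rw [← Matrix.det_vandermonde (fun i : Fin n => x i.succ), map_mul, map_sum, map_pow,
        MvPolynomial.aeval_X]
      have h4 : ∀ r ∈ T, (∏ j, x 0 ^ (d j - 1 - r j)) *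
            Matrix.det (Matrix.of fun i j : Fin n => x i.succ ^ (m j.castSucc + r j)) =
          Matrix.det (Matrix.vandermonde fun i : Fin n => x i.succ) *
          MvPolynomial.aeval x ((∏ j, MvPolynomial.X 0 ^ (d j - 1 - r j)) *
            MvPolynomial.rename Fin.succ (P r)) := by
        intro r hr
        rw [(hP r hr).2 R fun i => x i.succ, map_mul, MvPolynomial.aeval_rename, map_prod]
        simp only [map_pow, MvPolynomial.aeval_X]
        rw [mul_left_comm]
        rfl
      rw [Finset.sum_congr rfl h4, ← Finset.mul_sum]
      ring

variable {N : ℕ}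

theorem vandermondePoly_ne_zero : vandermondePoly N ≠ 0 := by
  refine Finset.prod_ne_zero_iff.2 fun i _ => Finset.prod_ne_zero_iff.2 fun j hj => ?_
  exact sub_ne_zero.2 fun h => (Finset.mem_Ioi.1 hj).ne (MvPolynomial.X_injective h)

theorem prod_sub_eq_det_vandermonde {R : Type*} [CommRing R] (x : Fin N → R) :
    ∏ i : Fin N, ∏ j ∈ Finset.Ioi i, (x i - x j) =
      Matrix.det (Matrix.vandermonde fun i => x (Fin.rev i)) := by
  rw [Matrix.det_vandermonde, Finset.prod_sigma', Finset.prod_sigma']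
  refine Finset.prod_bij' (fun p _ => ⟨Fin.rev p.2, Fin.rev p.1⟩)
    (fun p _ => ⟨Fin.rev p.2, Fin.rev p.1⟩) ?_ ?_ ?_ ?_ ?_ <;> simp

/-- The exponents of the alternant decrease, so that rows and columns are reversed in order to apply
`exists_det_pow_eq`. -/
theorem exists_schurPoly_eq (l : Signature N) :
    ∃ P : MvPolynomial (Fin N) ℕ, 0 < MvPolynomial.eval (fun _ => 1) P ∧
      schurPoly l = MvPolynomial.map (Nat.castRingHom ℂ) P := by
  have hm : StrictMono fun j : Fin N => shiftedExponent l (Fin.rev j) := by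
    intro i j hij
    have h1 : l.1 (Fin.rev i) ≤ l.1 (Fin.rev j) := l.2 (Fin.rev_le_rev.2 hij.le)
    have h2 : (Fin.rev j : ℕ) < (Fin.rev i : ℕ) := Fin.lt_def.1 (Fin.rev_lt_rev.2 hij)
    have h3 := (Fin.rev i).isLt
    simp only [shiftedExponent]
    have : (l.1 (Fin.rev i) - lowest l).toNat ≤ (l.1 (Fin.rev j) - lowest l).toNat :=
      Int.toNat_le_toNat (by linarith)
    omega
  obtain ⟨P, hP, hdet⟩ := exists_det_pow_eq _ hm
  refine ⟨MvPolynomial.rename Fin.rev P, ?_, ?_⟩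
  · rw [MvPolynomial.eval_rename]
    exact hP
  · apply mul_left_cancel₀ vandermondePoly_ne_zero
    rw [← alternant_eq, vandermondePoly, prod_sub_eq_det_vandermonde]
    have h1 := hdet (MvPolynomial (Fin N) ℂ) fun i => MvPolynomial.X (Fin.rev i)
    have h2 : alternant (shiftedExponent l) = Matrix.det (Matrix.of fun i j : Fin N =>
        (MvPolynomial.X (Fin.rev i) : MvPolynomial (Fin N) ℂ) ^
          shiftedExponent l (Fin.rev j)) := by
      rw [alternant, ← Matrix.det_submatrix_equiv_self Fin.revPerm]
      rfl
    rw [h2, h1]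
    congr 1
    rw [MvPolynomial.map_rename]
    rw [MvPolynomial.rename_eq_aeval, MvPolynomial.aeval_def, MvPolynomial.aeval_def,
      MvPolynomial.eval₂_map]
    rfl

end Positivity

/-! ### Normalized Schur functions near `1^N` -/

section NormalizedSchur

variable {N : ℕ}

theorem exists_schur_eq_sum (l : Signature N) :
    ∃ P : MvPolynomial (Fin N) ℕ, 0 < MvPolynomial.eval (fun _ => 1) P ∧
      ∀ x : Fin N → ℂ, (∀ i, x i ≠ 0) → schur l x =
        ∑ d ∈ P.support, ((MvPolynomial.coeff d P : ℕ) : ℂ) * ∏ i, x i ^ ((d i : ℤ) + lowest l) := by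
  obtain ⟨P, hP, hS⟩ := exists_schurPoly_eq l
  refine ⟨P, hP, fun x hx => ?_⟩
  rw [schur, hS, MvPolynomial.eval_map, MvPolynomial.eval₂_eq', Finset.mul_sum]
  refine Finset.sum_congr rfl fun d _ => ?_
  rw [Nat.coe_castRingHom, mul_left_comm, ← Finset.prod_zpow, ← Finset.prod_mul_distrib]
  congr 1
  refine Finset.prod_congr rfl fun i _ => ?_
  rw [zpow_add₀ (hx i), zpow_natCast, mul_comm]

theorem schur_one_ne_zero (l : Signature N) : schur l (fun _ => 1) ≠ 0 := by
  obtain ⟨P, hP, hS⟩ := exists_schurPoly_eq l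
  rw [schur, hS, MvPolynomial.eval_map, MvPolynomial.eval₂_eq']
  rw [MvPolynomial.eval_eq'] at hP
  simp only [Finset.prod_const_one, one_zpow, one_mul, one_pow, mul_one,
    Nat.coe_castRingHom] at hP ⊢
  rw [← Nat.cast_sum]
  exact_mod_cast hP.ne'

/-- The normalized Schur function `s_λ(x) / s_λ(1^N)`. -/
noncomputable def normSchur (l : Signature N) (x : Fin N → ℂ) : ℂ :=
  schur l x / schur l (fun _ => 1)

theorem normSchur_one (l : Signature N) : normSchur l (onePt N) = 1 :=
  div_self (schur_one_ne_zero l)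

/-- The vertices of the real cube of radius `δ` around `1^N`. -/
noncomputable def corner (δ : ℝ) (ε : Fin N → Bool) : Fin N → ℂ :=
  fun i => ((if ε i then 1 + δ else 1 - δ : ℝ) : ℂ)

theorem zpow_le_add_of_mem {lo hi t : ℝ} (hlo : 0 < lo) (h1 : lo ≤ t) (h2 : t ≤ hi) (a : ℤ) :
    t ^ a ≤ hi ^ a + lo ^ a := by
  have ht : 0 < t := hlo.trans_le h1
  have hhi : 0 < hi := ht.trans_le h2
  rcases le_or_gt 0 a with ha | ha
  · have := zpow_le_zpow_left₀ ha ht.le h2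
    have := zpow_pos hlo a
    linarith
  · have : t ^ a ≤ lo ^ a := by
      rw [← neg_neg a, zpow_neg, zpow_neg lo]
      exact inv_anti₀ (zpow_pos hlo _) (zpow_le_zpow_left₀ (by omega) hlo.le h1)
    have := zpow_pos hhi a
    linarith

theorem norm_sub_one_bounds {δ : ℝ} {z : ℂ} (hz : ‖z - 1‖ ≤ δ) :
    1 - δ ≤ ‖z‖ ∧ ‖z‖ ≤ 1 + δ := by
  have h1 := norm_sub_norm_le (1 : ℂ) z
  have h2 := norm_sub_norm_le z (1 : ℂ)
  rw [norm_sub_rev, norm_one] at h1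
  rw [norm_one] at h2
  constructor <;> linarith

/-- Since Schur functions have nonnegative coefficients, their values near `1^N` are dominated by
their values at the vertices of a cube. -/
theorem norm_normSchur_le (l : Signature N) {δ : ℝ} (h0 : 0 < δ) (h1 : δ < 1) {x : Fin N → ℂ}
    (hx : ∀ i, ‖x i - 1‖ ≤ δ) : ‖normSchur l x‖ ≤ ∑ ε, ‖normSchur l (corner δ ε)‖ := by
  simp only [normSchur, norm_div]
  rw [← Finset.sum_div]
  gcongr
  obtain ⟨P, -, hP⟩ := exists_schur_eq_sum l
  have hxb : ∀ i, 1 - δ ≤ ‖x i‖ ∧ ‖x i‖ ≤ 1 + δ := fun i => norm_sub_one_bounds (hx i)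
  have hlo : 0 < 1 - δ := by linarith
  have hx0 : ∀ i, x i ≠ 0 := fun i => norm_pos_iff.1 (hlo.trans_le (hxb i).1)
  set c : (Fin N → Bool) → Fin N → ℝ := fun ε i => if ε i then 1 + δ else 1 - δ with hc
  have hcpos : ∀ ε i, 0 < c ε i := by
    intro ε i
    simp only [hc]
    split_ifs <;> linarith
  have hcorner : ∀ ε, ‖schur l (corner δ ε)‖ =
      ∑ d ∈ P.support, ((MvPolynomial.coeff d P : ℕ) : ℝ) * ∏ i, c ε i ^ ((d i : ℤ) + lowest l) := by
    intro ε
    rw [hP _ fun i => by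
      show ((c ε i : ℝ) : ℂ) ≠ 0
      exact_mod_cast (hcpos ε i).ne']
    rw [show ∑ d ∈ P.support, ((MvPolynomial.coeff d P : ℕ) : ℂ) * ∏ i, corner δ ε i ^ ((d i : ℤ) + lowest l) =
      ((∑ d ∈ P.support, ((MvPolynomial.coeff d P : ℕ) : ℝ) * ∏ i, c ε i ^ ((d i : ℤ) + lowest l) : ℝ) : ℂ) by
        push_cast
        rfl]
    rw [Complex.norm_real, Real.norm_of_nonneg]
    exact Finset.sum_nonneg fun d _ => mul_nonneg (Nat.cast_nonneg _)
      (Finset.prod_nonneg fun i _ => (zpow_pos (hcpos ε i) _).le)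
  simp only [hcorner]
  rw [Finset.sum_comm, hP x hx0]
  refine (norm_sum_le _ _).trans (Finset.sum_le_sum fun d _ => ?_)
  rw [norm_mul, ← Finset.mul_sum, Complex.norm_natCast, norm_prod]
  refine mul_le_mul_of_nonneg_left ?_ (Nat.cast_nonneg _)
  calc ∏ i, ‖x i ^ ((d i : ℤ) + lowest l)‖
      ≤ ∏ i, ∑ b : Bool, (if b then 1 + δ else 1 - δ) ^ ((d i : ℤ) + lowest l) := by
        refine Finset.prod_le_prod (fun i _ => norm_nonneg _) fun i _ => ?_
        rw [norm_zpow]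
        simpa using zpow_le_add_of_mem hlo (hxb i).1 (hxb i).2 _
    _ = ∑ ε : Fin N → Bool, ∏ i, c ε i ^ ((d i : ℤ) + lowest l) := by
        rw [Finset.prod_univ_sum, Fintype.piFinset_univ]

theorem rename_alternant (π : Equiv.Perm (Fin N)) (m : Fin N → ℕ) :
    MvPolynomial.rename π (alternant m) = (Equiv.Perm.sign π : MvPolynomial (Fin N) ℂ) *
      alternant m := by
  rw [alternant, ← Matrix.det_permute, ← AlgHom.coe_toRingHom, RingHom.map_det]
  congr 1
  ext1 i j
  simp

theorem vandermondePoly_eq_alternant :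
    vandermondePoly N = alternant fun j : Fin N => (Fin.rev j : ℕ) := by
  rw [vandermondePoly, prod_sub_eq_det_vandermonde, alternant,
    ← Matrix.det_submatrix_equiv_self Fin.revPerm]
  congr 1
  ext1 i j
  simp [Matrix.vandermonde_apply]

theorem schur_comp_perm (l : Signature N) (π : Equiv.Perm (Fin N)) (x : Fin N → ℂ) :
    schur l (x ∘ π) = schur l x := by
  have h1 : MvPolynomial.rename π (schurPoly l) = schurPoly l := by
    have h2 := congrArg (MvPolynomial.rename π) (alternant_eq l)
    rw [map_mul, rename_alternant, alternant_eq, vandermondePoly_eq_alternant, rename_alternant,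
      ← vandermondePoly_eq_alternant, mul_assoc] at h2
    have h3 : ((Equiv.Perm.sign π : ℤ) : MvPolynomial (Fin N) ℂ) ≠ 0 := by
      rcases Int.units_eq_one_or (Equiv.Perm.sign π) with h | h <;> simp [h]
    exact (mul_left_cancel₀ vandermondePoly_ne_zero (mul_left_cancel₀ h3 h2)).symm
  rw [schur, schur, ← MvPolynomial.eval_rename, h1]
  congr 2
  exact Equiv.prod_comp π x

theorem analyticAt_schur (l : Signature N) {x : Fin N → ℂ} (hx : ∀ i, x i ≠ 0) :
    AnalyticAt ℂ (schur l) x := by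
  have h1 : AnalyticAt ℂ (fun x : Fin N → ℂ => ∏ i, x i) x :=
    Finset.analyticAt_fun_prod _ fun i _ => analyticAt_coord i x
  have h2 : AnalyticAt ℂ (fun x : Fin N → ℂ => MvPolynomial.eval x (schurPoly l)) x :=
    AnalyticOnNhd.eval_mvPolynomial _ x (Set.mem_univ x)
  exact (h1.zpow (Finset.prod_ne_zero_iff.2 fun i _ => hx i)).mul h2

theorem analyticAt_normSchur (l : Signature N) {x : Fin N → ℂ} (hx : ∀ i, x i ≠ 0) :
    AnalyticAt ℂ (normSchur l) x :=
  (analyticAt_schur l hx).div analyticAt_const (schur_one_ne_zero l)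

end NormalizedSchur

/-! ### Schur functions as eigenvectors of the moment operators -/

section Euler

open MvPowerSeries

variable {N : ℕ}

/-- The particle positions `λ_j + N - j` (one-based `j`). -/
def position (l : Signature N) (j : Fin N) : ℤ := l.1 j + (N : ℤ) - 1 - (j : ℤ)

/-- The Laurent monomial with exponents `a`. -/
noncomputable def laurentMonomial (a : Fin N → ℤ) (x : Fin N → ℂ) : ℂ := ∏ i, x i ^ a i

theorem eventually_ne_zero : ∀ᶠ x : Fin N → ℂ in 𝓝 (onePt N), ∀ i, x i ≠ 0 := by
  refine eventually_all.2 fun i => ?_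
  exact (continuous_apply i).continuousAt.eventually_ne one_ne_zero

theorem analyticAt_laurentMonomial (a : Fin N → ℤ) {x : Fin N → ℂ} (hx : ∀ i, x i ≠ 0) :
    AnalyticAt ℂ (laurentMonomial a) x :=
  Finset.analyticAt_fun_prod _ fun i _ => (analyticAt_coord i x).zpow (hx i)

theorem coord_mul_pd_laurentMonomial (a : Fin N → ℤ) (i : Fin N) {x : Fin N → ℂ}
    (hx : ∀ i, x i ≠ 0) :
    x i * pd i (laurentMonomial a) x = a i * laurentMonomial a x := by
  rw [pd_eq_deriv i (analyticAt_laurentMonomial a hx).differentiableAt]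
  have h1 : (fun z : ℂ => laurentMonomial a (Function.update x i z)) =
      fun z => z ^ a i * ∏ j ∈ Finset.univ.erase i, x j ^ a j := by
    funext z
    rw [laurentMonomial, ← Finset.mul_prod_erase _ _ (Finset.mem_univ i), Function.update_self]
    congr 1
    refine Finset.prod_congr rfl fun j hj => ?_
    rw [Function.update_of_ne (Finset.ne_of_mem_erase hj)]
  rw [h1, deriv_mul_const (differentiableAt_zpow.2 (Or.inl (hx i))), deriv_zpow, laurentMonomial,
    ← Finset.mul_prod_erase _ _ (Finset.mem_univ i)]
  have h2 : x i ^ a i = x i * x i ^ (a i - 1) := by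
    rw [← zpow_one_add₀ (hx i)]
    congr 1
    ring
  rw [h2]
  ring

theorem euler_taylor_laurentMonomial (a : Fin N → ℤ) (i : Fin N) :
    (1 + X i) * pderiv ℂ i (taylor (laurentMonomial a)) =
      (a i : ℂ) • taylor (laurentMonomial a) := by
  have h1 : ∀ i, onePt N i ≠ 0 := fun _ => one_ne_zero
  have hA := analyticAt_laurentMonomial a h1
  rw [pderiv_taylor i hA, ← taylor_coord, ← taylor_mul (analyticAt_coord i _) (analyticAt_pd i hA),
    ← taylor_const_mul _ hA]
  refine taylor_congr ?_
  filter_upwards [eventually_ne_zero] with x hx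
  exact coord_mul_pd_laurentMonomial a i hx

/-- An eigenvector of the Euler operator `(1 + X_i) ∂_i` is an eigenvector of
`(1 + X_i)^k ∂_i^k`, with the falling factorial of the eigenvalue. -/
theorem pow_mul_iterate_pderiv_of_euler {f : MvPowerSeries (Fin N) ℂ} {i : Fin N} {a : ℂ}
    (h : (1 + X i) * pderiv ℂ i f = a • f) (k : ℕ) :
    (1 + X i) ^ k * (pderiv ℂ i)^[k] f = (∏ t ∈ Finset.range k, (a - t)) • f := by
  induction k with
  | zero => simp
  | succ k ih =>
    have h1 : (1 + X i) * pderiv ℂ i ((1 + X i) ^ k * (pderiv ℂ i)^[k] f) =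
        (k : ℂ) • ((1 + X i) ^ k * (pderiv ℂ i)^[k] f) +
          (1 + X i) ^ (k + 1) * (pderiv ℂ i)^[k + 1] f := by
      rw [Derivation.leibniz, Derivation.leibniz_pow, Function.iterate_succ_apply', map_add,
        pderiv_one, pderiv_X, Pi.single_eq_same, zero_add, smul_eq_mul, smul_eq_mul, smul_eq_mul,
        Nat.cast_smul_eq_nsmul]
      cases k with
      | zero => simp
      | succ k =>
        simp only [nsmul_eq_mul, Nat.add_sub_cancel]
        ring
    rw [ih, Derivation.map_smul, mul_smul_comm, h, smul_smul, smul_smul] at h1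
    rw [Finset.prod_range_succ, mul_sub, sub_smul, h1, mul_comm _ (k : ℂ)]
    abel

/-- The Vandermonde product as a power series. -/
noncomputable def vandermondeSeries (N : ℕ) : MvPowerSeries (Fin N) ℂ :=
  ∏ i : Fin N, ∏ j ∈ Finset.Ioi i, (X i - X j)

theorem taylor_vandermonde :
    taylor (fun x : Fin N → ℂ => ∏ i : Fin N, ∏ j ∈ Finset.Ioi i, (x i - x j)) =
      vandermondeSeries N := by
  have h1 : ∀ i j : Fin N, AnalyticAt ℂ (fun x : Fin N → ℂ => x i - x j) (onePt N) :=
    fun i j => (analyticAt_coord i _).fun_sub (analyticAt_coord j _)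
  rw [taylor_prod _ fun i _ => Finset.analyticAt_fun_prod _ fun j _ => h1 i j, vandermondeSeries]
  refine Finset.prod_congr rfl fun i _ => ?_
  rw [taylor_prod _ fun j _ => h1 i j]
  refine Finset.prod_congr rfl fun j _ => ?_
  rw [taylor_sub (analyticAt_coord i _) (analyticAt_coord j _), taylor_coord, taylor_coord]
  ring

theorem pderiv_prod_eq_zero {κ : Type*} (s : Finset κ) (i : Fin N)
    {f : κ → MvPowerSeries (Fin N) ℂ} (hf : ∀ k ∈ s, pderiv ℂ i (f k) = 0) :
    pderiv ℂ i (∏ k ∈ s, f k) = 0 := by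
  classical
  induction s using Finset.induction_on with
  | empty => simp
  | insert a s ha ih =>
    rw [Finset.prod_insert ha, Derivation.leibniz, hf a (Finset.mem_insert_self _ _),
      ih fun k hk => hf k (Finset.mem_insert_of_mem hk), smul_zero, smul_zero, add_zero]

theorem isVandermonde_vandermondeSeries : IsVandermonde (vandermondeSeries N) := by
  refine ⟨?_, fun i => ?_⟩
  · refine Finset.prod_ne_zero_iff.2 fun i _ => Finset.prod_ne_zero_iff.2 fun j hj => ?_
    exact X_sub_X_ne_zero (Finset.mem_Ioi.1 hj).ne
  · refine ⟨∏ a ∈ Finset.univ.erase i, (if a < i then -1 else 1) *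
      ∏ b ∈ (Finset.Ioi a).erase i, (X a - X b), ?_, ?_⟩
    · refine pderiv_prod_eq_zero _ _ fun a ha => ?_
      have ha' := Finset.ne_of_mem_erase ha
      rw [Derivation.leibniz, pderiv_prod_eq_zero _ _ fun b hb => by
        rw [map_sub, pderiv_X, pderiv_X, Pi.single_eq_of_ne ha',
          Pi.single_eq_of_ne (Finset.ne_of_mem_erase hb), sub_zero]]
      split_ifs <;> simp
    · rw [vandermondeSeries, ← Finset.mul_prod_erase _ _ (Finset.mem_univ i),
        ← Finset.prod_mul_distrib]
      have h1 : ∏ b ∈ Finset.Ioi i, (X i - X b : MvPowerSeries (Fin N) ℂ) =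
          ∏ b ∈ Finset.univ.erase i, if i < b then X i - X b else 1 := by
        rw [← Finset.prod_filter]
        refine Finset.prod_congr ?_ fun _ _ => rfl
        ext b
        simp only [Finset.mem_Ioi, Finset.mem_filter, Finset.mem_erase, Finset.mem_univ, and_true]
        exact ⟨fun h => ⟨h.ne', h⟩, fun h => h.2⟩
      rw [h1, ← Finset.prod_mul_distrib]
      refine Finset.prod_congr rfl fun a ha => ?_
      rcases lt_or_gt_of_ne (Finset.ne_of_mem_erase ha) with h | h
      · rw [if_neg h.not_gt, if_pos h, ← Finset.mul_prod_erase _ _ (Finset.mem_Ioi.2 h)]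
        ring
      · rw [if_pos h, if_neg h.not_gt, Finset.erase_eq_of_notMem (by simp [h.le])]
        ring

theorem vandermondeSeries_mul_taylor_schur (l : Signature N) :
    vandermondeSeries N * taylor (schur l) = ∑ σ : Equiv.Perm (Fin N),
      ((Equiv.Perm.sign σ : ℤ) : ℂ) • taylor (laurentMonomial fun i => position l (σ i)) := by
  have h1 : ∀ i, onePt N i ≠ 0 := fun _ => one_ne_zero
  have hV : AnalyticAt ℂ (fun x : Fin N → ℂ => ∏ i : Fin N, ∏ j ∈ Finset.Ioi i, (x i - x j))
      (onePt N) := Finset.analyticAt_fun_prod _ fun i _ => Finset.analyticAt_fun_prod _ fun j _ =>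
        (analyticAt_coord i _).fun_sub (analyticAt_coord j _)
  have hM : ∀ σ : Equiv.Perm (Fin N), AnalyticAt ℂ
      (laurentMonomial fun i => position l (σ i)) (onePt N) :=
    fun σ => analyticAt_laurentMonomial _ h1
  rw [← taylor_vandermonde, ← taylor_mul hV (analyticAt_schur l h1)]
  simp only [← taylor_const_mul _ (hM _)]
  rw [← taylor_sum _ fun σ _ => analyticAt_const.fun_mul (hM σ)]
  refine taylor_congr ?_
  filter_upwards [eventually_ne_zero] with x hx
  rw [vandermonde_mul_schur l x hx, ← Matrix.det_transpose, Matrix.det_apply]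
  refine Finset.sum_congr rfl fun σ _ => ?_
  rw [Units.smul_def, zsmul_eq_mul]
  rfl

/-- Schur functions are eigenvectors of the moment operators: the product with the Vandermonde
product is a sum of Laurent monomials whose exponents are permutations of the positions. -/
theorem momentOp_taylor_normSchur (l : Signature N)
    (hsymm : ∀ π, permAct π (taylor (normSchur l)) = taylor (normSchur l)) (k : ℕ) :
    momentOp k (taylor (normSchur l)) =
      (∑ i, ∏ t ∈ Finset.range k, ((position l i : ℂ) - t)) • taylor (normSchur l) := by
  have h1 : ∀ i, onePt N i ≠ 0 := fun _ => one_ne_zero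
  have hN : taylor (normSchur l) = (schur l (fun _ => 1))⁻¹ • taylor (schur l) := by
    rw [← taylor_const_mul _ (analyticAt_schur l h1)]
    congr 1
    funext x
    rw [normSchur, div_eq_inv_mul]
  apply mul_left_cancel₀ isVandermonde_vandermondeSeries.1
  rw [mul_momentOp isVandermonde_vandermondeSeries k hsymm]
  have hV : vandermondeSeries N * taylor (normSchur l) =
      (schur l (fun _ => 1))⁻¹ • ∑ σ : Equiv.Perm (Fin N), ((Equiv.Perm.sign σ : ℤ) : ℂ) •
        taylor (laurentMonomial fun i => position l (σ i)) := by
    rw [hN, mul_smul_comm, vandermondeSeries_mul_taylor_schur]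
  have hlin : ∀ (i : Fin N) (c : ℂ) (f : MvPowerSeries (Fin N) ℂ),
      (pderiv ℂ i)^[k] (c • f) = c • (pderiv ℂ i)^[k] f := by
    intro i c f
    exact Function.Commute.iterate_left (f := pderiv ℂ i) (g := fun f => c • f)
      (fun f => Derivation.map_smul _ _ _) k f
  have hlinS : ∀ (i : Fin N) (f : Equiv.Perm (Fin N) → MvPowerSeries (Fin N) ℂ),
      (pderiv ℂ i)^[k] (∑ σ, f σ) = ∑ σ, (pderiv ℂ i)^[k] (f σ) := by
    intro i f
    clear hlin
    induction k with
    | zero => rfl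
    | succ k ihk => simp only [Function.iterate_succ_apply', ihk, map_sum]
  rw [mul_smul_comm, hV, smul_comm, Finset.smul_sum]
  simp only [hlin, hlinS, mul_smul_comm, Finset.mul_sum]
  rw [Finset.sum_comm]
  simp only [← Finset.smul_sum]
  congr 1
  rw [Finset.smul_sum]
  refine Finset.sum_congr rfl fun σ _ => ?_
  simp only [pow_mul_iterate_pderiv_of_euler (euler_taylor_laurentMonomial _ _)]
  rw [← Finset.sum_smul, smul_comm]
  refine congrArg (· • _) ?_
  exact Equiv.sum_comp σ fun i => ∏ t ∈ Finset.range k, ((position l i : ℂ) - t)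

end Euler

/-! ### Setting variables equal to one -/

section Restriction

open MvPowerSeries

variable {k N : ℕ}

/-- The point of `ℂ^N` with coordinates `u` at the positions `e` and `1` elsewhere. -/
noncomputable def extendOne (e : Fin k ↪ Fin N) (u : Fin k → ℂ) : Fin N → ℂ :=
  Function.extend e u fun _ => 1

theorem extendOne_apply (e : Fin k ↪ Fin N) (u : Fin k → ℂ) (j : Fin k) :
    extendOne e u (e j) = u j := e.injective.extend_apply _ _ _

theorem extendOne_of_notMem (e : Fin k ↪ Fin N) (u : Fin k → ℂ) {i : Fin N}
    (hi : ∀ j, e j ≠ i) : extendOne e u i = 1 :=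
  Function.extend_apply' _ _ _ fun ⟨j, hj⟩ => hi j hj

theorem extendOne_onePt (e : Fin k ↪ Fin N) : extendOne e (onePt k) = onePt N := by
  funext i
  by_cases hi : ∃ j, e j = i
  · obtain ⟨j, rfl⟩ := hi
    exact extendOne_apply e _ j
  · exact extendOne_of_notMem e _ (not_exists.1 hi)

theorem extendOne_update (e : Fin k ↪ Fin N) (u : Fin k → ℂ) (j : Fin k) (z : ℂ) :
    extendOne e (Function.update u j z) = Function.update (extendOne e u) (e j) z := by
  funext i
  by_cases hi : ∃ j, e j = i
  · obtain ⟨j', rfl⟩ := hi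
    rw [extendOne_apply]
    by_cases hj : j' = j
    · subst hj
      simp
    · rw [Function.update_of_ne hj, Function.update_of_ne (e.injective.ne hj), extendOne_apply]
  · have hi := not_exists.1 hi
    rw [extendOne_of_notMem e _ hi, Function.update_of_ne (Ne.symm (hi j)), extendOne_of_notMem e _ hi]

theorem analyticAt_extendOne (e : Fin k ↪ Fin N) (u : Fin k → ℂ) :
    AnalyticAt ℂ (extendOne e) u := by
  refine analyticAt_pi_iff.2 fun i => ?_
  by_cases hi : ∃ j, e j = i
  · obtain ⟨j, rfl⟩ := hi
    simp only [extendOne_apply]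
    exact analyticAt_coord j u
  · simp only [extendOne_of_notMem e _ (not_exists.1 hi)]
    exact analyticAt_const

theorem analyticAt_comp_extendOne (e : Fin k ↪ Fin N) {f : (Fin N → ℂ) → ℂ}
    (hf : AnalyticAt ℂ f (onePt N)) : AnalyticAt ℂ (fun u => f (extendOne e u)) (onePt k) := by
  rw [← extendOne_onePt e] at hf
  exact hf.comp (analyticAt_extendOne e _)

theorem pd_comp_extendOne (e : Fin k ↪ Fin N) (j : Fin k) {f : (Fin N → ℂ) → ℂ} {u : Fin k → ℂ}
    (hf : AnalyticAt ℂ f (extendOne e u)) :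
    pd j (fun u => f (extendOne e u)) u = pd (e j) f (extendOne e u) := by
  rw [pd_eq_deriv (f := fun u => f (extendOne e u)) j
      (hf.comp (analyticAt_extendOne e u)).differentiableAt,
    pd_eq_deriv (e j) hf.differentiableAt, extendOne_apply]
  simp only [extendOne_update]

theorem pderiv_killCompl (e : Fin k ↪ Fin N) (j : Fin k) (f : MvPowerSeries (Fin N) ℂ) :
    pderiv ℂ j (killCompl e f) = killCompl e (pderiv ℂ (e j) f) := by
  ext β
  rw [coeff_pderiv, coeff_killCompl, coeff_killCompl, coeff_pderiv, Finsupp.embDomain_add,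
    Finsupp.embDomain_single, Finsupp.embDomain_apply_self]

theorem constantCoeff_killCompl (e : Fin k ↪ Fin N) (f : MvPowerSeries (Fin N) ℂ) :
    constantCoeff (killCompl e f) = constantCoeff f := by
  rw [← coeff_zero_eq_constantCoeff_apply, coeff_killCompl, Finsupp.embDomain_zero,
    coeff_zero_eq_constantCoeff_apply]

/-- Restricting a function to some of the variables, with the others equal to `1`, corresponds to
setting the other variables of its Taylor series to `0`. -/
theorem killCompl_taylor (e : Fin k ↪ Fin N) {f : (Fin N → ℂ) → ℂ}
    (hf : AnalyticAt ℂ f (onePt N)) :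
    killCompl e (taylor f) = taylor fun u => f (extendOne e u) := by
  have key : ∀ d : ℕ, ∀ f : (Fin N → ℂ) → ℂ, AnalyticAt ℂ f (onePt N) → ∀ β : Fin k →₀ ℕ,
      β.degree ≤ d → coeff β (killCompl e (taylor f)) =
        coeff β (taylor fun u => f (extendOne e u)) := by
    intro d
    have h0 : ∀ f : (Fin N → ℂ) → ℂ, constantCoeff (killCompl e (taylor f)) =
        constantCoeff (taylor fun u => f (extendOne e u)) := by
      intro f
      rw [constantCoeff_killCompl, constantCoeff_taylor, constantCoeff_taylor, extendOne_onePt]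
    induction d with
    | zero =>
      intro f _ β hβ
      rw [(Finsupp.degree_eq_zero_iff β).1 (Nat.le_zero.1 hβ), coeff_zero_eq_constantCoeff_apply,
        coeff_zero_eq_constantCoeff_apply, h0]
    | succ d ih =>
      intro f hf β hβ
      refine coeff_eq_of_pderiv d (h0 f) ?_ β hβ
      intro j γ hγ
      have hpd : pd j (fun u => f (extendOne e u)) =ᶠ[𝓝 (onePt k)]
          fun u => pd (e j) f (extendOne e u) := by
        have h1 : Tendsto (extendOne e) (𝓝 (onePt k)) (𝓝 (onePt N)) := by
          have := (analyticAt_extendOne e (onePt k)).continuousAt.tendsto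
          rwa [extendOne_onePt] at this
        filter_upwards [h1.eventually hf.eventually_analyticAt] with u hu
        exact pd_comp_extendOne e j hu
      rw [pderiv_killCompl, pderiv_taylor _ hf, pderiv_taylor j (analyticAt_comp_extendOne e hf),
        taylor_congr hpd]
      exact ih _ (analyticAt_pd _ hf) γ hγ
  ext β
  exact key _ f hf β le_rfl

theorem permAct_taylor (π : Equiv.Perm (Fin N)) {f : (Fin N → ℂ) → ℂ}
    (hf : AnalyticAt ℂ f (onePt N)) :
    permAct π (taylor f) = taylor fun x => f (x ∘ π) := by
  have h1 : ∀ g : MvPowerSeries (Fin N) ℂ,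
      permAct π g = killCompl π.symm.toEmbedding g := by
    intro g
    ext α
    rw [coeff_permAct', coeff_killCompl, Finsupp.embDomain_eq_mapDomain,
      Finsupp.equivMapDomain_eq_mapDomain]
    rfl
  rw [h1, killCompl_taylor _ hf]
  congr 1
  funext x
  congr 1
  funext i
  have := extendOne_apply π.symm.toEmbedding x (π i)
  simpa using this

theorem permAct_taylor_normSchur (l : Signature N) (π : Equiv.Perm (Fin N)) :
    permAct π (taylor (normSchur l)) = taylor (normSchur l) := by
  rw [permAct_taylor π (analyticAt_normSchur l fun _ => one_ne_zero)]
  congr 1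
  funext x
  rw [normSchur, normSchur, schur_comp_perm]

theorem padOnes_eq_extendOne (h : k ≤ N) (u : Fin k → ℂ) :
    padOnes N u = extendOne (Fin.castLEEmb h) u := by
  funext i
  by_cases hi : (i : ℕ) < k
  · have h1 : Fin.castLEEmb h ⟨i, hi⟩ = i := rfl
    rw [padOnes, dif_pos hi]
    conv_rhs => rw [← h1]
    rw [extendOne_apply]
  · rw [padOnes, dif_neg hi, extendOne_of_notMem]
    intro j hj
    rw [← hj] at hi
    exact hi j.isLt

end Restriction

/-! ### The Schur generating function as a power series -/

section GeneratingSeries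

open MvPowerSeries

variable {N : ℕ}

/-- The formal expansion at `1^N` of the Schur generating function. -/
noncomputable def schurSeries (ρ : Measure (Signature N)) : MvPowerSeries (Fin N) ℂ :=
  fun α => ∑' l : Signature N, (ρ.real {l} : ℂ) * coeff α (taylor (normSchur l))

theorem coeff_schurSeries (ρ : Measure (Signature N)) (α : Fin N →₀ ℕ) :
    coeff α (schurSeries ρ) =
      ∑' l : Signature N, (ρ.real {l} : ℂ) * coeff α (taylor (normSchur l)) := rfl

/-- A dominating series for the Schur generating function near `1^N`. -/
theorem exists_dominating {ρ : Measure (Signature N)}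
    (h : ∀ᶠ x : Fin N → ℂ in 𝓝 (fun _ => 1), Summable (sgfTerm ρ x)) :
    ∃ δ : ℝ, 0 < δ ∧ δ < 1 ∧ ∃ M : Signature N → ℝ,
      Summable (fun l => ρ.real {l} * M l) ∧
      ∀ l, ∀ x : Fin N → ℂ, (∀ i, ‖x i - 1‖ ≤ δ) → ‖normSchur l x‖ ≤ M l := by
  obtain ⟨r, hr, hball⟩ := Metric.eventually_nhds_iff.1 h
  set δ := min (r / 2) (1 / 2) with hδ
  have h0 : 0 < δ := by positivity
  have h1 : δ < 1 := (min_le_right _ _).trans_lt (by norm_num)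
  have h2 : δ < r := (min_le_left _ _).trans_lt (by linarith)
  refine ⟨δ, h0, h1, fun l => ∑ ε, ‖normSchur l (corner δ ε)‖, ?_,
    fun l x hx => norm_normSchur_le l h0 h1 hx⟩
  simp only [Finset.mul_sum]
  refine summable_sum fun ε _ => ?_
  have h3 : Summable (sgfTerm ρ (corner δ ε)) := by
    refine hball ((dist_pi_lt_iff hr).2 fun i => ?_)
    rw [Complex.dist_eq, corner]
    split_ifs
    · push_cast
      rw [add_sub_cancel_left, Complex.norm_real, Real.norm_of_nonneg h0.le]
      exact h2
    · push_cast
      rw [sub_sub_cancel_left, norm_neg, Complex.norm_real, Real.norm_of_nonneg h0.le]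
      exact h2
  refine h3.norm.congr fun l => ?_
  rw [sgfTerm, norm_mul, Complex.norm_real, Real.norm_of_nonneg measureReal_nonneg]
  rfl

/-- The Taylor coefficients of the Schur generating function are summable termwise, by Cauchy's
estimate and the dominating series. -/
theorem coeffHasSum_schurSeries {ρ : Measure (Signature N)}
    (h : ∀ᶠ x : Fin N → ℂ in 𝓝 (fun _ => 1), Summable (sgfTerm ρ x)) :
    CoeffHasSum (fun l => (ρ.real {l} : ℂ) • taylor (normSchur l)) (schurSeries ρ) := by
  obtain ⟨δ, h0, h1, M, hM, hdom⟩ := exists_dominating h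
  intro α
  obtain ⟨K, hK⟩ := exists_norm_coeff_taylor_le α δ h0
  have hball : ∀ x ∈ Metric.ball (onePt N) δ, ∀ i, ‖x i - 1‖ ≤ δ := by
    intro x hx i
    rw [← Complex.dist_eq]
    exact ((dist_pi_lt_iff h0).1 hx i).le
  simp only [coeff_smul]
  refine Summable.hasSum (Summable.of_norm_bounded (g := fun l => K * (ρ.real {l} * M l))
    (hM.mul_left K) fun l => ?_)
  rw [norm_mul, Complex.norm_real, Real.norm_of_nonneg measureReal_nonneg, mul_left_comm]
  refine mul_le_mul_of_nonneg_left (hK _ _ (fun x hx => ?_) fun x hx => ?_) measureReal_nonneg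
  · refine analyticAt_normSchur l fun i => ?_
    exact norm_pos_iff.1 ((sub_pos.2 h1).trans_le (norm_sub_one_bounds (hball x hx i)).1)
  · exact hdom l x (hball x hx)

theorem permAct_schurSeries {ρ : Measure (Signature N)}
    (h : ∀ᶠ x : Fin N → ℂ in 𝓝 (fun _ => 1), Summable (sgfTerm ρ x)) (π : Equiv.Perm (Fin N)) :
    permAct π (schurSeries ρ) = schurSeries ρ := by
  refine CoeffHasSum.unique ((coeffHasSum_schurSeries h).permAct π) ?_
  simp only [map_smul, permAct_taylor_normSchur]
  exact coeffHasSum_schurSeries h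

theorem hasSum_measureReal_singleton (ρ : Measure (Signature N)) [IsProbabilityMeasure ρ] :
    HasSum (fun l : Signature N => ρ.real {l}) 1 := by
  have h1 := hasSum_integral_iUnion (μ := ρ) (f := fun _ => (1 : ℝ))
    (s := fun l : Signature N => {l}) (fun l => measurableSet_singleton l)
    (fun i j hij => by simpa [Function.onFun] using hij) (integrable_const _).integrableOn
  simpa [Set.iUnion_of_singleton, Measure.real] using! h1

theorem constantCoeff_schurSeries (ρ : Measure (Signature N)) [IsProbabilityMeasure ρ] :
    constantCoeff (schurSeries ρ) = 1 := by
  rw [← coeff_zero_eq_constantCoeff_apply, coeff_schurSeries]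
  simp only [coeff_zero_eq_constantCoeff_apply, constantCoeff_taylor, normSchur_one, mul_one]
  exact_mod_cast (Complex.hasSum_ofReal.2 (hasSum_measureReal_singleton ρ)).tsum_eq

/-- The restriction of the formal generating series to the first `k` variables is the Taylor series
of the restricted generating function. -/
theorem killCompl_schurSeries {k : ℕ} (hk : k ≤ N) {ρ : Measure (Signature N)}
    (h : ∀ᶠ x : Fin N → ℂ in 𝓝 (fun _ => 1), Summable (sgfTerm ρ x)) {U : Set (Fin k → ℂ)}
    (hU : U ∈ 𝓝 (onePt k)) {R : (Fin k → ℂ) → ℂ} (hR : IsRootBranch ρ U R) :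
    killCompl (Fin.castLEEmb hk) (schurSeries ρ) = taylor R ^ N := by
  have hRan : AnalyticAt ℂ R (onePt k) := hR.analytic _ (mem_of_mem_nhds hU)
  obtain ⟨δ, h0, h1, M, hM, hdom⟩ := exists_dominating h
  set B := Metric.ball (onePt k) δ with hB
  have hpad : ∀ u ∈ B, ∀ i, ‖extendOne (Fin.castLEEmb hk) u i - 1‖ ≤ δ := by
    intro u hu i
    by_cases hi : ∃ j, Fin.castLEEmb hk j = i
    · obtain ⟨j, rfl⟩ := hi
      rw [extendOne_apply, ← Complex.dist_eq]
      exact ((dist_pi_lt_iff h0).1 hu j).le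
    · rw [extendOne_of_notMem _ _ (not_exists.1 hi), sub_self, norm_zero]
      exact h0.le
  set g : Signature N → (Fin k → ℂ) → ℂ := fun l u =>
    (ρ.real {l} : ℂ) * normSchur l (extendOne (Fin.castLEEmb hk) u) with hg
  have hgan : ∀ l, AnalyticOnNhd ℂ (g l) B := by
    intro l u hu
    refine analyticAt_const.fun_mul (AnalyticAt.comp (analyticAt_normSchur l fun i => ?_)
      (analyticAt_extendOne _ u))
    exact norm_pos_iff.1 ((sub_pos.2 h1).trans_le (norm_sub_one_bounds (hpad u hu i)).1)
  have hunif := tendstoUniformlyOn_tsum (f := g) hM (s := B) fun l u hu => by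
    rw [hg, norm_mul, Complex.norm_real, Real.norm_of_nonneg measureReal_nonneg]
    exact mul_le_mul_of_nonneg_left (hdom l _ (hpad u hu)) measureReal_nonneg
  have hlim : (fun u => ∑' l, g l u) =ᶠ[𝓝 (onePt k)] fun u => R u ^ N := by
    filter_upwards [hU] with u hu
    rw [hR.pow_eq u hu, padOnes_eq_extendOne hk]
    rfl
  rw [← taylor_pow hRan, ← taylor_congr hlim]
  ext β
  have hBn : B ∈ 𝓝 (onePt k) := Metric.ball_mem_nhds _ h0
  have ht := tendsto_coeff_taylor hBn (Eventually.of_forall fun s : Finset (Signature N) =>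
    Finset.analyticOnNhd_fun_sum s fun l _ => hgan l)
    ((hRan.fun_pow N).congr hlim.symm) hunif β
  have ht' := coeffHasSum_schurSeries h (β.embDomain (Fin.castLEEmb hk))
  rw [← coeff_killCompl] at ht'
  refine tendsto_nhds_unique ht' (ht.congr fun s => ?_)
  rw [taylor_sum _ fun l _ => hgan l _ (mem_of_mem_nhds hBn), map_sum]
  refine Finset.sum_congr rfl fun l _ => ?_
  have hA := analyticAt_normSchur l (x := onePt N) fun _ => one_ne_zero
  rw [taylor_const_mul _ (analyticAt_comp_extendOne _ hA), ← killCompl_taylor _ hA, coeff_smul,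
    coeff_killCompl]
  exact (coeff_smul _ _ _).symm

end GeneratingSeries

/-! ### Logarithmic derivatives of the Schur generating function -/

section LogDeriv

open MvPowerSeries

/-- The inverse of power series is continuous for coefficientwise convergence. -/
theorem CoeffTendsto.inv {σ : Type*} [DecidableEq σ] {f : ℕ → MvPowerSeries σ ℂ}
    {F : MvPowerSeries σ ℂ} (hf : CoeffTendsto f F) (h0 : constantCoeff F ≠ 0) :
    CoeffTendsto (fun N => (f N)⁻¹) F⁻¹ := by
  have hc : Tendsto (fun N => (constantCoeff (f N))⁻¹) atTop (𝓝 (constantCoeff F)⁻¹) := by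
    simp only [← coeff_zero_eq_constantCoeff_apply] at h0 ⊢
    exact (hf 0).inv₀ h0
  intro α
  induction α using WellFoundedLT.induction with
  | ind α ih =>
    refine Tendsto.congr (fun N => (coeff_inv α (f N)).symm) ?_
    rw [coeff_inv]
    split_ifs with hα
    · exact hc
    · refine hc.neg.mul (tendsto_finsetSum _ fun p _ => ?_)
      split_ifs with hp
      · exact (hf p.1).mul (ih p.2 hp)
      · exact tendsto_const_nhds

theorem killCompl_trans_permAct {k N : ℕ} (e : Fin k ↪ Fin N) (π : Equiv.Perm (Fin N))
    (f : MvPowerSeries (Fin N) ℂ) :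
    killCompl (e.trans π.toEmbedding) (permAct π f) = killCompl e f := by
  ext β
  rw [coeff_killCompl, coeff_killCompl, coeff_permAct']
  refine coeff_congr ?_ _
  ext i
  rw [Finsupp.equivMapDomain_apply, Equiv.symm_symm]
  by_cases hi : ∃ j, e j = i
  · obtain ⟨j, rfl⟩ := hi
    rw [Finsupp.embDomain_apply_self]
    exact Finsupp.embDomain_apply_self (e.trans π.toEmbedding) β j
  · rw [Finsupp.embDomain_of_notMem_range, Finsupp.embDomain_of_notMem_range]
    · exact fun ⟨j, hj⟩ => hi ⟨j, hj⟩
    · exact fun ⟨j, hj⟩ => hi ⟨j, π.injective hj⟩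

/-- The restriction of a symmetric power series does not depend on the chosen variables. -/
theorem killCompl_eq_of_symm {k N : ℕ} {f : MvPowerSeries (Fin N) ℂ}
    (hf : ∀ π : Equiv.Perm (Fin N), permAct π f = f) (e e' : Fin k ↪ Fin N) :
    killCompl e f = killCompl e' f := by
  obtain ⟨π, hπ⟩ := Equiv.Perm.exists_extending_pair e e' e.injective e'.injective
  have h1 : e.trans π.toEmbedding = e' := by
    ext j
    exact congrArg Fin.val (hπ j)
  rw [← killCompl_trans_permAct e π f, h1, hf]

/-- The logarithmic derivative `N⁻¹ ∂_i S / S` of the generating series `S` in `N` variables. -/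
noncomputable def logDerivSeries {N : ℕ} (S : MvPowerSeries (Fin N) ℂ) (i : Fin N) :
    MvPowerSeries (Fin N) ℂ :=
  (N : ℂ)⁻¹ • (pderiv ℂ i S * S⁻¹)

theorem smul_logDerivSeries_mul {N : ℕ} {S : MvPowerSeries (Fin N) ℂ}
    (hS : constantCoeff S = 1) (i : Fin N) :
    (N : ℂ) • (logDerivSeries S i * S) = pderiv ℂ i S := by
  have hN : (N : ℂ) ≠ 0 := Nat.cast_ne_zero.2 i.pos.ne'
  rw [logDerivSeries, smul_mul_assoc, smul_smul, mul_inv_cancel₀ hN, one_smul, mul_assoc,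
    MvPowerSeries.inv_mul_cancel _ (by rw [hS]; exact one_ne_zero), mul_one]

/-- If the restriction of `S` to some of the variables is an `N`-th power, then the restriction of
its normalized logarithmic derivative is the logarithmic derivative of the root. -/
theorem killCompl_logDerivSeries {k N : ℕ} {S : MvPowerSeries (Fin N) ℂ}
    (hS : constantCoeff S = 1) (e : Fin k ↪ Fin N) (j : Fin k) {T : MvPowerSeries (Fin k) ℂ}
    (hT : constantCoeff T = 1) (h : killCompl e S = T ^ N) :
    killCompl e (logDerivSeries S (e j)) = pderiv ℂ j T * T⁻¹ := by
  have hN : N ≠ 0 := (e j).pos.ne'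
  have hT1 : constantCoeff T ≠ 0 := by
    rw [hT]
    exact one_ne_zero
  have hT0 : T ≠ 0 := by
    rintro rfl
    simp at hT
  rw [MvPowerSeries.eq_mul_inv_iff_mul_eq hT1]
  have h1 := congrArg (killCompl e) (smul_logDerivSeries_mul hS (e j))
  rw [← pderiv_killCompl, map_smul, map_mul, h, Derivation.leibniz_pow, smul_eq_mul,
    ← Nat.cast_smul_eq_nsmul ℂ] at h1
  have h2 := smul_right_injective _ (Nat.cast_ne_zero (R := ℂ).2 hN) h1
  obtain ⟨M, rfl⟩ := Nat.exists_eq_succ_of_ne_zero hN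
  rw [pow_succ', Nat.succ_sub_one, mul_comm (T ^ M), ← mul_assoc] at h2
  exact mul_right_cancel₀ (pow_ne_zero M hT0) h2

/-- The logarithmic derivative in the first variable of the limit `F_{n+1}`. -/
noncomputable def limitSeries (F : ∀ k : ℕ, (Fin k → ℂ) → ℂ) (n : ℕ) :
    MvPowerSeries (Fin (n + 1)) ℂ :=
  pderiv ℂ 0 (taylor (F (n + 1))) * (taylor (F (n + 1)))⁻¹

theorem limit_apply_one {ρ : ∀ N : ℕ, Measure (Signature N)} {k : ℕ} {f : (Fin k → ℂ) → ℂ}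
    (h : RootConverges ρ k f) : f (onePt k) = 1 := by
  obtain ⟨U, -, h1, R, hR, hlim⟩ := h
  refine tendsto_nhds_unique (hlim.tendsto_at h1) (tendsto_const_nhds.congr' ?_)
  filter_upwards [hR] with N hN
  exact hN.map_one.symm

/-- The hypothesis on the roots of the Schur generating functions, in terms of power series: the
normalized logarithmic derivatives of the restrictions are those of the roots. -/
theorem logDerivConverges_schurSeries
    (ρ : ∀ N : ℕ, Measure (Signature N)) (hprob : ∀ N, IsProbabilityMeasure (ρ N))
    (hconv : ∀ N, 1 ≤ N → ∀ᶠ x : Fin N → ℂ in 𝓝 (fun _ => 1), Summable (sgfTerm (ρ N) x))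
    (F : ∀ k : ℕ, (Fin k → ℂ) → ℂ)
    (hFan : ∀ k, 1 ≤ k → AnalyticAt ℂ (F k) (fun _ => 1))
    (hlim : ∀ k, 1 ≤ k → RootConverges ρ k (F k)) :
    LogDerivConverges (fun N => schurSeries (ρ N)) (fun N => logDerivSeries (schurSeries (ρ N)))
      (limitSeries F) where
  symm N hN π := permAct_schurSeries (hconv N hN) π
  ne_zero N _ h := by
    have h1 := constantCoeff_schurSeries (ρ N)
    rw [h, map_zero] at h1
    exact zero_ne_one h1
  pderiv_eq N i := (smul_logDerivSeries_mul (constantCoeff_schurSeries (ρ N)) i).symm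
  lim n := by
    have h1 := limit_apply_one (hlim (n + 1) (Nat.succ_pos n))
    obtain ⟨U, hU, hU1, R, hR, hunif⟩ := hlim (n + 1) (Nat.succ_pos n)
    have hUn : U ∈ 𝓝 (onePt (n + 1)) := hU.mem_nhds hU1
    refine ⟨fun N => pderiv ℂ 0 (taylor (R N)) * (taylor (R N))⁻¹, ?_, ?_⟩
    · filter_upwards [hR, eventually_ge_atTop (n + 1)] with N hRN hN e
      have hsum := hconv N (le_trans (Nat.succ_pos n) hN)
      refine killCompl_logDerivSeries (constantCoeff_schurSeries (ρ N)) e 0 ?_ ?_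
      · rw [constantCoeff_taylor]
        exact hRN.map_one
      · rw [killCompl_eq_of_symm (permAct_schurSeries hsum) e (Fin.castLEEmb hN)]
        exact killCompl_schurSeries hN hsum hUn hRN
    · have hT : CoeffTendsto (fun N => taylor (R N)) (taylor (F (n + 1))) :=
        tendsto_coeff_taylor hUn (hR.mono fun N h => h.analytic) (hFan _ (Nat.succ_pos n)) hunif
      refine CoeffTendsto.mul ?_ (hT.inv ?_)
      · intro α
        simp only [coeff_pderiv]
        exact (hT _).mul_const _
      · rw [constantCoeff_taylor, h1]
        exact one_ne_zero

/-- On the line through `1^{m+1}` whose direction is formed by the `(m+1)`-st roots of unity, a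
symmetric function is constant to order `m`. -/
theorem coeff_lineEval_rootsVec_of_symm {m d : ℕ} {T : MvPowerSeries (Fin (m + 1)) ℂ}
    (hT : ∀ π, permAct π T = T) (hd0 : d ≠ 0) (hd : d ≤ m) :
    PowerSeries.coeff d (lineEval (rootsVec m) T) = 0 := by
  have h1 : lineEval (rootsVec m) T =
      lineEval (fun j => rootsVec m 1 * rootsVec m j) T := by
    conv_lhs => rw [← hT (Equiv.addLeft 1)]
    rw [lineEval_permAct]
    refine congrArg (fun c => lineEval c T) ?_
    funext j
    exact rootsVec_add m 1 j
  have h2 := congrArg (PowerSeries.coeff d) h1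
  rw [coeff_lineEval_mul_const] at h2
  have hm : 1 < m + 1 := by omega
  have h3 : rootsVec m 1 ^ d ≠ 1 := by
    rw [rootsVec, Fin.val_one' , Nat.mod_eq_of_lt hm, pow_one]
    exact (isPrimitiveRoot_rootOfUnity m).pow_ne_one_of_pos_of_lt hd0 (by omega)
  have h4 : (1 - rootsVec m 1 ^ d) * PowerSeries.coeff d (lineEval (rootsVec m) T) = 0 := by
    rw [sub_mul, one_mul, ← h2, sub_self]
  exact (mul_eq_zero.1 h4).resolve_left (sub_ne_zero.2 h3.symm)

theorem partialFirst_eventuallyEq {l : ℕ} {f : (Fin (l + 1) → ℂ) → ℂ}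
    (hf : AnalyticAt ℂ f (onePt (l + 1))) : pd 0 f =ᶠ[𝓝 (onePt (l + 1))] partialFirst f := by
  filter_upwards [hf.eventually_analyticAt] with x hx
  exact pd_eq_deriv 0 hx.differentiableAt

/-- In the formula for the limiting moments, the logarithmic derivative of `F` may be replaced by
the derivative: along the roots-of-unity line they agree to the relevant order. -/
theorem formalMoment_limitSeries (F : ∀ k : ℕ, (Fin k → ℂ) → ℂ)
    (hFan : ∀ k, 1 ≤ k → AnalyticAt ℂ (F k) (fun _ => 1))
    (hFsymm : ∀ k, 1 ≤ k → ∀ σ : Equiv.Perm (Fin k),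
      ∀ᶠ u : Fin k → ℂ in 𝓝 (fun _ => 1), F k (u ∘ σ) = F k u)
    (hF1 : ∀ k, 1 ≤ k → F k (onePt k) = 1) (k : ℕ) :
    formalMoment (limitSeries F) k = limitMoment F k := by
  rw [formalMoment, limitMoment]
  refine Finset.sum_congr rfl fun m _ => ?_
  rw [mul_assoc]
  congr 1
  have hm := Nat.succ_pos m
  set f := F (m + 1) with hfdef
  have hf : AnalyticAt ℂ f (onePt (m + 1)) := hFan (m + 1) hm
  set T := taylor f with hT
  have hT1 : constantCoeff T = 1 := by rw [hT, constantCoeff_taylor, hfdef, hF1 _ hm]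
  have hTsymm : ∀ π, permAct π T = T := by
    intro π
    rw [hT, permAct_taylor π hf]
    exact taylor_congr (hFsymm _ hm π)
  set φ := lineEval (rootsVec m) T with hφ
  set A := lineEval (rootsVec m) (limitSeries F m) with hA
  have hφ1 : PowerSeries.X ^ (m + 1) ∣ φ - 1 := by
    rw [PowerSeries.X_pow_dvd_iff]
    intro d hd
    rcases eq_or_ne d 0 with rfl | hd0
    · rw [map_sub, hφ, constantCoeff_lineEval, hT1, PowerSeries.coeff_one, if_pos rfl, sub_self]
    · rw [map_sub, hφ, coeff_lineEval_rootsVec_of_symm hTsymm hd0 (by omega),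
        PowerSeries.coeff_one, if_neg hd0, sub_self]
  have hB : lineEval (rootsVec m) (pderiv ℂ 0 T) = A * φ := by
    rw [hA, hφ, ← map_mul, limitSeries, mul_assoc, MvPowerSeries.inv_mul_cancel, mul_one]
    rw [← hfdef, ← hT, hT1]
    exact one_ne_zero
  have hdvd : PowerSeries.X ^ (m + 1) ∣
      lineEval (rootsVec m) ((1 + X 0) ^ k * pderiv ℂ 0 T ^ (k - m)) -
        lineEval (rootsVec m) ((1 + X 0) ^ k * limitSeries F m ^ (k - m)) := by
    rw [map_mul, map_mul, ← mul_sub, map_pow _ (pderiv ℂ 0 T), map_pow _ (limitSeries F m), hB,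
      ← hA]
    refine Dvd.dvd.mul_left (dvd_trans ?_ (sub_dvd_pow_sub_pow (A * φ) A (k - m))) _
    have : A * φ - A = A * (φ - 1) := by ring
    rw [this]
    exact Dvd.dvd.mul_left hφ1 _
  have hcoeff := (PowerSeries.X_pow_dvd_iff.1 hdvd) m (Nat.lt_succ_self m)
  rw [map_sub, sub_eq_zero] at hcoeff
  rw [← hcoeff]
  have hpd := analyticAt_pd 0 hf
  have hx : AnalyticAt ℂ (fun x : Fin (m + 1) → ℂ => x 0) (onePt (m + 1)) := analyticAt_coord 0 _
  have hg : AnalyticAt ℂ (fun x : Fin (m + 1) → ℂ => x 0 ^ k * pd 0 f x ^ (k - m))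
      (onePt (m + 1)) := (hx.fun_pow k).fun_mul (hpd.fun_pow _)
  have hline := iteratedDeriv_line (rootsVec m) m hg
  rw [taylor_mul (hx.fun_pow k) (hpd.fun_pow _), taylor_pow hx, taylor_pow hpd, taylor_coord,
    ← pderiv_taylor 0 hf] at hline
  have hcont : Tendsto (fun u : ℂ => fun j => 1 + u * rootsVec m j) (𝓝 0)
      (𝓝 (onePt (m + 1))) := by
    have h1 : Continuous fun u : ℂ => fun j => 1 + u * rootsVec m j := by fun_prop
    have h2 := h1.tendsto 0
    simpa using! h2
  have hev : (fun u : ℂ => (1 + u) ^ k *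
      partialFirst f (fun j : Fin (m + 1) => 1 + u * rootOfUnity (m + 1) ^ (j : ℕ)) ^ (k - m))
      =ᶠ[𝓝 0] fun u => (fun x : Fin (m + 1) → ℂ => x 0 ^ k * pd 0 f x ^ (k - m))
        fun j => 1 + u * rootsVec m j := by
    filter_upwards [hcont.eventually (partialFirst_eventuallyEq hf)] with u hu
    simp only [hu]
    simp [rootsVec]
  rw [hev.iteratedDeriv_eq, hline, Nat.factorial_succ]
  have hfac : (m.factorial : ℂ) ≠ 0 := Nat.cast_ne_zero.2 m.factorial_ne_zero
  have hm1 : (m : ℂ) + 1 ≠ 0 := Nat.cast_add_one_ne_zero m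
  push_cast
  field_simp
  rw [hT]

end LogDeriv

/-! ### Moments of the empirical measures -/

section FactorialMoments

open MvPowerSeries

variable {N : ℕ}

/-- The moments `N^{-j-r-1} ∑_i l_i (l_i - 1) ⋯ (l_i - j + 1) l_i^r` of the particle positions
`l_i`, mixing falling factorials with powers. -/
noncomputable def mixedMoment (j r : ℕ) (l : Signature N) : ℝ :=
  ((N : ℝ) ^ (j + r + 1))⁻¹ *
    ∑ i, (∏ t ∈ Finset.range j, ((position l i : ℝ) - t)) * (position l i : ℝ) ^ r

theorem mixedMoment_succ (hN : 1 ≤ N) (j r : ℕ) (l : Signature N) :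
    mixedMoment j (r + 1) l = mixedMoment (j + 1) r l + (j / N : ℝ) * mixedMoment j r l := by
  have hN0 : (N : ℝ) ≠ 0 := Nat.cast_ne_zero.2 (by omega)
  have h1 : ∀ i : Fin N, (∏ t ∈ Finset.range j, ((position l i : ℝ) - t)) *
      (position l i : ℝ) ^ (r + 1) =
      (∏ t ∈ Finset.range (j + 1), ((position l i : ℝ) - t)) * (position l i : ℝ) ^ r +
        j * ((∏ t ∈ Finset.range j, ((position l i : ℝ) - t)) * (position l i : ℝ) ^ r) := by
    intro i
    rw [Finset.prod_range_succ]
    ring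
  simp only [mixedMoment, h1, Finset.sum_add_distrib, ← Finset.mul_sum]
  field_simp
  ring

theorem momentOp_smul_taylor_normSchur (k : ℕ) (c : ℂ) (l : Signature N) :
    momentOp k (c • taylor (normSchur l)) = c • momentOp k (taylor (normSchur l)) := by
  have hs := permAct_taylor_normSchur l
  apply mul_left_cancel₀ isVandermonde_vandermondeSeries.1
  rw [mul_momentOp isVandermonde_vandermondeSeries k fun π => by rw [map_smul, hs],
    mul_smul_comm, mul_smul_comm, mul_momentOp isVandermonde_vandermondeSeries k hs,
    Finset.smul_sum]
  refine Finset.sum_congr rfl fun i _ => ?_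
  have hc : (pderiv ℂ i)^[k] (c • (vandermondeSeries N * taylor (normSchur l))) =
      c • (pderiv ℂ i)^[k] (vandermondeSeries N * taylor (normSchur l)) :=
    Function.Commute.iterate_left (f := pderiv ℂ i) (g := fun f => c • f)
      (fun f => Derivation.map_smul _ _ _) k _
  rw [hc, mul_smul_comm]

theorem momentOp_taylor_eq_mixedMoment (hN : 1 ≤ N) (k : ℕ) (c : ℂ) (l : Signature N) :
    momentOp k (c • taylor (normSchur l)) =
      (N : ℂ) ^ (k + 1) • ((c * (mixedMoment k 0 l : ℂ)) • taylor (normSchur l)) := by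
  have hN0 : (N : ℂ) ≠ 0 := Nat.cast_ne_zero.2 (by omega)
  rw [momentOp_smul_taylor_normSchur, momentOp_taylor_normSchur l (permAct_taylor_normSchur l),
    smul_smul, smul_smul]
  congr 1
  rw [mixedMoment]
  push_cast
  simp only [pow_zero, mul_one, add_zero]
  field_simp

/-- If `S Q` is the expansion of a weighted generating series, then multiplying the weights by the
normalized factorial moments corresponds to passing from `Q` to `momentQuot k N Q L`. -/
theorem coeffHasSum_mul_mixedMoment (hN : 1 ≤ N) {w : Signature N → ℂ}
    {Q S : MvPowerSeries (Fin N) ℂ} {L : Fin N → MvPowerSeries (Fin N) ℂ}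
    (hS : ∀ π : Equiv.Perm (Fin N), permAct π S = S)
    (hL : ∀ a, pderiv ℂ a S = (N : ℂ) • (L a * S))
    (h : CoeffHasSum (fun l => w l • taylor (normSchur l)) (Q * S)) (k : ℕ) :
    CoeffHasSum (fun l => (w l * (mixedMoment k 0 l : ℂ)) • taylor (normSchur l))
      (momentQuot k (N : ℂ) Q L * S) := by
  have hN0 : (N : ℂ) ≠ 0 := Nat.cast_ne_zero.2 (by omega)
  have h1 := (h.momentOp k).smul ((N : ℂ) ^ (k + 1))⁻¹
  rw [momentOp_mul_eq k hN0 Q hS hL, smul_smul, inv_mul_cancel₀ (pow_ne_zero _ hN0), one_smul,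
    mul_comm S] at h1
  simp only [momentOp_taylor_eq_mixedMoment hN, smul_smul, ← mul_assoc,
    inv_mul_cancel₀ (pow_ne_zero _ hN0), one_mul] at h1
  exact h1

theorem CoeffHasSum.hasSum_weights {w : Signature N → ℂ} {Q S : MvPowerSeries (Fin N) ℂ}
    (hS : constantCoeff S = 1)
    (h : CoeffHasSum (fun l => w l • taylor (normSchur l)) (Q * S)) :
    HasSum w (constantCoeff Q) := by
  have h1 := h 0
  simp only [coeff_zero_eq_constantCoeff_apply, map_mul, hS, mul_one] at h1
  refine h1.congr_fun ?_
  intro l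
  rw [← coeff_zero_eq_constantCoeff_apply, coeff_smul, coeff_zero_eq_constantCoeff_apply,
    constantCoeff_taylor, normSchur_one, mul_one]

end FactorialMoments

/-! ### Convergence in probability of the moments -/

section Probability

/-- Convergence in probability to a constant, for random variables on varying probability
spaces. -/
def TendstoInProb (ρ : ∀ N : ℕ, Measure (Signature N)) (X : ∀ N : ℕ, Signature N → ℝ) (c : ℝ) :
    Prop :=
  ∀ ε : ℝ, 0 < ε → Tendsto (fun N => ρ N {l | ε ≤ |X N l - c|}) atTop (𝓝 0)

namespace TendstoInProb

variable {ρ : ∀ N : ℕ, Measure (Signature N)} {X Y : ∀ N : ℕ, Signature N → ℝ} {a b : ℝ}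

theorem congr (h : TendstoInProb ρ X a) (hXY : ∀ᶠ N in atTop, ∀ l, X N l = Y N l) :
    TendstoInProb ρ Y a := by
  intro ε hε
  refine (h ε hε).congr' ?_
  filter_upwards [hXY] with N hN
  simp only [hN]

theorem add (hX : TendstoInProb ρ X a) (hY : TendstoInProb ρ Y b) :
    TendstoInProb ρ (fun N l => X N l + Y N l) (a + b) := by
  intro ε hε
  have h1 := (hX (ε / 2) (half_pos hε)).add (hY (ε / 2) (half_pos hε))
  rw [add_zero] at h1
  refine tendsto_of_tendsto_of_tendsto_of_le_of_le tendsto_const_nhds h1 (fun _ => zero_le)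
    fun N => (measure_mono ?_).trans (measure_union_le _ _)
  intro l hl
  by_contra hcon
  simp only [Set.mem_union, Set.mem_ofPred_eq, not_or, not_le] at hcon hl
  have h2 : X N l + Y N l - (a + b) = (X N l - a) + (Y N l - b) := by ring
  rw [h2] at hl
  have := abs_add_le (X N l - a) (Y N l - b)
  linarith [hcon.1, hcon.2]

theorem mul_of_tendsto_zero (hX : TendstoInProb ρ X a) {c : ℕ → ℝ} (hc : Tendsto c atTop (𝓝 0)) :
    TendstoInProb ρ (fun N l => c N * X N l) 0 := by
  intro ε hε
  have h1 : Tendsto (fun N => |c N| * (|a| + 1)) atTop (𝓝 0) := by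
    simpa using hc.abs.mul_const (|a| + 1)
  refine tendsto_of_tendsto_of_tendsto_of_le_of_le' tendsto_const_nhds (hX 1 one_pos)
    (Eventually.of_forall fun _ => zero_le) ?_
  filter_upwards [h1.eventually_lt_const hε] with N hN
  refine measure_mono fun l hl => ?_
  by_contra hcon
  simp only [Set.mem_ofPred_eq, not_le, sub_zero, abs_mul] at hcon hl
  have h2 : |X N l| ≤ |a| + 1 := by
    have := abs_sub_abs_le_abs_sub (X N l) a
    linarith
  have := mul_le_mul_of_nonneg_left h2 (abs_nonneg (c N))
  linarith

/-- Chebyshev's inequality: convergence of the first two moments to those of a constant. -/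
theorem of_tendsto_moments (hprob : ∀ N, IsProbabilityMeasure (ρ N)) {p q : ℕ → ℝ}
    (hp : ∀ N, 1 ≤ N → HasSum (fun l => (ρ N).real {l} * X N l) (p N))
    (hq : ∀ N, 1 ≤ N → HasSum (fun l => (ρ N).real {l} * X N l ^ 2) (q N))
    (hpa : Tendsto p atTop (𝓝 a)) (hqa : Tendsto q atTop (𝓝 (a ^ 2))) :
    TendstoInProb ρ X a := by
  intro ε hε
  have hv : Tendsto (fun N => q N - 2 * a * p N + a ^ 2) atTop (𝓝 0) := by
    have := (hqa.sub (hpa.const_mul (2 * a))).add_const (a ^ 2)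
    have h0 : a ^ 2 - 2 * a * a + a ^ 2 = 0 := by ring
    rwa [h0] at this
  have h1 : Tendsto (fun N => ENNReal.ofReal ((q N - 2 * a * p N + a ^ 2) / ε ^ 2)) atTop
      (𝓝 0) := by
    have := ENNReal.tendsto_ofReal (hv.div_const (ε ^ 2))
    simpa using this
  refine tendsto_of_tendsto_of_tendsto_of_le_of_le' tendsto_const_nhds h1
    (Eventually.of_forall fun _ => zero_le) ?_
  filter_upwards [eventually_ge_atTop 1] with N hN
  have hsum : HasSum (fun l => (ρ N).real {l} * ((X N l - a) ^ 2 / ε ^ 2))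
      ((q N - 2 * a * p N + a ^ 2) / ε ^ 2) := by
    have h2 := ((hq N hN).sub ((hp N hN).mul_left (2 * a))).add
      ((hasSum_measureReal_singleton (ρ N)).mul_left (a ^ 2))
    rw [mul_one] at h2
    refine (h2.div_const (ε ^ 2)).congr_fun fun l => ?_
    ring
  have hnn : ∀ l : Signature N, 0 ≤ (ρ N).real {l} * ((X N l - a) ^ 2 / ε ^ 2) := fun l =>
    mul_nonneg measureReal_nonneg (by positivity)
  rw [← hsum.tsum_eq, ENNReal.ofReal_tsum_of_nonneg hnn hsum.summable]
  set A : Set (Signature N) := {l | ε ≤ |X N l - a|} with hA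
  have hAm : MeasurableSet A := A.to_countable.measurableSet
  calc ρ N A = ∫⁻ l, A.indicator 1 l ∂(ρ N) := (lintegral_indicator_one hAm).symm
    _ = ∑' l, A.indicator 1 l * ρ N {l} := lintegral_countable' _
    _ ≤ _ := by
      refine ENNReal.tsum_le_tsum fun l => ?_
      by_cases hl : l ∈ A
      · rw [Set.indicator_of_mem hl, Pi.one_apply, one_mul]
        have h3 : 1 ≤ (X N l - a) ^ 2 / ε ^ 2 := by
          rw [one_le_div (by positivity), ← sq_abs (X N l - a)]
          exact pow_le_pow_left₀ hε.le hl 2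
        calc ρ N {l} = ENNReal.ofReal ((ρ N).real {l}) :=
              (ENNReal.ofReal_toReal (measure_ne_top _ _)).symm
          _ ≤ _ := ENNReal.ofReal_le_ofReal (le_mul_of_one_le_right measureReal_nonneg h3)
      · rw [Set.indicator_of_notMem hl, zero_mul]
        exact zero_le

end TendstoInProb

open MvPowerSeries in
/-- The normalized factorial moments converge in probability: their first two moments are read off
from the generating series by applying the moment operator once and twice. -/
theorem tendstoInProb_mixedMoment_zero
    (ρ : ∀ N : ℕ, Measure (Signature N)) (hprob : ∀ N, IsProbabilityMeasure (ρ N))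
    (hconv : ∀ N, 1 ≤ N → ∀ᶠ x : Fin N → ℂ in 𝓝 (fun _ => 1), Summable (sgfTerm (ρ N) x))
    {L : ∀ N : ℕ, Fin N → MvPowerSeries (Fin N) ℂ} {G : ∀ n : ℕ, MvPowerSeries (Fin (n + 1)) ℂ}
    (h : LogDerivConverges (fun N => schurSeries (ρ N)) L G) (k : ℕ) :
    ((formalMoment G k).re : ℂ) = formalMoment G k ∧
      TendstoInProb ρ (fun _ => mixedMoment k 0) (formalMoment G k).re := by
  set Q : ∀ N : ℕ, MvPowerSeries (Fin N) ℂ := fun N => momentQuot k (N : ℂ) 1 (L N) with hQ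
  set Q' : ∀ N : ℕ, MvPowerSeries (Fin N) ℂ := fun N => momentQuot k (N : ℂ) (Q N) (L N) with hQ'
  set M := formalMoment G k with hM
  have hone : UnifBdd fun N _ => (1 : MvPowerSeries (Fin N) ℂ) :=
    by simpa using UnifBdd.one_add_X_pow 0
  have hQb : UnifBdd fun N _ => Q N := h.unifBdd_momentQuot hone k
  have hQs : ∀ N, 1 ≤ N → ∀ π : Equiv.Perm (Fin N), permAct π (Q N) = Q N := by
    intro N hN π
    have hN0 : (N : ℂ) ≠ 0 := Nat.cast_ne_zero.2 (by omega)
    have h1 := momentOp_mul_eq k hN0 1 (h.symm N hN) (h.pderiv_eq N)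
    have h2 := permAct_momentOp k (h.symm N hN) π
    rw [one_mul] at h1
    rw [h1, map_smul, map_mul, h.symm N hN] at h2
    exact mul_left_cancel₀ (h.ne_zero N hN) (smul_right_injective _ (pow_ne_zero _ hN0) h2)
  have hlim1 : Tendsto (fun N => constantCoeff (Q N)) atTop (𝓝 M) := by
    have h1 := (h.tendsto_constantCoeff_momentQuot hone (fun N _ π => map_one _) k).add_const M
    rw [zero_add] at h1
    refine h1.congr fun N => ?_
    rw [map_one, one_mul, sub_add_cancel]
  have hlim2 : Tendsto (fun N => constantCoeff (Q' N)) atTop (𝓝 (M ^ 2)) := by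
    have h1 := (h.tendsto_constantCoeff_momentQuot hQb hQs k).add (hlim1.mul_const M)
    rw [zero_add, ← sq] at h1
    exact h1.congr fun N => sub_add_cancel _ _
  have hsum0 : ∀ N, 1 ≤ N → CoeffHasSum
      (fun l => ((ρ N).real {l} : ℂ) • taylor (normSchur l)) (1 * schurSeries (ρ N)) := by
    intro N hN
    rw [one_mul]
    exact coeffHasSum_schurSeries (hconv N hN)
  have hsum1 : ∀ N (hN : 1 ≤ N), CoeffHasSum
      (fun l => (((ρ N).real {l} : ℂ) * (mixedMoment k 0 l : ℂ)) • taylor (normSchur l))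
      (Q N * schurSeries (ρ N)) := fun N hN =>
    coeffHasSum_mul_mixedMoment hN (h.symm N hN) (h.pderiv_eq N) (hsum0 N hN) k
  have hsum2 : ∀ N (hN : 1 ≤ N), CoeffHasSum
      (fun l => (((ρ N).real {l} : ℂ) * (mixedMoment k 0 l : ℂ) * (mixedMoment k 0 l : ℂ)) •
        taylor (normSchur l)) (Q' N * schurSeries (ρ N)) := fun N hN =>
    coeffHasSum_mul_mixedMoment hN (h.symm N hN) (h.pderiv_eq N) (hsum1 N hN) k
  have hw1 : ∀ N, 1 ≤ N → HasSum (fun l => (((ρ N).real {l} * mixedMoment k 0 l : ℝ) : ℂ))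
      (constantCoeff (Q N)) := by
    intro N hN
    refine ((hsum1 N hN).hasSum_weights (constantCoeff_schurSeries (ρ N))).congr_fun fun l => ?_
    push_cast
    rfl
  have hw2 : ∀ N, 1 ≤ N → HasSum (fun l => (((ρ N).real {l} * mixedMoment k 0 l ^ 2 : ℝ) : ℂ))
      (constantCoeff (Q' N)) := by
    intro N hN
    refine ((hsum2 N hN).hasSum_weights (constantCoeff_schurSeries (ρ N))).congr_fun fun l => ?_
    push_cast
    ring
  have hMre : (M.re : ℂ) = M := by
    have him : Tendsto (fun N => (constantCoeff (Q N)).im) atTop (𝓝 M.im) :=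
      (Complex.continuous_im.tendsto M).comp hlim1
    have h0 : M.im = 0 := by
      refine tendsto_nhds_unique him (tendsto_const_nhds.congr' ?_)
      filter_upwards [eventually_ge_atTop 1] with N hN
      have := (Complex.hasSum_im (hw1 N hN)).tsum_eq
      simpa using this
    exact Complex.ext rfl (by simp [h0])
  refine ⟨hMre, TendstoInProb.of_tendsto_moments hprob (p := fun N => (constantCoeff (Q N)).re)
    (q := fun N => (constantCoeff (Q' N)).re) ?_ ?_ ?_ ?_⟩
  · intro N hN
    simpa only [Complex.ofReal_re] using Complex.hasSum_re (hw1 N hN)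
  · intro N hN
    simpa only [Complex.ofReal_re] using Complex.hasSum_re (hw2 N hN)
  · exact (Complex.continuous_re.tendsto M).comp hlim1
  · have h1 := (Complex.continuous_re.tendsto (M ^ 2)).comp hlim2
    have h2 : (M ^ 2).re = M.re ^ 2 := by
      rw [← hMre, ← Complex.ofReal_pow, Complex.ofReal_re, Complex.ofReal_re]
    rwa [h2] at h1

/-- Falling factorials may be replaced by powers, one factor at a time. -/
theorem tendstoInProb_mixedMoment {ρ : ∀ N : ℕ, Measure (Signature N)} {m : ℕ → ℝ}
    (h : ∀ k, TendstoInProb ρ (fun _ => mixedMoment k 0) (m k)) (j r : ℕ) :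
    TendstoInProb ρ (fun _ => mixedMoment j r) (m (j + r)) := by
  induction r generalizing j with
  | zero => exact h j
  | succ r ih =>
    have h1 : Tendsto (fun N : ℕ => (j : ℝ) / N) atTop (𝓝 0) :=
      tendsto_const_div_atTop_nhds_zero_nat (j : ℝ)
    have h2 := (ih (j + 1)).add ((ih j).mul_of_tendsto_zero h1)
    rw [add_zero, add_right_comm, add_assoc] at h2
    refine h2.congr ?_
    filter_upwards [eventually_ge_atTop 1] with N hN l
    exact (mixedMoment_succ hN j r l).symm

theorem isProbabilityMeasure_empiricalMeasure {N : ℕ} (hN : 1 ≤ N) (l : Signature N) :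
    IsProbabilityMeasure (empiricalMeasure l) := by
  constructor
  rw [empiricalMeasure, Measure.smul_apply, Measure.finsetSum_apply]
  simp only [measure_univ, Finset.sum_const, Finset.card_univ, Fintype.card_fin, nsmul_eq_mul,
    mul_one, smul_eq_mul]
  exact ENNReal.inv_mul_cancel (by exact_mod_cast (by omega : N ≠ 0)) (ENNReal.natCast_ne_top N)

theorem integrable_empiricalMeasure {N : ℕ} (hN : 1 ≤ N) (l : Signature N) (f : ℝ → ℝ) :
    Integrable f (empiricalMeasure l) := by
  refine Integrable.smul_measure ?_ (ENNReal.inv_ne_top.2 (by exact_mod_cast (by omega : N ≠ 0)))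
  exact integrable_finsetSum_measure.2 fun i _ => integrable_dirac (by simp)

theorem integral_empiricalMeasure {N : ℕ} (k : ℕ) (l : Signature N) :
    ∫ x : ℝ, x ^ k ∂(empiricalMeasure l) = mixedMoment 0 k l := by
  rw [empiricalMeasure, integral_smul_measure,
    integral_finsetSum_measure fun i _ => integrable_dirac (by simp), mixedMoment]
  simp only [integral_dirac, Finset.range_zero, Finset.prod_empty, one_mul, div_pow,
    ← Finset.sum_div, ENNReal.toReal_inv, ENNReal.toReal_natCast, smul_eq_mul, zero_add]
  rw [pow_succ, mul_inv, mul_comm _ (N : ℝ)⁻¹, mul_assoc, div_eq_inv_mul]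
  congr 3
  funext i
  congr 1
  rw [position]
  push_cast
  rfl

end Probability

/-! ### The limiting measure -/

section MomentLimit

/-- Truncation of a real number to `[-R, R]`. -/
noncomputable def clamp (R y : ℝ) : ℝ := max (-R) (min R y)

theorem continuous_clamp (R : ℝ) : Continuous (clamp R) := by
  unfold clamp
  fun_prop

theorem abs_clamp_le {R : ℝ} (hR : 0 ≤ R) (y : ℝ) : |clamp R y| ≤ R := by
  rw [abs_le, clamp]
  exact ⟨le_max_left _ _, max_le (by linarith) (min_le_left _ _)⟩

theorem abs_clamp_sub_le {R : ℝ} (hR : 0 < R) (y : ℝ) : |clamp R y - y| ≤ y ^ 2 / R := by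
  have h0 : 0 ≤ y ^ 2 / R := by positivity
  rw [clamp]
  rcases le_total R y with h | h
  · rw [min_eq_left h, max_eq_right (by linarith), abs_le, le_div_iff₀ hR, neg_le, le_div_iff₀ hR]
    constructor <;> nlinarith
  · rw [min_eq_right h]
    rcases le_total (-R) y with h' | h'
    · rw [max_eq_right h', sub_self, abs_zero]
      exact h0
    · rw [max_eq_left h', abs_le, le_div_iff₀ hR, neg_le, le_div_iff₀ hR]
      constructor <;> nlinarith

/-- The truncated power `x ↦ clamp R (x ^ k)` as a bounded continuous function. -/
noncomputable def clampPow (k : ℕ) {R : ℝ} (hR : 0 ≤ R) : BoundedContinuousFunction ℝ ℝ :=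
  BoundedContinuousFunction.ofNormedAddCommGroup (fun x => clamp R (x ^ k))
    ((continuous_clamp R).comp (continuous_pow k)) R fun _ => abs_clamp_le hR _

theorem clampPow_apply (k : ℕ) {R : ℝ} (hR : 0 ≤ R) (x : ℝ) :
    clampPow k hR x = clamp R (x ^ k) := rfl

theorem abs_integral_clampPow_sub_le {ν : Measure ℝ} [IsProbabilityMeasure ν]
    (hν : ∀ k : ℕ, Integrable (fun x : ℝ => x ^ k) ν) (k : ℕ) {R : ℝ} (hR : 0 < R) :
    |∫ x, clampPow k hR.le x ∂ν - ∫ x, x ^ k ∂ν| ≤ (∫ x, x ^ (2 * k) ∂ν) / R := by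
  rw [← integral_sub (BoundedContinuousFunction.integrable ν _) (hν k), ← integral_div]
  refine (abs_integral_le_integral_abs).trans (integral_mono ?_ ((hν (2 * k)).div_const R) ?_)
  · exact ((BoundedContinuousFunction.integrable ν _).sub (hν k)).abs
  · intro x
    have := abs_clamp_sub_le hR (x ^ k)
    rwa [← pow_mul, mul_comm k 2] at this

/-- The moment problem is solvable for limits of moment sequences: if all moments of a sequence of
probability measures converge, the limits are the moments of a probability measure. -/
theorem exists_measure_of_tendsto_moments {ν : ℕ → Measure ℝ}
    (hprob : ∀ j, IsProbabilityMeasure (ν j))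
    (hint : ∀ j k, Integrable (fun x : ℝ => x ^ k) (ν j)) {m : ℕ → ℝ}
    (hlim : ∀ k, Tendsto (fun j => ∫ x, x ^ k ∂(ν j)) atTop (𝓝 (m k))) :
    ∃ μ : Measure ℝ, IsProbabilityMeasure μ ∧ (∀ k : ℕ, Integrable (fun x : ℝ => x ^ k) μ) ∧
      ∀ k : ℕ, ∫ x, x ^ k ∂μ = m k := by
  have hbdd : ∀ k, ∃ C : ℝ, ∀ j, ∫ x, x ^ k ∂(ν j) ≤ C := fun k =>
    let ⟨C, hC⟩ := (hlim k).bddAbove_range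
    ⟨C, fun j => hC ⟨j, rfl⟩⟩
  choose C hC using hbdd
  set P : ℕ → ProbabilityMeasure ℝ := fun j => ⟨ν j, hprob j⟩ with hP
  have htight : IsTightMeasureSet {((μ : ProbabilityMeasure ℝ) : Measure ℝ) | μ ∈ Set.range P} := by
    rw [isTightMeasureSet_iff_exists_isCompact_measure_compl_le]
    intro ε hε
    -- Markov's inequality for the second moment
    have hmarkov : ∀ R : ℝ, 0 < R → ∀ j,
        ν j (Metric.closedBall 0 R)ᶜ ≤ ENNReal.ofReal (C 2 / R ^ 2) := by
      intro R hR j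
      have h1 := mul_meas_ge_le_integral_of_nonneg (μ := ν j)
        (Eventually.of_forall fun x : ℝ => sq_nonneg x) (hint j 2) (R ^ 2)
      have h2 : (ν j).real {x : ℝ | R ^ 2 ≤ x ^ 2} ≤ C 2 / R ^ 2 := by
        rw [le_div_iff₀ (by positivity), mul_comm]
        exact h1.trans (hC 2 j)
      refine le_trans (measure_mono ?_) (ENNReal.le_ofReal_iff_toReal_le (measure_ne_top _ _)
        (measureReal_nonneg.trans h2) |>.2 h2)
      intro x hx
      rw [Set.mem_compl_iff, mem_closedBall_zero_iff, not_le, Real.norm_eq_abs] at hx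
      show R ^ 2 ≤ x ^ 2
      rw [← sq_abs x]
      exact pow_le_pow_left₀ hR.le hx.le 2
    have ht : Tendsto (fun R : ℝ => ENNReal.ofReal (C 2 / R ^ 2)) atTop (𝓝 0) := by
      have h1 : Tendsto (fun R : ℝ => C 2 / R ^ 2) atTop (𝓝 0) :=
        tendsto_const_nhds.div_atTop (tendsto_pow_atTop two_ne_zero)
      simpa using ENNReal.tendsto_ofReal h1
    obtain ⟨R, hR, hR0⟩ := ((ht.eventually_le_const hε).and (eventually_gt_atTop 0)).exists
    refine ⟨Metric.closedBall 0 R, isCompact_closedBall 0 R, ?_⟩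
    rintro _ ⟨_, ⟨j, rfl⟩, rfl⟩
    exact (hmarkov R hR0 j).trans hR
  have hcpt := isCompact_closure_of_isTightMeasureSet htight
  -- Prokhorov's theorem gives a weak limit along an ultrafilter
  set 𝒰 := hyperfilter ℕ with h𝒰
  have hle : (𝒰 : Filter ℕ) ≤ atTop := Nat.hyperfilter_le_atTop
  obtain ⟨μ, -, hμ⟩ := hcpt.ultrafilter_le_nhds (𝒰.map P) (by
    refine le_trans ?_ (principal_mono.2 subset_closure)
    rw [le_principal_iff]
    exact Ultrafilter.mem_map.2 (univ_mem' fun j => ⟨j, rfl⟩))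
  have hweak : ∀ f : BoundedContinuousFunction ℝ ℝ,
      Tendsto (fun j => ∫ x, f x ∂(ν j)) 𝒰 (𝓝 (∫ x, f x ∂(μ : Measure ℝ))) :=
    ProbabilityMeasure.tendsto_iff_forall_integral_tendsto.1 hμ
  have hlim' : ∀ k, Tendsto (fun j => ∫ x, x ^ k ∂(ν j)) 𝒰 (𝓝 (m k)) :=
    fun k => (hlim k).mono_left hle
  -- even powers are integrable, by monotone convergence of truncations
  have heven : ∀ k : ℕ, Integrable (fun x : ℝ => x ^ (2 * k)) (μ : Measure ℝ) := by
    intro k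
    have hnn : ∀ x : ℝ, 0 ≤ x ^ (2 * k) := fun x => (even_two_mul k).pow_nonneg x
    have hcl : ∀ (n : ℕ) (x : ℝ), clamp n (x ^ (2 * k)) = min (n : ℝ) (x ^ (2 * k)) := by
      intro n x
      have hn : (0 : ℝ) ≤ n := Nat.cast_nonneg n
      rw [clamp, max_eq_right]
      exact (neg_nonpos.2 hn).trans (le_min hn (hnn x))
    have htrunc : ∀ n : ℕ, ∫⁻ x, ENNReal.ofReal (min (n : ℝ) (x ^ (2 * k))) ∂(μ : Measure ℝ) ≤
        ENNReal.ofReal (m (2 * k)) := by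
      intro n
      have hn : (0 : ℝ) ≤ n := Nat.cast_nonneg n
      have h1 : ∫ x, clampPow (2 * k) hn x ∂(μ : Measure ℝ) ≤ m (2 * k) := by
        refine le_of_tendsto_of_tendsto' (hweak _) (hlim' (2 * k)) fun j => ?_
        refine integral_mono (BoundedContinuousFunction.integrable _ _) (hint j _) fun x => ?_
        rw [clampPow_apply, hcl]
        exact min_le_right _ _
      rw [← ofReal_integral_eq_lintegral_ofReal]
      · refine ENNReal.ofReal_le_ofReal (le_trans (le_of_eq ?_) h1)
        exact integral_congr_ae (Eventually.of_forall fun x => (hcl n x).symm)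
      · refine (BoundedContinuousFunction.integrable (μ : Measure ℝ) (clampPow (2 * k) hn)).congr
          (Eventually.of_forall fun x => ?_)
        exact hcl n x
      · exact Eventually.of_forall fun x => le_min hn (hnn x)
    have hsup : ∫⁻ x, ENNReal.ofReal (x ^ (2 * k)) ∂(μ : Measure ℝ) ≤
        ENNReal.ofReal (m (2 * k)) := by
      have hmono : Monotone fun (n : ℕ) (x : ℝ) => ENNReal.ofReal (min (n : ℝ) (x ^ (2 * k))) :=
        fun n n' hnn' x => ENNReal.ofReal_le_ofReal
          (min_le_min_right _ (Nat.cast_le.2 hnn'))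
      refine le_of_tendsto' (lintegral_tendsto_of_tendsto_of_monotone (fun n => ?_)
        (Eventually.of_forall fun x n n' h => hmono h x)
        (Eventually.of_forall fun x => ?_)) htrunc
      · fun_prop
      · refine tendsto_const_nhds.congr' ?_
        obtain ⟨n₀, hn₀⟩ := exists_nat_ge (x ^ (2 * k))
        filter_upwards [eventually_ge_atTop n₀] with n hn
        rw [min_eq_right (hn₀.trans (Nat.cast_le.2 hn))]
    refine ⟨by fun_prop, ?_⟩
    rw [hasFiniteIntegral_iff_ofReal (Eventually.of_forall hnn)]
    exact hsup.trans_lt ENNReal.ofReal_lt_top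
  have hint' : ∀ k : ℕ, Integrable (fun x : ℝ => x ^ k) (μ : Measure ℝ) := by
    intro k
    refine ((integrable_const (1 : ℝ)).add (heven k)).mono' (by fun_prop)
      (Eventually.of_forall fun x => ?_)
    rw [Real.norm_eq_abs, Pi.add_apply, mul_comm, pow_mul, ← sq_abs (x ^ k)]
    nlinarith [sq_nonneg (|x ^ k| - 1)]
  refine ⟨μ, μ.2, hint', fun k => ?_⟩
  set K := C (2 * k) + ∫ x, x ^ (2 * k) ∂(μ : Measure ℝ) with hK
  -- truncation changes the moments by at most `O(1 / R)`, uniformly in the sequence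
  have hest : ∀ R : ℝ, 0 < R → |m k - ∫ x, x ^ k ∂(μ : Measure ℝ)| ≤ K / R := by
    intro R hR
    have h1 := abs_integral_clampPow_sub_le hint' k hR
    have h2 : |∫ x, clampPow k hR.le x ∂(μ : Measure ℝ) - m k| ≤ C (2 * k) / R := by
      refine le_of_tendsto ((hweak (clampPow k hR.le)).sub (hlim' k)).abs
        (Eventually.of_forall fun j => ?_)
      refine (abs_integral_clampPow_sub_le (hint j) k hR).trans ?_
      gcongr
      exact hC _ j
    rw [abs_sub_comm] at h2
    have h3 := abs_sub_le (m k) (∫ x, clampPow k hR.le x ∂(μ : Measure ℝ))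
      (∫ x, x ^ k ∂(μ : Measure ℝ))
    rw [hK, add_div]
    linarith
  have hzero : |m k - ∫ x, x ^ k ∂(μ : Measure ℝ)| ≤ 0 :=
    ge_of_tendsto (tendsto_const_nhds.div_atTop tendsto_id)
      ((eventually_gt_atTop 0).mono fun R hR => hest R hR)
  exact (sub_eq_zero.1 (abs_nonpos_iff.1 hzero)).symm

/-- Limits in probability of the moments of the empirical measures are limits of the moments of a
deterministic sequence of empirical measures, hence moments of a probability measure. -/
theorem exists_measure_of_tendstoInProb {ρ : ∀ N : ℕ, Measure (Signature N)}
    (hprob : ∀ N, IsProbabilityMeasure (ρ N)) {m : ℕ → ℝ}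
    (h : ∀ k, TendstoInProb ρ (fun _ => mixedMoment 0 k) (m k)) :
    ∃ μ : Measure ℝ, IsProbabilityMeasure μ ∧ (∀ k : ℕ, Integrable (fun x : ℝ => x ^ k) μ) ∧
      ∀ k : ℕ, ∫ x, x ^ k ∂μ = m k := by
  have hex : ∀ j : ℕ, ∃ (N : ℕ) (l : Signature N), 1 ≤ N ∧
      ∀ k ∈ Finset.range (j + 1), |mixedMoment 0 k l - m k| < 1 / ((j : ℝ) + 1) := by
    intro j
    have hpos : (0 : ℝ) < 1 / ((j : ℝ) + 1) := by positivity
    have h1 : Tendsto (fun N => ∑ k ∈ Finset.range (j + 1),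
        ρ N {l | 1 / ((j : ℝ) + 1) ≤ |mixedMoment 0 k l - m k|}) atTop (𝓝 0) := by
      have := tendsto_finsetSum (Finset.range (j + 1)) fun k _ => h k _ hpos
      simpa using this
    obtain ⟨N, hN, hN1⟩ := ((h1.eventually_lt_const one_pos).and (eventually_ge_atTop 1)).exists
    by_contra hcon
    push Not at hcon
    have hcover : (Set.univ : Set (Signature N)) ⊆ ⋃ k ∈ Finset.range (j + 1),
        {l | 1 / ((j : ℝ) + 1) ≤ |mixedMoment 0 k l - m k|} := by
      intro l _
      obtain ⟨k, hk, hkl⟩ := hcon N l hN1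
      exact Set.mem_biUnion (Finset.mem_coe.2 hk) hkl
    have h2 := (measure_mono hcover).trans (measure_biUnion_finset_le (μ := ρ N) _ _)
    rw [measure_univ] at h2
    exact absurd hN (not_lt.2 h2)
  choose N l hN hl using hex
  refine exists_measure_of_tendsto_moments (ν := fun j => empiricalMeasure (l j))
    (fun j => isProbabilityMeasure_empiricalMeasure (hN j) (l j))
    (fun j k => integrable_empiricalMeasure (hN j) (l j) _) fun k => ?_
  simp only [integral_empiricalMeasure]
  rw [tendsto_iff_norm_sub_tendsto_zero]
  refine squeeze_zero' (Eventually.of_forall fun j => norm_nonneg _) ?_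
    tendsto_one_div_add_atTop_nhds_zero_nat
  filter_upwards [eventually_ge_atTop k] with j hj
  exact (hl j k (Finset.mem_range.2 (by omega))).le

end MomentLimit

end SchurLLN

theorem mainTheorem1
    (ρ : ∀ N : ℕ, Measure (SchurLLN.Signature N))
    (hprob : ∀ N, IsProbabilityMeasure (ρ N))
    (hconv : ∀ N, 1 ≤ N →
      ∀ᶠ x : Fin N → ℂ in 𝓝 (fun _ => 1), Summable (SchurLLN.sgfTerm (ρ N) x))
    (F : ∀ k : ℕ, (Fin k → ℂ) → ℂ)
    (hFan : ∀ k, 1 ≤ k → AnalyticAt ℂ (F k) (fun _ => 1))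
    (hFsymm : ∀ k, 1 ≤ k → ∀ σ : Equiv.Perm (Fin k),
      ∀ᶠ u : Fin k → ℂ in 𝓝 (fun _ => 1), F k (u ∘ σ) = F k u)
    (hlim : ∀ k, 1 ≤ k → SchurLLN.RootConverges ρ k (F k)) :
    ∃ μ : Measure ℝ, IsProbabilityMeasure μ ∧
      (∀ k : ℕ, Integrable (fun x : ℝ => x ^ k) μ) ∧
      (∀ k : ℕ, 1 ≤ k → ((∫ x : ℝ, x ^ k ∂μ : ℝ) : ℂ) = SchurLLN.limitMoment F k) ∧
      (∀ k : ℕ, 1 ≤ k → ∀ ε : ℝ, 0 < ε →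
        Tendsto
          (fun N : ℕ => ρ N {l : SchurLLN.Signature N |
            ε ≤ |(∫ x : ℝ, x ^ k ∂(SchurLLN.empiricalMeasure l)) - ∫ x : ℝ, x ^ k ∂μ|})
          atTop (𝓝 0)) := by
  have hL := SchurLLN.logDerivConverges_schurSeries ρ hprob hconv F hFan hlim
  have hF := SchurLLN.formalMoment_limitSeries F hFan hFsymm
    fun k hk => SchurLLN.limit_apply_one (hlim k hk)
  have hX := SchurLLN.tendstoInProb_mixedMoment_zero ρ hprob hconv hL
  simp only [hF] at hX
  have hmom : ∀ k, SchurLLN.TendstoInProb ρ (fun _ => SchurLLN.mixedMoment 0 k)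
      (SchurLLN.limitMoment F k).re := by
    intro k
    have h1 := SchurLLN.tendstoInProb_mixedMoment (fun k => (hX k).2) 0 k
    rwa [zero_add] at h1
  obtain ⟨μ, hμ, hint, hm⟩ := SchurLLN.exists_measure_of_tendstoInProb hprob hmom
  refine ⟨μ, hμ, hint, fun k _ => ?_, fun k _ ε hε => ?_⟩
  · rw [hm, (hX k).1]
  · simp only [SchurLLN.integral_empiricalMeasure, hm]
    exact hmom k ε hε
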